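/- **Notation.** For $f:\mathbb R^3\to\mathbb C$ measurable, let $$\|f\|_B=\sum_{j\ge -1}\Big(2^{j+1}\int_{C(j)}|f|^2\,dx\Big)^{1/2},$$ where $C(-1)$ is the unit ball and $C(j)=\{2^j\le|x|<2^{j+1}\}$ for $j\ge 0$; $B$ is the space of $f$ with $\|f\|_B<\infty$. The Fourier transform is $\mathcal F f(\xi)=(2\pi)^{-3}\int_{\mathbb R^3} e^{-ix\cdot\xi}f(x)\,dx$. Let $q_1\in\mathbb R^3\setminus\{0\}$ and, for $\varepsilon>0$, let $\alpha_\varepsilon>0$ with $\alpha_\varepsilon\to0$ as $\varepsilon\to0$. For $S_0,S_1\in B$ let $u^\varepsilon\in L^2(\mathbb R^3)$ be the solution of $$-i\frac{\alpha_\varepsilon}{\varepsilon}u^\varepsilon+\Delta u^\varepsilon+\frac1{\varepsilon^2}u^\varepsilon=\frac1{\varepsilon^3}S_0\Big(\frac x\varepsilon\Big)+\frac1{\varepsilon^3}S_1\Big(\frac{x-q_1}\varepsilon\Big)\qquad\text{in }\mathbb R^3,$$ and let $W^\varepsilon=W^\varepsilon(u^\varepsilon)$ be its Wigner transform, $$W^\varepsilon(x,\xi)=\mathcal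 F_{y\to\xi}\Big(u^\varepsilon\big(x+\tfrac\varepsilon2y\big)\,\overline{u^\varepsilon}\big(x-\tfrac\varepsilon2y\big)\Big).$$ For $\lambda>0$ let $X_\lambda$ be the space of functions $\hat\varphi(x,\xi)=\int_{\mathbb R^3} e^{iy\cdot\xi}\varphi(x,y)\,dy$ on $\mathbb R^3\times\mathbb R^3$ (so that $\varphi(x,\cdot)=\mathcal F_{\xi\to y}\hat\varphi(x,\cdot)$), where $\varphi$ is measurable, continuous in $x$, and $$\|\hat\varphi\|_{X_\lambda}=\int_{\mathbb R^3}\sup_{x\in\mathbb R^3}(1+|x|+|y|)^{1+\lambda}|\varphi(x,y)|\,dy<\infty,$$ and let $W^\varepsilon$ act on it by $$\langle W^\varepsilon,\hat\varphi\rangle=\int_{\mathbb R^6}u^\varepsilon\big(x+\tfrac\varepsilon2y\big)\,\overline{u^\varepsilon}\big(x-\tfrac\varepsilon2y\big)\,\varphi(x,y)\,dx\,dy,$$ which equals $\int W^\varepsilon\hat\varphi\,dx\,d\xi$ when $\hat\varphi$ is integrable. **Theorem 4.1.** There is an absolute constant $C$ such that, for all $q_1$, $(\alpha_\varepsilon)$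 as above, all $S_0,S_1\in B$ and all $\lambda>0$: 1. The Wigner transforms are bounded in the dual $X_\lambda^*$: there is $M<\infty$ such that, for all $\varepsilon\in(0,1]$ and all $\hat\varphi\in X_\lambda$, the integral defining $\langle W^\varepsilon,\hat\varphi\rangle$ converges absolutely and $|\langle W^\varepsilon,\hat\varphi\rangle|\le M\|\hat\varphi\|_{X_\lambda}$. 2. Every sequence $\varepsilon_k\to0$ of positive numbers has a subsequence along which $W^{\varepsilon}$ converges weak-$*$ in $X_\lambda^*$ to a positive, locally bounded measure $\mu$ on $\mathbb R^3_x\times\mathbb R^3_\xi$: every $\hat\varphi\in X_\lambda$ is $\mu$-integrable and $\langle W^{\varepsilon},\hat\varphi\rangle\to\int\hat\varphi\,d\mu$ along the subsequence. Moreover, $$\sup_{R>0}\frac1R\int_{|x|<R}\int_{\xi\in\mathbb R^3}d\mu(x,\xi)\le C\,(\|S_0\|_B+\|S_1\|_B)^2.$$ -/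

import Mathlib

open MeasureTheory Set Filter Topology
open scoped ENNReal NNReal ComplexConjugate SchwartzMap

noncomputable section

/-- Three-dimensional Euclidean space, with its Euclidean norm and Lebesgue measure. -/
abbrev E3 : Type := EuclideanSpace ℝ (Fin 3)

/-! ### The Agmon–Hörmander space `B` -/

/-- The dyadic rings, numbered from `0`: `dyadicRing 0` is the unit ball (the ring `C(-1)`), and
`dyadicRing (j + 1)` is the ring `C(j) = {2 ^ j ≤ |x| < 2 ^ (j + 1)}`. -/
def dyadicRing : ℕ → Set E3
  | 0 => {x | ‖x‖ < 1}
  | j + 1 => {x | 2 ^ j ≤ ‖x‖ ∧ ‖x‖ < 2 ^ (j + 1)}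

/-- The norm `‖f‖_B = ∑_{j ≥ -1} (2 ^ (j + 1) ∫_{C(j)} |f|²) ^ (1 / 2)`, with `k = j + 1`. -/
def bNorm (f : E3 → ℂ) : ℝ≥0∞ :=
  ∑' k : ℕ, (2 ^ k * ∫⁻ x in dyadicRing k, ‖f x‖ₑ ^ 2) ^ (1 / 2 : ℝ)

/-- `f` belongs to the space `B`. -/
def MemB (f : E3 → ℂ) : Prop :=
  AEStronglyMeasurable f volume ∧ bNorm f < ∞

/-! ### The Helmholtz equation with two concentrating sources -/

/-- The source `S^ε(x) = ε⁻³ S₀(x / ε) + ε⁻³ S₁((x - q) / ε)`. -/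
def source (S₀ S₁ : E3 → ℂ) (q : E3) (ε : ℝ) (x : E3) : ℂ :=
  ((ε ^ 3)⁻¹ : ℝ) * S₀ (ε⁻¹ • x) + ((ε ^ 3)⁻¹ : ℝ) * S₁ (ε⁻¹ • (x - q))

/-- `u ∈ L²(ℝ³)` is a solution of `-i (a / ε) u + Δ u + ε⁻² u = S` in the sense of (tempered)
distributions. -/
structure IsHelmholtzSolution (a ε : ℝ) (S u : E3 → ℂ) : Prop where
  memLp : MemLp u 2 volume
  weak : ∀ φ : 𝓢(E3, ℂ),
    ∫ x, u x * (-Complex.I * ((a / ε : ℝ) : ℂ) * φ x + Laplacian.laplacian (φ : E3 → ℂ) x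
        + (((ε ^ 2)⁻¹ : ℝ) : ℂ) * φ x)
      = ∫ x, S x * φ x

/-! ### The Wigner transform -/

/-- The Fourier transform `(2π)⁻³ ∫ e^{-i x·ξ} f(x) dx`. -/
def fourier3 (f : E3 → ℂ) (ξ : E3) : ℂ :=
  (((2 * Real.pi) ^ 3)⁻¹ : ℝ) * ∫ x, Complex.exp (-Complex.I * (inner ℝ x ξ : ℝ)) * f x

/-- The inverse Fourier transform `∫ e^{i y·ξ} g(y) dy`. -/
def fourierInv3 (g : E3 → ℂ) (ξ : E3) : ℂ :=
  ∫ y, Complex.exp (Complex.I * (inner ℝ y ξ : ℝ)) * g y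

/-- The two-point function `u(x + ε y / 2) * conj (u(x - ε y / 2))`. -/
def twoPoint (ε : ℝ) (u : E3 → ℂ) (x y : E3) : ℂ :=
  u (x + (ε / 2) • y) * conj (u (x - (ε / 2) • y))

/-- The Wigner transform `W^ε(u)(x, ξ)`. For `u ∈ L²` and `ε > 0` the integral converges absolutely
at every point. -/
def wigner (ε : ℝ) (u : E3 → ℂ) (x ξ : E3) : ℂ :=
  fourier3 (twoPoint ε u x) ξ

/-- The bracket of `W^ε(u)` with the function `φ^(x, ξ) = fourierInv3 (φ x) ξ`, in terms of `φ`.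
It is the integral of `W^ε(u) φ^` over phase space whenever `φ^` is integrable, see
`integral_wigner_mul`; for the other elements of `X_λ` the latter need not converge absolutely, and
this formula is the extension. -/
def wignerBracket (ε : ℝ) (u : E3 → ℂ) (φ : E3 → E3 → ℂ) : ℂ :=
  ∫ p : E3 × E3, twoPoint ε u p.1 p.2 * φ p.1 p.2

/-! ### The space `X_λ` -/

/-- The norm of `X_λ`, in terms of `φ`:
`∫ sup_x (1 + |x| + |y|) ^ (1 + λ) |φ(x, y)| dy`. -/
def xNorm (lam : ℝ) (φ : E3 → E3 → ℂ) : ℝ≥0∞ :=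
  ∫⁻ y, ⨆ x, ENNReal.ofReal ((1 + ‖x‖ + ‖y‖) ^ (1 + lam)) * ‖φ x y‖ₑ

/-- `φ` is the partial Fourier transform of an element of `X_λ`; that element is the function
`(x, ξ) ↦ fourierInv3 (φ x) ξ`. As usual for such spaces of symbols, `φ` is continuous in `x` (so
that elements of `X_λ` can be integrated against arbitrary measures on phase space). -/
structure MemX (lam : ℝ) (φ : E3 → E3 → ℂ) : Prop where
  measurable : Measurable (Function.uncurry φ)
  continuous : ∀ y, Continuous fun x => φ x y
  norm_lt_top : xNorm lam φ < ∞

theorem measurable_twoPoint {ε : ℝ} {u : E3 → ℂ} (hu : AEStronglyMeasurable u volume) :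
    AEStronglyMeasurable (fun p : E3 × E3 => twoPoint ε u p.1 p.2) (volume.prod volume) := by
  have key : ∀ c : ℝ, AEStronglyMeasurable (fun p : E3 × E3 => u (p.1 + c • p.2))
      (volume.prod volume) := by
    intro c
    have h1 : MeasurePreserving (fun p : E3 × E3 => (p.1, p.2 + c • p.1))
        (volume.prod volume) (volume.prod volume) := by
      refine MeasurePreserving.skew_product (f := id) (g := fun y x => x + c • y)
        (MeasurePreserving.id _) (by fun_prop) (Filter.Eventually.of_forall fun y => ?_)
      exact (measurePreserving_add_right volume (c • y)).map_eq
    have h2 : Measure.QuasiMeasurePreserving (fun p : E3 × E3 => p.1 + c • p.2)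
        (volume.prod volume) volume :=
      (Measure.quasiMeasurePreserving_snd.comp h1.quasiMeasurePreserving).comp
        (Measure.measurePreserving_swap (μ := (volume : Measure E3))
          (ν := (volume : Measure E3))).quasiMeasurePreserving
    exact hu.comp_quasiMeasurePreserving h2
  have h1 := key (ε / 2)
  have h2 := key (-(ε / 2))
  have h3 := h1.mul (Complex.continuous_conj.comp_aestronglyMeasurable h2)
  refine h3.congr (Filter.Eventually.of_forall fun p => ?_)
  simp [twoPoint, sub_eq_add_neg]

theorem lintegral_affine (c : ℝ) (hc : c ≠ 0) (g : E3 → ℝ≥0∞) (hg : AEMeasurable g volume)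
    (x : E3) : ∫⁻ y, g (x + c • y) = ENNReal.ofReal |(c ^ 3)⁻¹| * ∫⁻ z, g z := by
  have h0 : AEMeasurable (fun z => g (x + z)) volume :=
    hg.comp_quasiMeasurePreserving (measurePreserving_add_left volume x).quasiMeasurePreserving
  have h1 := Measure.map_addHaar_smul (volume : Measure E3) hc
  have h2 : AEMeasurable (fun z => g (x + z)) (Measure.map (fun y : E3 => c • y) volume) := by
    rw [h1]; exact h0.smul_measure _
  have h3 := lintegral_map' h2 (by fun_prop)
  rw [← h3, h1, lintegral_smul_measure, lintegral_add_left_eq_self]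
  simp

theorem lintegral_twoPoint_le {ε : ℝ} (hε : ε ≠ 0) {u : E3 → ℂ} (hu : MemLp u 2 volume) :
    ∃ K : ℝ≥0∞, K < ∞ ∧ ∀ x, ∫⁻ y, ‖twoPoint ε u x y‖ₑ ≤ K := by
  have hI : ∫⁻ z, ‖u z‖ₑ ^ 2 < ∞ := by
    have := lintegral_rpow_enorm_lt_top_of_eLpNorm_lt_top (by norm_num) (by norm_num) hu.2
    simpa using this
  have hg : AEMeasurable (fun z => ‖u z‖ₑ ^ 2) volume := hu.1.enorm.pow_const 2
  have hc : ε / 2 ≠ 0 := by positivity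
  refine ⟨ENNReal.ofReal |((ε / 2) ^ 3)⁻¹| * (∫⁻ z, ‖u z‖ₑ ^ 2)
    + ENNReal.ofReal |((-(ε / 2)) ^ 3)⁻¹| * (∫⁻ z, ‖u z‖ₑ ^ 2), ?_, fun x => ?_⟩
  rotate_left
  · calc ∫⁻ y, ‖twoPoint ε u x y‖ₑ
        ≤ ∫⁻ y, (‖u (x + (ε / 2) • y)‖ₑ ^ 2 + ‖u (x + (-(ε / 2)) • y)‖ₑ ^ 2) := by
          refine lintegral_mono fun y => ?_
          simp only [twoPoint, sub_eq_add_neg, neg_smul, enorm_mul, RCLike.enorm_conj]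
          rcases le_total (‖u (x + (ε / 2) • y)‖ₑ) (‖u (x + -((ε / 2) • y))‖ₑ) with h | h
          · calc _ ≤ ‖u (x + -((ε / 2) • y))‖ₑ * ‖u (x + -((ε / 2) • y))‖ₑ := by gcongr
              _ ≤ _ := by rw [← sq]; exact le_add_self
          · calc _ ≤ ‖u (x + (ε / 2) • y)‖ₑ * ‖u (x + (ε / 2) • y)‖ₑ := by gcongr
              _ ≤ _ := by rw [← sq]; exact le_self_add
      _ = _ := by
          rw [lintegral_add_left' ?_, lintegral_affine _ hc _ hg,
            lintegral_affine _ (neg_ne_zero.2 hc) _ hg]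
          have : Measure.QuasiMeasurePreserving (fun y : E3 => x + (ε / 2) • y) volume volume := by
            refine (measurePreserving_add_left volume x).quasiMeasurePreserving.comp
              (g := fun z => x + z) (f := fun y => (ε / 2) • y) ⟨by fun_prop, ?_⟩
            rw [Measure.map_addHaar_smul _ hc]
            exact Measure.smul_absolutelyContinuous
          exact hg.comp_quasiMeasurePreserving this
  · exact ENNReal.add_lt_top.2 ⟨ENNReal.mul_lt_top (by simp) hI, ENNReal.mul_lt_top (by simp) hI⟩

/-- For an integrable function `ψ` on phase space, the integral of `W^ε(u) ψ` is the bracket of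
`W^ε(u)` with the partial Fourier transform of `ψ`. -/
theorem integral_wigner_mul {ε : ℝ} (hε : ε ≠ 0) {u : E3 → ℂ} (hu : MemLp u 2 volume)
    {ψ : E3 → E3 → ℂ} (hψ : Integrable (Function.uncurry ψ)) :
    ∫ p : E3 × E3, wigner ε u p.1 p.2 * ψ p.1 p.2
      = wignerBracket ε u (fun x => fourier3 (ψ x)) := by
  obtain ⟨K, hK, hKx⟩ := lintegral_twoPoint_le hε hu
  have hv := measurable_twoPoint (ε := ε) hu.1
  set c : ℂ := ((((2 * Real.pi) ^ 3)⁻¹ : ℝ) : ℂ) with hcdef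
  let F : E3 × (E3 × E3) → ℂ := fun t =>
    c * (Complex.exp (-Complex.I * (inner ℝ t.2.2 t.2.1 : ℝ)) * twoPoint ε u t.1 t.2.2
      * ψ t.1 t.2.1)
  have hsw : MeasurePreserving (fun t : E3 × (E3 × E3) => (t.1, t.2.swap))
      (volume.prod (volume.prod volume)) (volume.prod (volume.prod volume)) :=
    (MeasurePreserving.id _).prod Measure.measurePreserving_swap
  have hassoc := (measurePreserving_prodAssoc (volume : Measure E3) (volume : Measure E3)
    (volume : Measure E3)).symm
  have mF1 : AEStronglyMeasurable (fun t : E3 × (E3 × E3) => twoPoint ε u t.1 t.2.2)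
      (volume.prod (volume.prod volume)) := by
    have : Measure.QuasiMeasurePreserving (fun t : E3 × (E3 × E3) => (t.1, t.2.2))
        (volume.prod (volume.prod volume)) (volume.prod volume) :=
      (Measure.quasiMeasurePreserving_fst.comp hassoc.quasiMeasurePreserving).comp
        hsw.quasiMeasurePreserving
    exact hv.comp_quasiMeasurePreserving this
  have mF2 : AEStronglyMeasurable (fun t : E3 × (E3 × E3) => ψ t.1 t.2.1)
      (volume.prod (volume.prod volume)) := by
    have : Measure.QuasiMeasurePreserving (fun t : E3 × (E3 × E3) => (t.1, t.2.1))
        (volume.prod (volume.prod volume)) (volume.prod volume) :=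
      Measure.quasiMeasurePreserving_fst.comp hassoc.quasiMeasurePreserving
    exact hψ.1.comp_quasiMeasurePreserving this
  have mF : AEStronglyMeasurable F (volume.prod (volume.prod volume)) := by
    have : Continuous fun t : E3 × (E3 × E3) =>
      Complex.exp (-Complex.I * (inner ℝ t.2.2 t.2.1 : ℝ)) := by fun_prop
    exact ((this.aestronglyMeasurable.mul mF1).mul mF2).const_mul c
  have hexp : ∀ r : ℝ, ‖Complex.exp (-Complex.I * r)‖ₑ = 1 := by
    intro r
    have : -Complex.I * r = ((-r : ℝ) : ℂ) * Complex.I := by push_cast; ring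
    rw [this, ← ofReal_norm, Complex.norm_exp_ofReal_mul_I, ENNReal.ofReal_one]
  have hF : Integrable F (volume.prod (volume.prod volume)) := by
    refine ⟨mF, ?_⟩
    rw [hasFiniteIntegral_iff_enorm, lintegral_prod _ mF.enorm]
    have e1 : ∀ᵐ x, ∫⁻ z : E3 × E3, ‖F (x, z)‖ₑ ∂(volume.prod volume)
        ≤ ‖c‖ₑ * K * ∫⁻ ξ, ‖ψ x ξ‖ₑ := by
      filter_upwards [mF.prodMk_left] with x hx
      rw [lintegral_prod _ hx.enorm]
      simp only [F, enorm_mul, hexp, one_mul]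
      calc ∫⁻ ξ, ∫⁻ y, ‖c‖ₑ * (‖twoPoint ε u x y‖ₑ * ‖ψ x ξ‖ₑ)
          = ∫⁻ ξ, (∫⁻ y, ‖twoPoint ε u x y‖ₑ) * (‖c‖ₑ * ‖ψ x ξ‖ₑ) := by
            refine lintegral_congr fun ξ => ?_
            rw [← lintegral_mul_const' _ _ (by finiteness)]
            refine lintegral_congr fun y => ?_
            ring
        _ ≤ ∫⁻ ξ, (‖c‖ₑ * K) * ‖ψ x ξ‖ₑ := by
            refine lintegral_mono fun ξ => ?_
            calc _ ≤ K * (‖c‖ₑ * ‖ψ x ξ‖ₑ) := by gcongr; exact hKx x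
              _ = _ := by ring
        _ = _ := lintegral_const_mul' _ _ (ENNReal.mul_ne_top (by finiteness) hK.ne)
    refine (lintegral_mono_ae e1).trans_lt ?_
    rw [lintegral_const_mul' _ _ (ENNReal.mul_ne_top (by finiteness) hK.ne)]
    refine ENNReal.mul_lt_top (ENNReal.mul_lt_top (by finiteness) hK) ?_
    have := hψ.2
    rw [hasFiniteIntegral_iff_enorm, Measure.volume_eq_prod, lintegral_prod _ hψ.1.enorm] at this
    exact this
  have hA : Integrable (fun s : (E3 × E3) × E3 => F (s.1.1, (s.1.2, s.2)))
      ((volume.prod volume).prod volume) :=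
    ((measurePreserving_prodAssoc (volume : Measure E3) (volume : Measure E3)
      (volume : Measure E3)).integrable_comp mF).2 hF
  have hF' : Integrable (fun t : E3 × (E3 × E3) => F (t.1, t.2.swap))
      (volume.prod (volume.prod volume)) := (hsw.integrable_comp mF).2 hF
  have hB : Integrable (fun s : (E3 × E3) × E3 => F (s.1.1, (s.2, s.1.2)))
      ((volume.prod volume).prod volume) :=
    ((measurePreserving_prodAssoc (volume : Measure E3) (volume : Measure E3)
      (volume : Measure E3)).integrable_comp hF'.1).2 hF'
  have L : ∫ p : E3 × E3, wigner ε u p.1 p.2 * ψ p.1 p.2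
      = ∫ x, ∫ ξ, ∫ y, F (x, (ξ, y)) := by
    have : ∀ p : E3 × E3, wigner ε u p.1 p.2 * ψ p.1 p.2 = ∫ y, F (p.1, (p.2, y)) := by
      intro p
      simp only [F, wigner, fourier3]
      rw [integral_const_mul, integral_mul_const, mul_assoc]
    simp_rw [this]
    exact integral_prod _ hA.integral_prod_left
  have Rr : wignerBracket ε u (fun x => fourier3 (ψ x))
      = ∫ x, ∫ y, ∫ ξ, F (x, (ξ, y)) := by
    have : ∀ p : E3 × E3, twoPoint ε u p.1 p.2 * fourier3 (ψ p.1) p.2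
        = ∫ ξ, F (p.1, (ξ, p.2)) := by
      intro p
      simp only [F, fourier3]
      rw [integral_const_mul, mul_left_comm, ← integral_const_mul]
      congr 1
      refine integral_congr_ae (Filter.Eventually.of_forall fun ξ => ?_)
      simp only [real_inner_comm p.2 ξ]
      ring
    unfold wignerBracket
    simp_rw [this]
    exact integral_prod _ hB.integral_prod_left
  rw [L, Rr]
  refine integral_congr_ae ?_
  filter_upwards [hF.prod_right_ae] with x hx
  exact integral_integral_swap hx
end

/-! Everything rests on a Morrey bound that is uniform in the centre $z$:
$\int_{B(z,R)}|u^\varepsilon|^2\le 128(\|S_0\|_B+\|S_1\|_B)^2R$ for all $R\ge\varepsilon$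
(`setLIntegral_ball_helmholtz_le`). It is proved by duality. If $g$ is a Schwartz function supported
in a ball and $\varphi$ is the Schwartz solution of the same equation with right-hand side $g$, then
$\int u^\varepsilon g=\int S^\varepsilon\varphi$. So only $\varphi$ near the two source points has
to be controlled, and `eLpNorm_resolvent_le` does it: with $k=1/\varepsilon$,
$\|\varphi\|_{L^2(B(c,r))}\le 8\sqrt{rR}\,k^{-1}\|g\|_{L^2}$, with no relation between $c$ and the
ball carrying $g$. The location of $q$ therefore plays no role. Summed over dyadic rings, the factor
$\sqrt r$ is dual to the norm of $B$ (`lintegral_concentrated_mul_le`).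

The resolvent estimate comes from one dimension. A Fourier transform in the two variables transverse
to an axis turns the equation into $h''-(a+i\eta)h=\gamma$ on a line, where $a=4\pi^2|\xi'|^2-k^2$.
With $\kappa^2=a+i\eta$ the solution satisfies $|h|\le\|\gamma\|_{L^1}/(2|\kappa|)$, which
degenerates only at $a=0$, and multiplying $h$ by $a$ removes the degeneracy. Hence the part of
$\varphi$ with multiplier $a$ is controlled from slab to slab (`AxisSplit.lintegral_slab_le`). The
three multipliers of this kind and the Helmholtz symbol have a linear combination equal to the
constant $k^2$, which recovers $\varphi$.

The Morrey bound makes $(1+|x|)^{-(1+\lambda)}$ integrable against $|u^\varepsilon|^2$ after any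
translation, which is the bound in $X_\lambda^*$. Positivity of the limit comes from the Husimi
measure, the squared modulus of a Fourier transform windowed at width $\sqrt\varepsilon$. It pairs
with a symbol as the Wigner transform pairs with an average of that symbol, and the average
converges to the symbol (`tendsto_wignerBracket_sub_smoothed`). Husimi measures inherit the Morrey
bound, hence are vaguely compact once weighted. Elements of $X_\lambda$ vanish at infinity in phase
space even when multiplied by $(1+|x|)^{1+\lambda/2}$, so vague convergence reaches all of them.
Mass bounds on open cylinders survive in the limit, at every radius $R>0$ because eventually
$\varepsilon\le R$. -/

open scoped FourierTransform

/-! ### First and second order equations on the line -/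

/-- The factor $e^{-\kappa(s-x)}$ turns $p'-\kappa p$ into an exact derivative and has modulus at
most $1$ to the right of $x$. The bound does not deteriorate as $\operatorname{Re}\kappa\to0$, which
is what makes the final estimate uniform in the absorption. -/
theorem norm_le_setIntegral_Ioi_deriv_sub {κ : ℂ} (hκ : 0 < κ.re) (p : 𝓢(ℝ, ℂ)) (x : ℝ) :
    ‖p x‖ ≤ ∫ s in Ioi x, ‖deriv p s - κ * p s‖ := by
  have hd : ∀ s, HasDerivAt (fun s : ℝ => Complex.exp (-κ * ((s - x : ℝ) : ℂ)) * p s)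
      (Complex.exp (-κ * ((s - x : ℝ) : ℂ)) * (deriv p s - κ * p s)) s := by
    intro s
    have h1 : HasDerivAt (fun s : ℝ => ((s - x : ℝ) : ℂ)) 1 s := by
      simpa using ((hasDerivAt_id s).sub_const x).ofReal_comp
    have h2 := ((h1.const_mul (-κ)).cexp).mul (p.hasDerivAt s)
    refine h2.congr_deriv ?_
    ring
  have hk : Integrable (fun s => deriv p s - κ * p s) :=
    (SchwartzMap.derivCLM ℂ ℂ p).integrable.sub (p.integrable.const_mul κ)
  have hnorm : ∀ s : ℝ, ‖Complex.exp (-κ * ((s - x : ℝ) : ℂ))‖ = Real.exp (-κ.re * (s - x)) := by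
    intro s
    rw [Complex.norm_exp]
    simp
  have hle : ∀ s ∈ Ioi x, ‖Complex.exp (-κ * ((s - x : ℝ) : ℂ))‖ ≤ 1 := by
    intro s hs
    rw [hnorm, Real.exp_le_one_iff]
    have : 0 < s - x := sub_pos.2 hs
    nlinarith
  have hint : IntegrableOn (fun s => Complex.exp (-κ * ((s - x : ℝ) : ℂ)) * (deriv p s - κ * p s))
      (Ioi x) := by
    refine Integrable.bdd_mul (c := 1) hk.integrableOn
      (Continuous.aestronglyMeasurable (by fun_prop)) ?_
    exact (ae_restrict_mem measurableSet_Ioi).mono hle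
  have hlim : Tendsto (fun s : ℝ => Complex.exp (-κ * ((s - x : ℝ) : ℂ)) * p s) atTop (𝓝 0) := by
    have h0 : Tendsto (fun s => ‖p s‖) atTop (𝓝 0) := by
      simpa using (p.tendsto_cocompact.mono_left atTop_le_cocompact).norm
    refine squeeze_zero_norm' ?_ h0
    filter_upwards [eventually_gt_atTop x] with s hs
    rw [norm_mul]
    exact mul_le_of_le_one_left (norm_nonneg _) (hle s hs)
  have key := integral_Ioi_of_hasDerivAt_of_tendsto' (fun s _ => hd s) hint hlim
  have : p x = -∫ s in Ioi x, Complex.exp (-κ * ((s - x : ℝ) : ℂ)) * (deriv p s - κ * p s) := by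
    rw [key]; simp
  rw [this, norm_neg]
  refine (norm_integral_le_integral_norm _).trans ?_
  refine setIntegral_mono_on hint.norm hk.norm.integrableOn measurableSet_Ioi fun s hs => ?_
  rw [norm_mul]
  exact mul_le_of_le_one_left (norm_nonneg _) (hle s hs)

/-- The mirror image of the previous estimate under $s\mapsto-s$. -/
theorem norm_le_setIntegral_Iic_deriv_add {κ : ℂ} (hκ : 0 < κ.re) (p : 𝓢(ℝ, ℂ)) (x : ℝ) :
    ‖p x‖ ≤ ∫ s in Iic x, ‖deriv p s + κ * p s‖ := by
  have h := norm_le_setIntegral_Ioi_deriv_sub hκ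
    (SchwartzMap.compCLMOfContinuousLinearEquiv ℂ (ContinuousLinearEquiv.neg ℝ) p) (-x)
  have hfun : ((SchwartzMap.compCLMOfContinuousLinearEquiv ℂ (ContinuousLinearEquiv.neg ℝ) p :
      𝓢(ℝ, ℂ)) : ℝ → ℂ) = fun s => p (-s) := by
    ext s; simp
  rw [hfun] at h
  simp only [neg_neg, deriv_comp_neg] at h
  refine h.trans (le_of_eq ?_)
  have h2 := integral_comp_neg_Ioi (-x) fun s => ‖deriv p s + κ * p s‖
  rw [neg_neg] at h2
  rw [← h2]
  refine setIntegral_congr_fun measurableSet_Ioi fun s _ => ?_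
  rw [← norm_neg]
  congr 1
  ring

/-- The resolvent of the second derivative on the line maps `L¹` to `L^∞`. -/
theorem norm_two_mul_mul_le_integral {κ : ℂ} (hκ : 0 < κ.re) (h : 𝓢(ℝ, ℂ)) (x : ℝ) :
    ‖2 * κ * h x‖ ≤ ∫ s, ‖deriv (deriv h) s - κ ^ 2 * h s‖ := by
  set h1 : 𝓢(ℝ, ℂ) := SchwartzMap.derivCLM ℂ ℂ h with hh1
  have e1 : (h1 : ℝ → ℂ) = deriv h := by ext s; simp [hh1]
  have hdd : ∀ s, HasDerivAt (deriv h) (deriv (deriv h) s) s := by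
    intro s; rw [← e1]; exact h1.hasDerivAt s
  have hk : Integrable (fun s => deriv (deriv h) s - κ ^ 2 * h s) := by
    rw [← e1]
    exact (SchwartzMap.derivCLM ℂ ℂ h1).integrable.sub (h.integrable.const_mul _)
  -- The operator factors as $(\partial-\kappa)(\partial+\kappa)$ and as
  -- $(\partial+\kappa)(\partial-\kappa)$. So $h'+\kappa h$ is controlled from the right and
  -- $h'-\kappa h$ from the left by the same function. Their difference is $2\kappa h$, and the two
  -- half-lines make up a single integral.
  have hp := norm_le_setIntegral_Ioi_deriv_sub hκ (h1 + κ • h) x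
  have hm := norm_le_setIntegral_Iic_deriv_add hκ (h1 - κ • h) x
  have dp : ∀ s, deriv (h1 + κ • h : 𝓢(ℝ, ℂ)) s - κ * (h1 + κ • h) s
      = deriv (deriv h) s - κ ^ 2 * h s := by
    intro s
    have : HasDerivAt (h1 + κ • h : 𝓢(ℝ, ℂ)) (deriv (deriv h) s + κ * deriv h s) s := by
      have e : ((h1 + κ • h : 𝓢(ℝ, ℂ)) : ℝ → ℂ) = deriv h + fun y => κ * h y := by
        funext s; simp [← e1]
      rw [e]
      exact (hdd s).add ((h.hasDerivAt s).const_mul κ)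
    rw [this.deriv]
    simp [← e1]; ring
  have dm : ∀ s, deriv (h1 - κ • h : 𝓢(ℝ, ℂ)) s + κ * (h1 - κ • h) s
      = deriv (deriv h) s - κ ^ 2 * h s := by
    intro s
    have : HasDerivAt (h1 - κ • h : 𝓢(ℝ, ℂ)) (deriv (deriv h) s - κ * deriv h s) s := by
      have e : ((h1 - κ • h : 𝓢(ℝ, ℂ)) : ℝ → ℂ) = deriv h - fun y => κ * h y := by
        funext s; simp [← e1]
      rw [e]
      exact (hdd s).sub ((h.hasDerivAt s).const_mul κ)
    rw [this.deriv]
    simp [← e1]; ring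
  simp only [dp] at hp
  simp only [dm] at hm
  have hsplit := intervalIntegral.integral_Iic_add_Ioi (b := x) hk.norm.integrableOn
    hk.norm.integrableOn
  have : 2 * κ * h x = (h1 + κ • h) x - (h1 - κ • h) x := by simp; ring
  rw [this, ← hsplit]
  exact (norm_sub_le _ _).trans (by linarith)

/-! ### Partial Fourier transforms of Schwartz functions -/

/-- The plane. -/
abbrev E2 : Type := EuclideanSpace ℝ (Fin 2)

/-- An orthogonal splitting of space into a line and a plane. -/
structure AxisSplit (Λ : (ℝ × E2) ≃L[ℝ] E3) : Prop where
  measurePreserving : MeasurePreserving Λ volume volume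
  inner_eq : ∀ s x t y, inner ℝ (Λ (s, x)) (Λ (t, y)) = s * t + inner ℝ x y

namespace AxisSplit

variable {Λ : (ℝ × E2) ≃L[ℝ] E3}

theorem norm_sq (hΛ : AxisSplit Λ) (s : ℝ) (x : E2) : ‖Λ (s, x)‖ ^ 2 = s ^ 2 + ‖x‖ ^ 2 := by
  rw [← real_inner_self_eq_norm_sq, hΛ.inner_eq, real_inner_self_eq_norm_sq, sq s]

theorem inner_axis (hΛ : AxisSplit Λ) (s : ℝ) (x : E2) : inner ℝ (Λ (s, x)) (Λ (1, 0)) = s := by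
  simp [hΛ.inner_eq]

theorem antilipschitz_plane (hΛ : AxisSplit Λ) (s : ℝ) :
    AntilipschitzWith 1 fun x : E2 => Λ (s, x) := by
  refine AntilipschitzWith.of_le_mul_dist fun x y => ?_
  have : Λ (s, x) - Λ (s, y) = Λ (0, x - y) := by rw [← map_sub]; simp
  rw [dist_eq_norm, dist_eq_norm, this, NNReal.coe_one, one_mul]
  have := hΛ.norm_sq 0 (x - y)
  exact le_of_sq_le_sq (by simp [this]) (norm_nonneg _)

theorem antilipschitz_line (hΛ : AxisSplit Λ) (x : E2) :
    AntilipschitzWith 1 fun s : ℝ => Λ (s, x) := by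
  refine AntilipschitzWith.of_le_mul_dist fun s t => ?_
  have : Λ (s, x) - Λ (t, x) = Λ (s - t, 0) := by rw [← map_sub]; simp
  rw [dist_eq_norm, dist_eq_norm, this, NNReal.coe_one, one_mul]
  have := hΛ.norm_sq (s - t) 0
  exact le_of_sq_le_sq (by simp [this]) (norm_nonneg _)

theorem temperate_plane (Λ : (ℝ × E2) ≃L[ℝ] E3) (s : ℝ) :
    (fun x : E2 => Λ (s, x)).HasTemperateGrowth := by
  have : (fun x : E2 => Λ (s, x))
      = fun x => Λ (s, 0) + ((Λ : (ℝ × E2) →L[ℝ] E3).comp (.inr ℝ ℝ E2)) x := by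
    funext x
    simp [← map_add]
  rw [this]
  exact (Function.HasTemperateGrowth.const _).add (ContinuousLinearMap.hasTemperateGrowth _)

theorem temperate_line (Λ : (ℝ × E2) ≃L[ℝ] E3) (x : E2) :
    (fun s : ℝ => Λ (s, x)).HasTemperateGrowth := by
  have : (fun s : ℝ => Λ (s, x))
      = fun s => Λ (0, x) + ((Λ : (ℝ × E2) →L[ℝ] E3).comp (.inl ℝ ℝ E2)) s := by
    funext s
    simp [← map_add]
  rw [this]
  exact (Function.HasTemperateGrowth.const _).add (ContinuousLinearMap.hasTemperateGrowth _)

/-- The restriction of a Schwartz function to a plane orthogonal to the axis. -/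
noncomputable def plane (hΛ : AxisSplit Λ) (φ : 𝓢(E3, ℂ)) (s : ℝ) : 𝓢(E2, ℂ) :=
  SchwartzMap.compCLMOfAntilipschitz ℂ (temperate_plane Λ s) (hΛ.antilipschitz_plane s) φ

/-- The restriction of a Schwartz function to a line parallel to the axis. -/
noncomputable def line (hΛ : AxisSplit Λ) (φ : 𝓢(E3, ℂ)) (x : E2) : 𝓢(ℝ, ℂ) :=
  SchwartzMap.compCLMOfAntilipschitz ℂ (temperate_line Λ x) (hΛ.antilipschitz_line x) φ

@[simp] theorem plane_apply (hΛ : AxisSplit Λ) (φ : 𝓢(E3, ℂ)) (s : ℝ) (x : E2) :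
    hΛ.plane φ s x = φ (Λ (s, x)) := rfl

@[simp] theorem line_apply (hΛ : AxisSplit Λ) (φ : 𝓢(E3, ℂ)) (s : ℝ) (x : E2) :
    hΛ.line φ x s = φ (Λ (s, x)) := rfl

theorem measurableEmbedding (Λ : (ℝ × E2) ≃L[ℝ] E3) : MeasurableEmbedding Λ :=
  Λ.toHomeomorph.measurableEmbedding

theorem integrable_comp (hΛ : AxisSplit Λ) (φ : 𝓢(E3, ℂ)) :
    Integrable (fun p : ℝ × E2 => φ (Λ p)) (volume.prod volume) :=
  (hΛ.measurePreserving.integrable_comp_emb (measurableEmbedding Λ)).2 φ.integrable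

theorem lintegral_eq (hΛ : AxisSplit Λ) (f : E3 → ℝ≥0∞) (hf : Measurable f) :
    ∫⁻ x, f x = ∫⁻ s, ∫⁻ x, f (Λ (s, x)) := by
  rw [← hΛ.measurePreserving.lintegral_comp hf, Measure.volume_eq_prod, lintegral_prod _ (by fun_prop)]

/-- A bound independent of the axial coordinate, used to dominate the planar Fourier integral. Cubic
decay is integrable on a plane. -/
theorem norm_plane_le (hΛ : AxisSplit Λ) (φ : 𝓢(E3, ℂ)) :
    ∃ b : E2 → ℝ, Integrable b ∧ ∀ s x, ‖φ (Λ (s, x))‖ ≤ b x := by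
  obtain ⟨C, hC⟩ := φ.decay 3 0
  obtain ⟨C', hC'⟩ := φ.decay 0 0
  have hb : Integrable (fun x : E2 => (1 + ‖x‖) ^ (-3 : ℝ)) :=
    integrable_one_add_norm (by simp; norm_num)
  refine ⟨fun x => 4 * (C' + C) * (1 + ‖x‖) ^ (-3 : ℝ), hb.const_mul _, fun s x => ?_⟩
  have h1 := hC.2 (Λ (s, x))
  have h2 := hC'.2 (Λ (s, x))
  simp only [norm_iteratedFDeriv_zero, pow_zero, one_mul] at h1 h2
  have h3 : ‖x‖ ≤ ‖Λ (s, x)‖ := by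
    refine le_of_sq_le_sq ?_ (norm_nonneg _)
    rw [hΛ.norm_sq]; nlinarith [sq_nonneg s]
  have h4 : ‖x‖ ^ 3 * ‖φ (Λ (s, x))‖ ≤ C := le_trans (by gcongr) h1
  have h5 : (1 + ‖x‖) ^ 3 ≤ 4 * (1 + ‖x‖ ^ 3) := by
    nlinarith [norm_nonneg x, mul_nonneg (norm_nonneg x) (sq_nonneg (‖x‖ - 1)),
      sq_nonneg (‖x‖ - 1)]
  have hpos : 0 < (1 + ‖x‖) ^ 3 := by positivity
  beta_reduce
  rw [Real.rpow_neg (by positivity), show (3 : ℝ) = ((3 : ℕ) : ℝ) by norm_num, Real.rpow_natCast,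
    ← div_eq_mul_inv, le_div_iff₀ hpos]
  nlinarith [norm_nonneg (φ (Λ (s, x)))]

/-- Fourier inversion in the axial variable alone: the planar Fourier transform of a Schwartz
function is the inverse axial Fourier transform of the full Fourier transform. -/
theorem fourier_plane_eq (hΛ : AxisSplit Λ) (φ : 𝓢(E3, ℂ)) (s : ℝ) (ξ : E2) :
    𝓕 (hΛ.plane φ s) ξ = 𝓕⁻ (hΛ.line (𝓕 φ) ξ) s := by
  set T : ℝ → ℂ := fun s => 𝓕 (hΛ.plane φ s) ξ with hT
  have hTe : ∀ s, T s = ∫ x, Real.fourierChar (-(inner ℝ x ξ)) • φ (Λ (s, x)) := by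
    intro s
    simp only [hT]
    rw [SchwartzMap.fourier_coe, Real.fourier_eq]
    rfl
  have hint : Integrable (fun p : ℝ × E2 => Real.fourierChar (-(inner ℝ p.2 ξ)) • φ (Λ p))
      (volume.prod volume) := by
    refine (hΛ.integrable_comp φ).mono (Continuous.aestronglyMeasurable (by fun_prop)) ?_
    exact Eventually.of_forall fun p => by simp
  have hTi : Integrable T := by
    simp only [funext hTe]
    exact hint.integral_prod_left
  have hTc : Continuous T := by
    obtain ⟨b, hb, hbx⟩ := hΛ.norm_plane_le φ
    simp only [funext hTe]
    refine continuous_of_dominated (bound := b)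
      (fun s => Continuous.aestronglyMeasurable (by fun_prop)) (fun s => ?_) hb ?_
    · exact Eventually.of_forall fun x => by simpa using hbx s x
    · exact Eventually.of_forall fun x => by fun_prop
  -- By Fubini and orthogonality of the splitting, transforming `T` along the axis gives the full
  -- transform. Inversion then applies because `T` is continuous and integrable with integrable
  -- transform, without showing that `T` is a Schwartz function.
  have hFT : 𝓕 T = (hΛ.line (𝓕 φ) ξ : ℝ → ℂ) := by
    funext t
    rw [Real.fourier_eq, line_apply, SchwartzMap.fourier_coe, Real.fourier_eq,
      ← hΛ.measurePreserving.integral_comp (measurableEmbedding Λ), Measure.volume_eq_prod,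
      integral_prod]
    · refine integral_congr_ae (Eventually.of_forall fun s => ?_)
      simp only [hTe, Circle.smul_def, smul_eq_mul]
      rw [← integral_const_mul]
      refine integral_congr_ae (Eventually.of_forall fun x => ?_)
      simp only [hΛ.inner_eq]
      rw [neg_add, AddChar.map_add_eq_mul, Circle.coe_mul, ← mul_assoc]
      simp [mul_comm s t]
    · refine (hΛ.integrable_comp φ).mono (Continuous.aestronglyMeasurable (by fun_prop)) ?_
      exact Eventually.of_forall fun p => by simp
  have := congrFun (hTc.fourierInv_fourier_eq hTi (by rw [hFT]; exact (hΛ.line (𝓕 φ) ξ).integrable)) s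
  rw [hFT] at this
  rw [SchwartzMap.fourierInv_coe, this]

end AxisSplit

/-! ### The slab estimate for the resolvent -/

/-- The Cauchy–Schwarz inequality for the lower integral. -/
theorem sq_lintegral_mul_le {X : Type*} [MeasurableSpace X] {μ : Measure X} {f g : X → ℝ≥0∞}
    (hf : AEMeasurable f μ) (hg : AEMeasurable g μ) :
    (∫⁻ x, f x * g x ∂μ) ^ 2 ≤ (∫⁻ x, f x ^ 2 ∂μ) * ∫⁻ x, g x ^ 2 ∂μ := by
  have h := ENNReal.lintegral_mul_le_Lp_mul_Lq μ Real.HolderConjugate.two_two hf hg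
  have h2 := pow_le_pow_left' h 2
  refine h2.trans (le_of_eq ?_)
  rw [mul_pow, ← ENNReal.rpow_natCast, ← ENNReal.rpow_natCast, ← ENNReal.rpow_mul,
    ← ENNReal.rpow_mul]
  simp

theorem sq_setLIntegral_le {X : Type*} [MeasurableSpace X] {μ : Measure X} {f : X → ℝ≥0∞}
    (hf : AEMeasurable f μ) (s : Set X) :
    (∫⁻ x in s, f x ∂μ) ^ 2 ≤ μ s * ∫⁻ x, f x ^ 2 ∂μ := by
  have h := sq_lintegral_mul_le (μ := μ.restrict s) (f := fun _ => 1) aemeasurable_const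
    hf.restrict
  simp only [one_mul, one_pow, lintegral_const, Measure.restrict_apply_univ] at h
  exact h.trans (by gcongr; exact Measure.restrict_le_self)

/-- Absorption keeps $a+i\eta$ off the real line, so no square root is purely imaginary, and one of
the two has positive real part. -/
theorem exists_sq_eq_of_im_pos (a : ℝ) {η : ℝ} (hη : 0 < η) :
    ∃ κ : ℂ, κ ^ 2 = a + η * Complex.I ∧ 0 < κ.re := by
  obtain ⟨z, hz⟩ := IsAlgClosed.exists_pow_nat_eq ((a : ℂ) + η * Complex.I) two_pos
  have him : (z ^ 2).im = η := by rw [hz]; simp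
  rw [sq, Complex.mul_im] at him
  rcases lt_trichotomy z.re 0 with h | h | h
  · exact ⟨-z, by simpa using hz, by simpa using h⟩
  · rw [h] at him; simp at him; exact absurd him.symm hη.ne'
  · exact ⟨z, hz, h⟩

theorem lintegral_enorm_sq_fourier {V : Type*} [NormedAddCommGroup V] [InnerProductSpace ℝ V]
    [FiniteDimensional ℝ V] [MeasurableSpace V] [BorelSpace V] (f : 𝓢(V, ℂ)) :
    ∫⁻ ξ, ‖𝓕 f ξ‖ₑ ^ 2 = ∫⁻ x, ‖f x‖ₑ ^ 2 := by
  have key : ∀ f : 𝓢(V, ℂ), ∫⁻ x, ‖f x‖ₑ ^ 2 = ENNReal.ofReal (∫ x, ‖f x‖ ^ 2) := by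
    intro f
    rw [ofReal_integral_eq_lintegral_ofReal]
    · refine lintegral_congr fun x => ?_
      rw [← ofReal_norm, ENNReal.ofReal_pow (norm_nonneg _)]
    · exact (memLp_two_iff_integrable_sq_norm f.continuous.aestronglyMeasurable).1 (f.memLp 2)
    · exact Eventually.of_forall fun x => by positivity
  rw [key, key, SchwartzMap.integral_norm_sq_fourier]

theorem lintegral_enorm_sq_fourierInv {V : Type*} [NormedAddCommGroup V] [InnerProductSpace ℝ V]
    [FiniteDimensional ℝ V] [MeasurableSpace V] [BorelSpace V] (f : 𝓢(V, ℂ)) :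
    ∫⁻ ξ, ‖𝓕⁻ f ξ‖ₑ ^ 2 = ∫⁻ x, ‖f x‖ₑ ^ 2 := by
  rw [← lintegral_enorm_sq_fourier (𝓕⁻ f), FourierTransform.fourier_fourierInv_eq]

theorem fourierInv_sub_smul {V : Type*} [NormedAddCommGroup V] [InnerProductSpace ℝ V]
    [FiniteDimensional ℝ V] [MeasurableSpace V] [BorelSpace V] (f g : 𝓢(V, ℂ)) (c : ℂ) :
    𝓕⁻ (f - c • g) = 𝓕⁻ f - c • 𝓕⁻ g := by
  simp only [← FourierTransform.fourierInvCLM_apply (R := ℂ), map_sub, map_smul]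

theorem laplacian_fourierInv {V : Type*} [NormedAddCommGroup V] [InnerProductSpace ℝ V]
    [FiniteDimensional ℝ V] [MeasurableSpace V] [BorelSpace V] {χ χ₂ : 𝓢(V, ℂ)}
    (h : ∀ t, χ₂ t = ((-((2 * Real.pi) ^ 2 * ‖t‖ ^ 2) : ℝ) : ℂ) * χ t) (x : V) :
    Laplacian.laplacian ((𝓕⁻ χ : 𝓢(V, ℂ)) : V → ℂ) x = 𝓕⁻ χ₂ x := by
  rw [← SchwartzMap.laplacian_apply,
    SchwartzMap.laplacian_eq_fourierMultiplierCLM, SchwartzMap.fourierMultiplierCLM_apply,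
    FourierTransform.fourier_fourierInv_eq, ← FourierTransform.fourierInv_smul]
  congr 2
  ext t
  rw [h, smul_apply, SchwartzMap.smulLeftCLM_apply_apply (by fun_prop)]
  simp [mul_assoc]

theorem deriv_deriv_fourierInv {χ χ₂ : 𝓢(ℝ, ℂ)}
    (h : ∀ t, χ₂ t = ((-((2 * Real.pi) ^ 2 * t ^ 2) : ℝ) : ℂ) * χ t) (s : ℝ) :
    deriv (deriv (𝓕⁻ χ : 𝓢(ℝ, ℂ))) s = 𝓕⁻ χ₂ s := by
  have := laplacian_fourierInv (χ := χ) (χ₂ := χ₂) (fun t => by rw [h]; simp) s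
  rw [← this, InnerProductSpace.laplacian_eq_iteratedDeriv_real, iteratedDeriv_succ,
    iteratedDeriv_one]

/-- One-dimensional resolvent estimate, on the Fourier side. -/
theorem enorm_sq_fourierInv_le {a η R z : ℝ} (hη : 0 < η) (ψ γ : 𝓢(ℝ, ℂ))
    (h : ∀ t, (-((2 * Real.pi) ^ 2 * t ^ 2 : ℝ) - a - η * Complex.I) * ψ t = γ t)
    (hsupp : ∀ s, s ∉ Icc (z - R) (z + R) → 𝓕⁻ γ s = 0) (s : ℝ) :
    ‖(a : ℂ) * 𝓕⁻ ψ s‖ₑ ^ 2 ≤ ENNReal.ofReal (|a| * R / 2) * ∫⁻ s, ‖𝓕⁻ γ s‖ₑ ^ 2 := by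
  obtain ⟨κ, hκ, hre⟩ := exists_sq_eq_of_im_pos a hη
  have hode : ∀ s, deriv (deriv (𝓕⁻ ψ : 𝓢(ℝ, ℂ))) s - κ ^ 2 * 𝓕⁻ ψ s = 𝓕⁻ γ s := by
    intro s
    have h1 : ∀ t, (γ - (-κ ^ 2) • ψ) t = ((-((2 * Real.pi) ^ 2 * t ^ 2) : ℝ) : ℂ) * ψ t := by
      intro t
      rw [sub_apply, smul_apply, ← h t, hκ, smul_eq_mul]
      push_cast
      ring
    rw [deriv_deriv_fourierInv h1, fourierInv_sub_smul]
    simp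
  have h1 := norm_two_mul_mul_le_integral hre (𝓕⁻ ψ) s
  simp only [hode] at h1
  have h2 : ‖2 * κ * 𝓕⁻ ψ s‖ₑ ≤ ∫⁻ s in Icc (z - R) (z + R), ‖𝓕⁻ γ s‖ₑ := by
    rw [← ofReal_norm]
    refine (ENNReal.ofReal_le_ofReal h1).trans ?_
    rw [ofReal_integral_norm_eq_lintegral_enorm (𝓕⁻ γ).integrable,
      ← lintegral_indicator measurableSet_Icc]
    refine lintegral_mono fun s => ?_
    by_cases hs : s ∈ Icc (z - R) (z + R)
    · simp [hs]
    · simp [hsupp s hs]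
  -- Cauchy–Schwarz on an interval of length $2R$.
  have h3 := (pow_le_pow_left' h2 2).trans (sq_setLIntegral_le
    ((𝓕⁻ γ).continuous.enorm.measurable.aemeasurable) _)
  -- This gives $|ah|^2\le\frac{|a|}4|2\kappa h|^2$, with no singularity at $a=0$. With the length
  -- $2R$ the constant becomes $|a|R/2$.
  have h4 : |a| ≤ ‖κ‖ ^ 2 := by
    rw [← norm_pow, hκ]
    have := Complex.abs_re_le_norm ((a : ℂ) + η * Complex.I)
    simpa using this
  have h5 : ‖(a : ℂ) * 𝓕⁻ ψ s‖ₑ ^ 2 ≤ ENNReal.ofReal (|a| / 4) * ‖2 * κ * 𝓕⁻ ψ s‖ₑ ^ 2 := by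
    rw [← ofReal_norm, ← ofReal_norm, ← ENNReal.ofReal_pow (norm_nonneg _),
      ← ENNReal.ofReal_pow (norm_nonneg _), ← ENNReal.ofReal_mul (by positivity)]
    refine ENNReal.ofReal_le_ofReal ?_
    simp only [norm_mul, mul_pow, Complex.norm_real, Real.norm_eq_abs, Complex.norm_ofNat]
    have : |a| ^ 2 * ‖𝓕⁻ ψ s‖ ^ 2 ≤ |a| * ‖κ‖ ^ 2 * ‖𝓕⁻ ψ s‖ ^ 2 := by
      rw [sq |a|]; gcongr
    linarith
  refine h5.trans ((mul_le_mul_right h3 _).trans (le_of_eq ?_))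
  rw [← mul_assoc, Real.volume_Icc, ← ENNReal.ofReal_mul (by positivity)]
  congr 2
  ring

namespace AxisSplit

variable {Λ : (ℝ × E2) ≃L[ℝ] E3}

theorem measurable_fourier_plane (hΛ : AxisSplit Λ) (φ : 𝓢(E3, ℂ)) :
    Measurable fun p : ℝ × E2 => 𝓕 (hΛ.plane φ p.1) p.2 := by
  have h : Continuous fun p : (ℝ × E2) × E2 =>
      Real.fourierChar (-(inner ℝ p.2 p.1.2)) • φ (Λ (p.1.1, p.2)) := by fun_prop
  have h2 := (h.stronglyMeasurable.integral_prod_right' (ν := (volume : Measure E2))).measurable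
  convert h2 using 2 with p
  rw [SchwartzMap.fourier_coe, Real.fourier_eq]
  rfl

/-- The slab estimate: a symbol vanishing where the axial frequency does, times the resolvent, maps
functions supported in a slab to functions which are controlled in every other slab. -/
theorem lintegral_slab_le (hΛ : AxisSplit Λ) {k η R z r c : ℝ} (hη : 0 < η) (hR : 0 ≤ R)
    (hr : 0 ≤ r) {φ g Φ : 𝓢(E3, ℂ)}
    (hg : ∀ ξ, (((k ^ 2 - (2 * Real.pi) ^ 2 * ‖ξ‖ ^ 2 : ℝ) : ℂ) - η * Complex.I) * 𝓕 φ ξ = 𝓕 g ξ)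
    (hΦ : ∀ ξ, 𝓕 Φ ξ
      = (((2 * Real.pi) ^ 2 * (‖ξ‖ ^ 2 - inner ℝ ξ (Λ (1, 0)) ^ 2) - k ^ 2 : ℝ) : ℂ) * 𝓕 φ ξ)
    (hsupp : ∀ x, R < |inner ℝ x (Λ (1, 0)) - z| → g x = 0) :
    ∫⁻ x in {x | |inner ℝ x (Λ (1, 0)) - c| ≤ r}, ‖Φ x‖ₑ ^ 2
      ≤ ENNReal.ofReal (3 * k ^ 2 * r * R + 1) * ∫⁻ x, ‖g x‖ₑ ^ 2 := by
  set e := Λ (1, 0)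
  have hmeas : MeasurableSet {x : E3 | |inner ℝ x e - c| ≤ r} :=
    (isClosed_le (by fun_prop) (by fun_prop)).measurableSet
  have hI : ∀ s : ℝ, |s - c| ≤ r ↔ s ∈ Icc (c - r) (c + r) := fun s => by
    rw [abs_le, mem_Icc]; constructor <;> rintro ⟨h1, h2⟩ <;> constructor <;> linarith
  set a : E2 → ℝ := fun ξ => (2 * Real.pi) ^ 2 * ‖ξ‖ ^ 2 - k ^ 2 with ha
  -- The multiplier of `Φ` depends on the transverse frequency only, so it is a constant along each
  -- axial line.
  have hQ : ∀ s ξ, 𝓕 (hΛ.plane Φ s) ξ = a ξ * 𝓕⁻ (hΛ.line (𝓕 φ) ξ) s := by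
    intro s ξ
    have : hΛ.line (𝓕 Φ) ξ = (a ξ : ℂ) • hΛ.line (𝓕 φ) ξ := by
      ext t
      rw [smul_apply, line_apply, line_apply, hΦ, hΛ.norm_sq, hΛ.inner_axis, smul_eq_mul]
      congr 3
      ring
    rw [hΛ.fourier_plane_eq, this, FourierTransform.fourierInv_smul, smul_apply, smul_eq_mul]
  set D : E2 → ℝ≥0∞ := fun ξ => ∫⁻ t, ‖𝓕 g (Λ (t, ξ))‖ₑ ^ 2 with hD
  have hD' : ∀ ξ, ∫⁻ s, ‖𝓕⁻ (hΛ.line (𝓕 g) ξ) s‖ₑ ^ 2 = D ξ := fun ξ =>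
    lintegral_enorm_sq_fourierInv _
  have hode : ∀ ξ t, (-((2 * Real.pi) ^ 2 * t ^ 2 : ℝ) - a ξ - η * Complex.I)
      * hΛ.line (𝓕 φ) ξ t = hΛ.line (𝓕 g) ξ t := by
    intro ξ t
    rw [line_apply, line_apply, ← hg, hΛ.norm_sq]
    congr 1
    simp only [ha]
    push_cast
    ring
  -- The slab restricts only the axial coordinate, so the support condition passes to every
  -- transverse frequency.
  have hvan : ∀ ξ s, s ∉ Icc (z - R) (z + R) → 𝓕⁻ (hΛ.line (𝓕 g) ξ) s = 0 := by
    intro ξ s hs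
    rw [← hΛ.fourier_plane_eq]
    have : hΛ.plane g s = 0 := by
      ext x
      rw [plane_apply, zero_apply]
      refine hsupp _ ?_
      rw [hΛ.inner_axis]
      by_contra! h
      rw [abs_le] at h
      exact hs ⟨by linarith, by linarith⟩
    rw [this, FourierTransform.fourier_zero, zero_apply]
  have hfib : ∀ ξ, ∫⁻ s in Icc (c - r) (c + r), ‖𝓕 (hΛ.plane Φ s) ξ‖ₑ ^ 2
      ≤ ENNReal.ofReal (3 * k ^ 2 * r * R + 1) * D ξ := by
    intro ξ
    simp only [hQ]
    have hpos : 0 ≤ 3 * k ^ 2 * r * R := by positivity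
    -- For $a\le3k^2$ also $|a|\le3k^2$, and the pointwise bound $|a|R/2$ is integrated over the
    -- slab of width $2r$. For larger $a$ the equation is elliptic: $a$ is at most the modulus of
    -- the full multiplier, and Plancherel on the line suffices. The threshold $3k^2$ leads to
    -- $3k^2rR+1\le(2\sqrt{rR}\,k)^2$ once $k^2rR\ge1$.
    rcases le_or_gt (a ξ) (3 * k ^ 2) with h | h
    · have h1 : |a ξ| ≤ 3 * k ^ 2 := by
        rw [abs_le]
        refine ⟨?_, h⟩
        have : 0 ≤ (2 * Real.pi) ^ 2 * ‖ξ‖ ^ 2 := by positivity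
        simp only [ha]; nlinarith [sq_nonneg k]
      calc _ ≤ ∫⁻ s in Icc (c - r) (c + r), ENNReal.ofReal (|a ξ| * R / 2) * D ξ := by
            refine lintegral_mono fun s => ?_
            rw [← hD']
            exact enorm_sq_fourierInv_le hη _ _ (hode ξ) (hvan ξ) s
        _ = ENNReal.ofReal (|a ξ| * R / 2 * (2 * r)) * D ξ := by
            rw [setLIntegral_const, Real.volume_Icc, ENNReal.ofReal_mul (by positivity)]
            rw [mul_right_comm]
            congr 3
            ring
        _ ≤ _ := by
            gcongr
            have : |a ξ| * (R * r) ≤ 3 * k ^ 2 * (R * r) := by gcongr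
            nlinarith
    · calc _ ≤ ∫⁻ s, ‖(a ξ : ℂ) * 𝓕⁻ (hΛ.line (𝓕 φ) ξ) s‖ₑ ^ 2 := setLIntegral_le_lintegral _ _
        _ = ∫⁻ t, ‖(a ξ : ℂ) * hΛ.line (𝓕 φ) ξ t‖ₑ ^ 2 := by
            have := lintegral_enorm_sq_fourierInv ((a ξ : ℂ) • hΛ.line (𝓕 φ) ξ)
            simpa only [FourierTransform.fourierInv_smul, smul_apply, smul_eq_mul] using this
        _ ≤ D ξ := by
            refine lintegral_mono fun t => ?_
            gcongr
            rw [← line_apply hΛ, ← hode, enorm_mul, enorm_mul]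
            gcongr
            rw [← ofReal_norm, ← ofReal_norm]
            refine ENNReal.ofReal_le_ofReal ?_
            refine le_trans ?_ (Complex.abs_re_le_norm _)
            rw [Complex.norm_real, Real.norm_eq_abs]
            have e1 : 0 < a ξ := lt_of_le_of_lt (by positivity) h
            have e2 : (-(((2 * Real.pi) ^ 2 * t ^ 2 : ℝ) : ℂ) - a ξ - η * Complex.I).re
                = -((2 * Real.pi) ^ 2 * t ^ 2 + a ξ) := by
              rw [Complex.sub_re, Complex.sub_re, Complex.neg_re, Complex.ofReal_re,
                Complex.ofReal_re, Complex.re_ofReal_mul, Complex.I_re]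
              ring
            rw [e2, abs_neg, abs_of_pos e1, abs_of_pos (by positivity)]
            have : 0 ≤ (2 * Real.pi) ^ 2 * t ^ 2 := by positivity
            linarith
        _ ≤ _ := by
            refine le_mul_of_one_le_left' ?_
            rw [ENNReal.one_le_ofReal]
            linarith
  have hint : ∫⁻ ξ, D ξ = ∫⁻ x, ‖g x‖ₑ ^ 2 := by
    rw [← lintegral_enorm_sq_fourier g, hΛ.lintegral_eq _ (by fun_prop), lintegral_lintegral_swap]
    exact (Continuous.measurable (by fun_prop)).aemeasurable
  -- Slice the slab along the axis and apply Plancherel on each plane.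
  have hL : ∫⁻ x in {x | |inner ℝ x e - c| ≤ r}, ‖Φ x‖ₑ ^ 2
      = ∫⁻ s in Icc (c - r) (c + r), ∫⁻ ξ, ‖𝓕 (hΛ.plane Φ s) ξ‖ₑ ^ 2 := by
    rw [← lintegral_indicator hmeas, hΛ.lintegral_eq _ (by
      exact Measurable.indicator (by fun_prop) hmeas), ← lintegral_indicator measurableSet_Icc]
    refine lintegral_congr fun s => ?_
    by_cases hs : s ∈ Icc (c - r) (c + r)
    · rw [indicator_of_mem hs, lintegral_enorm_sq_fourier]
      refine lintegral_congr fun x => ?_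
      rw [indicator_of_mem]
      · rfl
      · rw [mem_ofPred_eq, hΛ.inner_axis]; exact (hI s).2 hs
    · rw [indicator_of_notMem hs]
      refine lintegral_eq_zero_of_ae_eq_zero (Eventually.of_forall fun x => ?_)
      refine indicator_of_notMem ?_ _
      · rw [mem_ofPred_eq, hΛ.inner_axis]; exact fun h => hs ((hI s).1 h)
  rw [hL, lintegral_lintegral_swap]
  · calc _ ≤ ∫⁻ ξ, ENNReal.ofReal (3 * k ^ 2 * r * R + 1) * D ξ := lintegral_mono hfib
      _ = _ := by rw [lintegral_const_mul' _ _ ENNReal.ofReal_ne_top, hint]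
  · exact ((hΛ.measurable_fourier_plane Φ).enorm.pow_const 2).aemeasurable

end AxisSplit

/-! ### The resolvent estimate between arbitrary balls -/

/-- The splitting of space along the `i`-th coordinate axis. -/
noncomputable def coordAxis (i : Fin 3) : (ℝ × E2) ≃L[ℝ] E3 :=
  LinearEquiv.toContinuousLinearEquiv
    { toFun := fun p => WithLp.toLp 2 (i.insertNth (α := fun _ => ℝ) p.1 (WithLp.ofLp p.2))
      invFun := fun y => (y i, WithLp.toLp 2 fun j => y (i.succAbove j))
      map_add' := fun p q => by
        ext j
        refine Fin.succAboveCases i ?_ (fun j => ?_) j <;> simp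
      map_smul' := fun c p => by
        ext j
        refine Fin.succAboveCases i ?_ (fun j => ?_) j <;> simp
      left_inv := fun p => by
        ext j <;> simp
      right_inv := fun y => by
        ext j
        refine Fin.succAboveCases i ?_ (fun j => ?_) j <;> simp }

theorem coordAxis_apply (i : Fin 3) (p : ℝ × E2) :
    coordAxis i p = WithLp.toLp 2 (i.insertNth (α := fun _ => ℝ) p.1 (WithLp.ofLp p.2)) := rfl

theorem axisSplit_coordAxis (i : Fin 3) : AxisSplit (coordAxis i) where
  measurePreserving := by
    have h1 : MeasurePreserving (fun p : ℝ × E2 => (p.1, WithLp.ofLp p.2)) volume volume :=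
      (MeasurePreserving.id volume).prod (PiLp.volume_preserving_ofLp (Fin 2))
    have h2 := (volume_preserving_piFinSuccAbove (fun _ : Fin 3 => ℝ) i).symm
    have h3 := PiLp.volume_preserving_toLp (Fin 3)
    exact h3.comp (h2.comp h1)
  inner_eq s x t y := by
    simp only [coordAxis_apply, PiLp.inner_apply, Fin.sum_univ_succAbove _ i]
    simp [mul_comm]

theorem inner_coordAxis (i : Fin 3) (ξ : E3) : inner ℝ ξ (coordAxis i (1, 0)) = ξ i := by
  simp only [coordAxis_apply, PiLp.inner_apply, Fin.sum_univ_succAbove _ i]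
  simp

theorem eLpNorm_two_le_of_lintegral_le {X : Type*} [MeasurableSpace X] {μ ν : Measure X}
    {f g : X → ℂ} {A : ℝ} (hA : 0 ≤ A)
    (h : ∫⁻ x, ‖f x‖ₑ ^ 2 ∂μ ≤ ENNReal.ofReal (A ^ 2) * ∫⁻ x, ‖g x‖ₑ ^ 2 ∂ν) :
    eLpNorm f 2 μ ≤ ENNReal.ofReal A * eLpNorm g 2 ν := by
  rw [eLpNorm_eq_lintegral_rpow_enorm_toReal (by norm_num) (by norm_num),
    eLpNorm_eq_lintegral_rpow_enorm_toReal (by norm_num) (by norm_num)]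
  simp only [ENNReal.toReal_ofNat, ENNReal.rpow_ofNat]
  refine (ENNReal.rpow_le_rpow h (by norm_num)).trans (le_of_eq ?_)
  rw [ENNReal.mul_rpow_of_nonneg _ _ (by norm_num), ENNReal.ofReal_rpow_of_nonneg (by positivity)
    (by norm_num), ← Real.sqrt_eq_rpow, Real.sqrt_sq hA]

/-- Resolvent estimate: a Schwartz function is controlled on any ball by its image under
`Δ + k² - iη`, if the latter is supported in a ball. -/
theorem eLpNorm_resolvent_le {k η r R : ℝ} (hk : 0 < k) (hη : 0 < η) (hr : 0 < r) (hR : 0 < R)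
    (hkrR : 1 ≤ k ^ 2 * (r * R)) (c z : E3) {φ g : 𝓢(E3, ℂ)}
    (hg : ∀ ξ, (((k ^ 2 - (2 * Real.pi) ^ 2 * ‖ξ‖ ^ 2 : ℝ) : ℂ) - η * Complex.I) * 𝓕 φ ξ = 𝓕 g ξ)
    (hsupp : ∀ x, x ∉ Metric.ball z R → g x = 0) :
    eLpNorm φ 2 (volume.restrict (Metric.ball c r))
      ≤ ENNReal.ofReal (8 * √(r * R) / k) * eLpNorm g 2 volume := by
  have hmul : ∀ b : E3 → ℝ, b.HasTemperateGrowth → ∃ Φ : 𝓢(E3, ℂ),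
      ∀ ξ, 𝓕 Φ ξ = ((b ξ : ℝ) : ℂ) * 𝓕 φ ξ := by
    intro b hb
    refine ⟨𝓕⁻ (SchwartzMap.smulLeftCLM ℂ b (𝓕 φ)), fun ξ => ?_⟩
    rw [FourierTransform.fourier_fourierInv_eq, SchwartzMap.smulLeftCLM_apply_apply hb]
    simp
  obtain ⟨Φ₀, h0⟩ := hmul (fun ξ => (2 * Real.pi) ^ 2 * ‖ξ‖ ^ 2 - k ^ 2) (by fun_prop)
  have hi := fun i : Fin 3 => hmul (fun ξ => (2 * Real.pi) ^ 2 *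
    (‖ξ‖ ^ 2 - inner ℝ ξ (coordAxis i (1, 0)) ^ 2) - k ^ 2) (by fun_prop)
  choose Φ hΦ using hi
  -- With $P=4\pi^2|\xi|^2$, the three slab multipliers add up to $2P-3k^2$, since each $\xi_j^2$ is
  -- omitted exactly once. Hence $2(P-k^2)-(2P-3k^2)=k^2$.
  have hdec : (((k ^ 2 : ℝ) : ℂ)) • φ = (2 : ℂ) • Φ₀ - ∑ i, Φ i := by
    apply (FourierTransform.fourierEquiv ℂ 𝓢(E3, ℂ)).injective
    simp only [map_sub, map_smul, map_sum, FourierTransform.fourierEquiv_apply]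
    ext ξ
    simp only [sub_apply, smul_apply, Fin.sum_univ_three, add_apply, h0, hΦ,
      inner_coordAxis, smul_eq_mul, EuclideanSpace.real_norm_sq_eq]
    push_cast
    ring
  set μ := (volume : Measure E3).restrict (Metric.ball c r)
  have e0 : eLpNorm Φ₀ 2 μ ≤ ENNReal.ofReal 1 * eLpNorm g 2 volume := by
    refine eLpNorm_two_le_of_lintegral_le zero_le_one ?_
    rw [one_pow, ENNReal.ofReal_one, one_mul]
    refine (setLIntegral_le_lintegral _ _).trans ?_
    rw [← lintegral_enorm_sq_fourier, ← lintegral_enorm_sq_fourier g]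
    refine lintegral_mono fun ξ => ?_
    gcongr
    rw [h0, ← hg, enorm_mul, enorm_mul]
    gcongr
    rw [← ofReal_norm, ← ofReal_norm]
    refine ENNReal.ofReal_le_ofReal ?_
    refine le_trans ?_ (Complex.abs_re_le_norm _)
    rw [Complex.norm_real, Real.norm_eq_abs, Complex.sub_re, Complex.ofReal_re,
      Complex.re_ofReal_mul, Complex.I_re, mul_zero, sub_zero, abs_sub_comm]
  have hsq : √(r * R) ^ 2 = r * R := Real.sq_sqrt (by positivity)
  have ei : ∀ i, eLpNorm (Φ i) 2 μ ≤ ENNReal.ofReal (2 * k * √(r * R)) * eLpNorm g 2 volume := by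
    intro i
    refine eLpNorm_two_le_of_lintegral_le (by positivity) ?_
    set e := coordAxis i (1, 0)
    have he : ‖e‖ = 1 := by
      have := (axisSplit_coordAxis i).norm_sq 1 0
      simp only [norm_zero] at this
      exact (sq_eq_sq₀ (norm_nonneg _) zero_le_one).1 (by simpa using this)
    have hin : ∀ x y : E3, |inner ℝ x e - inner ℝ y e| ≤ dist x y := by
      intro x y
      rw [← inner_sub_left, dist_eq_norm]
      simpa [he] using abs_real_inner_le_norm (x - y) e
    have h1 := (axisSplit_coordAxis i).lintegral_slab_le (z := inner ℝ z e) (c := inner ℝ c e)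
      hη hR.le hr.le hg (hΦ i) (fun x hx => hsupp x fun hx' => by
        have := hin x z
        rw [Metric.mem_ball] at hx'
        exact absurd hx (not_lt.2 (by linarith)))
    have h2 : ∫⁻ x, ‖Φ i x‖ₑ ^ 2 ∂μ
        ≤ ∫⁻ x in {x | |inner ℝ x e - inner ℝ c e| ≤ r}, ‖Φ i x‖ₑ ^ 2 := by
      refine lintegral_mono_set fun x hx => ?_
      rw [Metric.mem_ball] at hx
      exact (hin x c).trans hx.le
    refine (h2.trans h1).trans ?_
    gcongr
    rw [mul_pow, mul_pow, hsq]
    nlinarith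
  have hG : AEStronglyMeasurable (Φ₀ : E3 → ℂ) μ := Φ₀.continuous.aestronglyMeasurable
  have hGi : ∀ i, AEStronglyMeasurable (Φ i : E3 → ℂ) μ :=
    fun i => (Φ i).continuous.aestronglyMeasurable
  -- Absorbs the elliptic term: $2+6t\le8t$ for $t=k\sqrt{rR}\ge1$.
  have hone : 1 ≤ k * √(r * R) := by
    refine le_of_sq_le_sq ?_ (by positivity)
    rw [mul_pow, hsq]; simpa using hkrR
  have htot : eLpNorm (((k ^ 2 : ℝ) : ℂ) • (φ : E3 → ℂ)) 2 μ
      ≤ ENNReal.ofReal (8 * k * √(r * R)) * eLpNorm g 2 volume := by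
    have hfun : ((k ^ 2 : ℝ) : ℂ) • (φ : E3 → ℂ) = (2 : ℂ) • (Φ₀ : E3 → ℂ) - ∑ i, (Φ i : E3 → ℂ) := by
      have := congrArg (fun f : 𝓢(E3, ℂ) => (f : E3 → ℂ)) hdec
      funext x
      simpa using congrFun this x
    rw [hfun]
    calc _ ≤ eLpNorm ((2 : ℂ) • (Φ₀ : E3 → ℂ)) 2 μ + eLpNorm (∑ i, (Φ i : E3 → ℂ)) 2 μ :=
          eLpNorm_sub_le (hG.const_smul _)
            (Finset.aestronglyMeasurable_sum _ fun i _ => hGi i) (by norm_num)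
      _ ≤ ENNReal.ofReal 2 * (ENNReal.ofReal 1 * eLpNorm g 2 volume)
          + ∑ i : Fin 3, ENNReal.ofReal (2 * k * √(r * R)) * eLpNorm g 2 volume := by
          gcongr
          · rw [eLpNorm_const_smul]
            gcongr
            rw [← ofReal_norm]; simp
          · exact (eLpNorm_sum_le (fun i _ => hGi i) (by norm_num)).trans
              (Finset.sum_le_sum fun i _ => ei i)
      _ = ENNReal.ofReal (2 + 3 * (2 * k * √(r * R))) * eLpNorm g 2 volume := by
          rw [ENNReal.ofReal_add (by positivity) (by positivity),
            ENNReal.ofReal_mul (p := 3) (by norm_num)]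
          simp [add_mul, mul_assoc]
      _ ≤ _ := by
          gcongr
          linarith
  rw [eLpNorm_const_smul] at htot
  have hk2 : ‖((k ^ 2 : ℝ) : ℂ)‖ₑ = ENNReal.ofReal (k ^ 2) := by
    rw [← ofReal_norm, Complex.norm_real, Real.norm_of_nonneg (by positivity)]
  rw [hk2] at htot
  have hk3 : ENNReal.ofReal ((k ^ 2)⁻¹) * ENNReal.ofReal (k ^ 2) = 1 := by
    rw [← ENNReal.ofReal_mul (by positivity), inv_mul_cancel₀ (by positivity), ENNReal.ofReal_one]
  calc eLpNorm φ 2 μ = ENNReal.ofReal ((k ^ 2)⁻¹) * (ENNReal.ofReal (k ^ 2) * eLpNorm φ 2 μ) := by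
        rw [← mul_assoc, hk3, one_mul]
    _ ≤ ENNReal.ofReal ((k ^ 2)⁻¹) * (ENNReal.ofReal (8 * k * √(r * R)) * eLpNorm g 2 volume) := by
        gcongr
    _ = _ := by
        rw [← mul_assoc, ← ENNReal.ofReal_mul (by positivity)]
        congr 2
        field_simp

/-! ### Uniform Morrey bounds for the Helmholtz equation -/

/-- The equation `Δφ + k²φ - iηφ = g` is solvable in the Schwartz space. -/
theorem exists_schwartz_helmholtz (k : ℝ) {η : ℝ} (hη : 0 < η) (g : 𝓢(E3, ℂ)) :
    ∃ φ : 𝓢(E3, ℂ),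
      (∀ ξ, (((k ^ 2 - (2 * Real.pi) ^ 2 * ‖ξ‖ ^ 2 : ℝ) : ℂ) - η * Complex.I) * 𝓕 φ ξ = 𝓕 g ξ) ∧
      ∀ x, -Complex.I * (η : ℂ) * φ x + Laplacian.laplacian (φ : E3 → ℂ) x
        + ((k ^ 2 : ℝ) : ℂ) * φ x = g x := by
  set s : E3 → ℝ := fun ξ => k ^ 2 - (2 * Real.pi) ^ 2 * ‖ξ‖ ^ 2 with hs
  have hst : s.HasTemperateGrowth := by fun_prop
  -- This is $1/(s-i\eta)=(s+i\eta)/(s^2+\eta^2)$, with the denominator written as a power of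
  -- $1+|s/\eta|^2$ so that temperate growth is visible.
  set m : E3 → ℂ := fun ξ => ((s ξ : ℝ) + η * Complex.I) *
    (((η ^ 2)⁻¹ * (1 + ‖η⁻¹ * s ξ‖ ^ 2) ^ (-1 : ℝ) : ℝ) : ℂ) with hm
  have hmt : m.HasTemperateGrowth := by
    have h1 : (fun ξ => (1 + ‖η⁻¹ * s ξ‖ ^ 2) ^ (-1 : ℝ)).HasTemperateGrowth :=
      (Function.hasTemperateGrowth_one_add_norm_sq_rpow ℝ (-1)).comp
        (f := fun ξ => η⁻¹ * s ξ) (by fun_prop)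
    fun_prop
  have hne : ∀ ξ, m ξ * ((s ξ : ℂ) - η * Complex.I) = 1 := by
    intro ξ
    have h1 : (1 + ‖η⁻¹ * s ξ‖ ^ 2) = (η ^ 2)⁻¹ * (s ξ ^ 2 + η ^ 2) := by
      rw [Real.norm_eq_abs, sq_abs]; field_simp; ring
    have h2 : (η ^ 2)⁻¹ * (1 + ‖η⁻¹ * s ξ‖ ^ 2) ^ (-1 : ℝ) = (s ξ ^ 2 + η ^ 2)⁻¹ := by
      rw [h1, Real.rpow_neg_one]; field_simp
    have h3 : ((s ξ ^ 2 + η ^ 2 : ℝ) : ℂ) ≠ 0 := by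
      exact_mod_cast (by positivity : s ξ ^ 2 + η ^ 2 ≠ 0)
    simp only [hm]
    rw [h2, mul_right_comm, Complex.ofReal_inv]
    rw [show ((s ξ : ℂ) + η * Complex.I) * ((s ξ : ℂ) - η * Complex.I)
      = ((s ξ ^ 2 + η ^ 2 : ℝ) : ℂ) by push_cast; linear_combination -(η : ℂ) ^ 2 * Complex.I_sq]
    exact mul_inv_cancel₀ h3
  set ψ := SchwartzMap.smulLeftCLM ℂ m (𝓕 g) with hψ
  have hψξ : ∀ ξ, ψ ξ = m ξ * 𝓕 g ξ := fun ξ => by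
    rw [hψ, SchwartzMap.smulLeftCLM_apply_apply hmt, smul_eq_mul]
  have hF : ∀ ξ, ((s ξ : ℂ) - η * Complex.I) * ψ ξ = 𝓕 g ξ := fun ξ => by
    rw [hψξ, ← mul_assoc, mul_comm _ (m ξ), hne, one_mul]
  refine ⟨𝓕⁻ ψ, fun ξ => ?_, fun x => ?_⟩
  · rw [FourierTransform.fourier_fourierInv_eq]; exact hF ξ
  · have h1 : ∀ t, (𝓕 g - (((k ^ 2 : ℝ) : ℂ) - η * Complex.I) • ψ) t
        = ((-((2 * Real.pi) ^ 2 * ‖t‖ ^ 2) : ℝ) : ℂ) * ψ t := by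
      intro t
      rw [sub_apply, smul_apply, ← hF t, smul_eq_mul]
      simp only [hs]
      push_cast
      ring
    rw [laplacian_fourierInv h1, fourierInv_sub_smul, FourierTransform.fourierInv_fourier_eq,
      sub_apply, smul_apply, smul_eq_mul]
    ring

/-! ### Dyadic rings and the pairing with concentrated sources -/

theorem measurableSet_dyadicRing (k : ℕ) : MeasurableSet (dyadicRing k) := by
  cases k with
  | zero => exact (isOpen_lt continuous_norm continuous_const).measurableSet
  | succ j =>
    exact (isClosed_le continuous_const continuous_norm).measurableSet.inter
      (isOpen_lt continuous_norm continuous_const).measurableSet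

theorem norm_lt_of_mem_dyadicRing {k : ℕ} {x : E3} (hx : x ∈ dyadicRing k) : ‖x‖ < 2 ^ k := by
  cases k with
  | zero => simpa [dyadicRing] using hx
  | succ j => exact hx.2

theorem exists_mem_dyadicRing (x : E3) : ∃ k, x ∈ dyadicRing k := by
  rcases lt_or_ge ‖x‖ 1 with h | h
  · exact ⟨0, h⟩
  · obtain ⟨n, h1, h2⟩ := exists_nat_pow_near h one_lt_two
    exact ⟨n + 1, h1, h2⟩

/-- A concentrating source in `B` acts boundedly on functions satisfying a Morrey bound. -/
theorem lintegral_concentrated_mul_le {S : E3 → ℂ} (hS : AEStronglyMeasurable S volume) (q : E3)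
    {ε : ℝ} (hε : 0 < ε) {φ : E3 → ℂ} (hφ : AEStronglyMeasurable φ volume) {N : ℝ≥0∞} {A : ℝ}
    (hA : 0 ≤ A)
    (hN : ∀ r, ε ≤ r → eLpNorm φ 2 (volume.restrict (Metric.ball q r))
      ≤ ENNReal.ofReal (A * √r * ε) * N) :
    ∫⁻ x, ‖(((ε ^ 3)⁻¹ : ℝ) : ℂ) * S (ε⁻¹ • (x - q))‖ₑ * ‖φ x‖ₑ
      ≤ ENNReal.ofReal A * bNorm S * N := by
  set T : E3 → ℂ := fun x => (((ε ^ 3)⁻¹ : ℝ) : ℂ) * S (ε⁻¹ • (x - q)) with hT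
  have hqm : Measure.QuasiMeasurePreserving (fun x : E3 => ε⁻¹ • (x - q)) volume volume := by
    refine Measure.QuasiMeasurePreserving.comp (g := fun x : E3 => ε⁻¹ • x)
      (f := fun x : E3 => x - q) (μb := volume) ⟨by fun_prop, ?_⟩
      (measurePreserving_sub_right volume q).quasiMeasurePreserving
    rw [Measure.map_addHaar_smul _ (inv_ne_zero hε.ne')]
    exact Measure.smul_absolutelyContinuous
  have hTm : AEStronglyMeasurable T volume := (hS.comp_quasiMeasurePreserving hqm).const_mul _
  set I : ℕ → ℝ≥0∞ := fun k => ∫⁻ x in dyadicRing k, ‖S x‖ₑ ^ 2 with hI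
  set D : ℕ → Set E3 := fun k => (fun x : E3 => ε⁻¹ • (x - q)) ⁻¹' dyadicRing k with hD
  have hDm : ∀ k, MeasurableSet (D k) := fun k =>
    (by fun_prop : Measurable fun x : E3 => ε⁻¹ • (x - q)) (measurableSet_dyadicRing k)
  have hTI : ∀ k, ∫⁻ x in D k, ‖T x‖ₑ ^ 2 = ENNReal.ofReal ((ε ^ 3)⁻¹) * I k := by
    intro k
    have hm : AEMeasurable ((dyadicRing k).indicator fun x => ‖S x‖ₑ ^ 2) volume :=
      (hS.enorm.pow_const 2).indicator (measurableSet_dyadicRing k)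
    have h1 := lintegral_affine ε⁻¹ (inv_ne_zero hε.ne') _ hm (-(ε⁻¹ • q))
    rw [lintegral_indicator (measurableSet_dyadicRing k)] at h1
    have h2 : ∀ x, (D k).indicator (fun x => ‖T x‖ₑ ^ 2) x = ENNReal.ofReal ((ε ^ 3)⁻¹) ^ 2 *
        (dyadicRing k).indicator (fun x => ‖S x‖ₑ ^ 2) (-(ε⁻¹ • q) + ε⁻¹ • x) := by
      intro x
      have e : -(ε⁻¹ • q) + ε⁻¹ • x = ε⁻¹ • (x - q) := by rw [smul_sub]; abel
      rw [e]
      by_cases hx : x ∈ D k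
      · rw [indicator_of_mem hx, indicator_of_mem (show _ ∈ dyadicRing k from hx)]
        simp only [hT, enorm_mul, mul_pow]
        congr 2
        rw [← ofReal_norm, Complex.norm_real, Real.norm_of_nonneg (by positivity)]
      · rw [indicator_of_notMem hx, indicator_of_notMem (show _ ∉ dyadicRing k from hx), mul_zero]
    rw [← lintegral_indicator (hDm k), lintegral_congr h2, lintegral_const_mul' _ _ (by finiteness),
      h1, ← mul_assoc]
    congr 1
    have e : |((ε⁻¹ ^ 3)⁻¹)| = ε ^ 3 := by
      rw [inv_pow, inv_inv, abs_of_pos (by positivity)]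
    rw [e, ← ENNReal.ofReal_pow (by positivity), ← ENNReal.ofReal_mul (by positivity)]
    congr 1
    field_simp
  have hpiece : ∀ k, ∫⁻ x in D k, ‖T x‖ₑ * ‖φ x‖ₑ
      ≤ ENNReal.ofReal A * (2 ^ k * I k) ^ (1 / 2 : ℝ) * N := by
    intro k
    -- The smallest rescaled ring has radius exactly $\varepsilon$, so the assumption on $\varphi$
    -- is only needed for $r\ge\varepsilon$.
    have hr : ε ≤ ε * 2 ^ k := le_mul_of_one_le_right hε.le (one_le_pow₀ one_le_two)
    have h1 := sq_lintegral_mul_le (μ := volume.restrict (D k)) hTm.enorm.restrict hφ.enorm.restrict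
    have h2 := ENNReal.rpow_le_rpow h1 (show (0 : ℝ) ≤ 1 / 2 by norm_num)
    have h3 : ((∫⁻ x in D k, ‖T x‖ₑ * ‖φ x‖ₑ) ^ 2) ^ (1 / 2 : ℝ)
        = ∫⁻ x in D k, ‖T x‖ₑ * ‖φ x‖ₑ := by
      rw [← ENNReal.rpow_natCast, ← ENNReal.rpow_mul]; simp
    rw [h3, ENNReal.mul_rpow_of_nonneg _ _ (by norm_num), hTI k] at h2
    have h4 : (∫⁻ x in D k, ‖φ x‖ₑ ^ 2) ^ (1 / 2 : ℝ)
        ≤ ENNReal.ofReal (A * √(ε * 2 ^ k) * ε) * N := by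
      refine le_trans ?_ (hN _ hr)
      rw [eLpNorm_eq_lintegral_rpow_enorm_toReal (by norm_num) (by norm_num)]
      simp only [ENNReal.toReal_ofNat, ENNReal.rpow_ofNat]
      refine ENNReal.rpow_le_rpow (lintegral_mono_set fun x hx => ?_) (by norm_num)
      have := norm_lt_of_mem_dyadicRing (show ε⁻¹ • (x - q) ∈ dyadicRing k from hx)
      rw [norm_smul, norm_inv, Real.norm_of_nonneg hε.le, inv_mul_lt_iff₀ hε] at this
      rwa [Metric.mem_ball, dist_eq_norm]
    refine h2.trans ((mul_le_mul_right h4 _).trans (le_of_eq ?_))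
    rw [ENNReal.mul_rpow_of_nonneg _ _ (by norm_num), ENNReal.mul_rpow_of_nonneg _ _ (by norm_num),
      ENNReal.ofReal_rpow_of_nonneg (by positivity) (by norm_num), ← Real.sqrt_eq_rpow]
    have h5 : ((2 : ℝ≥0∞) ^ k) ^ (1 / 2 : ℝ) = ENNReal.ofReal (√(2 ^ k)) := by
      rw [Real.sqrt_eq_rpow, ← ENNReal.ofReal_rpow_of_nonneg (by positivity) (by norm_num),
        ENNReal.ofReal_pow (by norm_num)]
      simp
    -- The powers of $\varepsilon$ cancel:
    -- $\varepsilon^{-3/2}\cdot\sqrt{\varepsilon2^k}\cdot\varepsilon=\sqrt{2^k}$, and $\sqrt{2^k}$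
    -- is the weight of ring $k$ in the norm of $B$.
    have h6 : √((ε ^ 3)⁻¹) * (A * √(ε * 2 ^ k) * ε) = A * √(2 ^ k) := by
      have : √((ε ^ 3)⁻¹) * √(ε * 2 ^ k) = ε⁻¹ * √(2 ^ k) := by
        rw [← Real.sqrt_mul (by positivity),
          show (ε ^ 3)⁻¹ * (ε * 2 ^ k) = (ε⁻¹) ^ 2 * 2 ^ k by field_simp,
          Real.sqrt_mul (by positivity), Real.sqrt_sq (by positivity)]
      calc _ = A * ε * (√((ε ^ 3)⁻¹) * √(ε * 2 ^ k)) := by ring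
        _ = _ := by rw [this]; field_simp
    have h7 : ENNReal.ofReal (√((ε ^ 3)⁻¹)) * ENNReal.ofReal (A * √(ε * 2 ^ k) * ε)
        = ENNReal.ofReal A * ENNReal.ofReal (√(2 ^ k)) := by
      rw [← ENNReal.ofReal_mul (by positivity), h6, ENNReal.ofReal_mul hA]
    rw [h5, ← mul_assoc (ENNReal.ofReal A), ← h7]
    ring
  have hcov : ⋃ k, D k = univ := by
    refine eq_univ_of_forall fun x => ?_
    obtain ⟨k, hk⟩ := exists_mem_dyadicRing (ε⁻¹ • (x - q))
    exact mem_iUnion.2 ⟨k, hk⟩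
  calc ∫⁻ x, ‖T x‖ₑ * ‖φ x‖ₑ = ∫⁻ x in ⋃ k, D k, ‖T x‖ₑ * ‖φ x‖ₑ := by
        rw [hcov, Measure.restrict_univ]
    _ ≤ ∑' k, ∫⁻ x in D k, ‖T x‖ₑ * ‖φ x‖ₑ := lintegral_iUnion_le _ _
    _ ≤ ∑' k, ENNReal.ofReal A * (2 ^ k * I k) ^ (1 / 2 : ℝ) * N := ENNReal.tsum_le_tsum hpiece
    _ = _ := by rw [ENNReal.tsum_mul_right, ENNReal.tsum_mul_left]; rfl

/-- Transposition: the weak formulation is bilinear, so a solution $\varphi$ of the same equation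
with source $g$ gives $\int ug=\int S\varphi$. The ball-to-ball resolvent estimate is then used with
centres $0$ and $q$, one for each source. -/
theorem enorm_integral_mul_le_of_helmholtz {a ε : ℝ} (ha : 0 < a) (hε : 0 < ε) {S₀ S₁ : E3 → ℂ}
    (h₀ : MemB S₀) (h₁ : MemB S₁) {q : E3} {u : E3 → ℂ}
    (hu : IsHelmholtzSolution a ε (source S₀ S₁ q ε) u) (z : E3) {R : ℝ} (hR : ε ≤ R)
    {g : 𝓢(E3, ℂ)} (hg : ∀ x, x ∉ Metric.ball z R → g x = 0) :
    ‖∫ x, u x * g x‖ₑ ≤ ENNReal.ofReal (8 * √R) * (bNorm S₀ + bNorm S₁) * eLpNorm g 2 volume := by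
  have hη : 0 < a / ε := div_pos ha hε
  have hRpos : 0 < R := hε.trans_le hR
  obtain ⟨φ, hφ1, hφ2⟩ := exists_schwartz_helmholtz ε⁻¹ hη g
  have hweak := hu.weak φ
  have e1 : ∀ x, u x * (-Complex.I * ((a / ε : ℝ) : ℂ) * φ x
      + Laplacian.laplacian (φ : E3 → ℂ) x + (((ε ^ 2)⁻¹ : ℝ) : ℂ) * φ x) = u x * g x := by
    intro x
    rw [← hφ2 x, inv_pow]
  simp only [e1] at hweak
  rw [hweak]
  have hN : ∀ p : E3, ∀ r, ε ≤ r → eLpNorm φ 2 (volume.restrict (Metric.ball p r))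
      ≤ ENNReal.ofReal (8 * √R * √r * ε) * eLpNorm g 2 volume := by
    intro p r hr
    have hrpos : 0 < r := hε.trans_le hr
    have hone : 1 ≤ ε⁻¹ ^ 2 * (r * R) := by
      have : ε * ε ≤ r * R := by gcongr
      rw [inv_pow, inv_mul_eq_div, one_le_div (by positivity)]
      nlinarith
    refine (eLpNorm_resolvent_le (inv_pos.2 hε) hη hrpos hRpos hone p z hφ1 hg).trans
      (le_of_eq ?_)
    rw [Real.sqrt_mul hrpos.le, div_inv_eq_mul]
    congr 2
    ring
  have hA : (0 : ℝ) ≤ 8 * √R := by positivity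
  have b0 := lintegral_concentrated_mul_le h₀.1 0 hε φ.continuous.aestronglyMeasurable hA (hN 0)
  have b1 := lintegral_concentrated_mul_le h₁.1 q hε φ.continuous.aestronglyMeasurable hA (hN q)
  simp only [sub_zero] at b0
  have hm0 : AEMeasurable
      (fun x => ‖(((ε ^ 3)⁻¹ : ℝ) : ℂ) * S₀ (ε⁻¹ • x)‖ₑ * ‖φ x‖ₑ) volume := by
    have hqm : Measure.QuasiMeasurePreserving (fun x : E3 => ε⁻¹ • x) volume volume := by
      refine ⟨by fun_prop, ?_⟩
      rw [Measure.map_addHaar_smul _ (inv_ne_zero hε.ne')]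
      exact Measure.smul_absolutelyContinuous
    exact ((h₀.1.comp_quasiMeasurePreserving hqm).const_mul _).enorm.mul
      φ.continuous.enorm.measurable.aemeasurable
  calc ‖∫ x, source S₀ S₁ q ε x * φ x‖ₑ ≤ ∫⁻ x, ‖source S₀ S₁ q ε x * φ x‖ₑ :=
        enorm_integral_le_lintegral_enorm _
    _ ≤ ∫⁻ x, (‖(((ε ^ 3)⁻¹ : ℝ) : ℂ) * S₀ (ε⁻¹ • x)‖ₑ * ‖φ x‖ₑ
          + ‖(((ε ^ 3)⁻¹ : ℝ) : ℂ) * S₁ (ε⁻¹ • (x - q))‖ₑ * ‖φ x‖ₑ) := by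
        refine lintegral_mono fun x => ?_
        rw [← add_mul, enorm_mul]
        gcongr
        exact enorm_add_le _ _
    _ ≤ _ := by
        rw [lintegral_add_left' hm0]
        refine (add_le_add b0 b1).trans (le_of_eq ?_)
        ring

/-! ### Local bounds by duality -/

/-- An `L²` function whose pairing with Schwartz functions supported in a ball is bounded is
bounded in `L²` of a smaller ball. -/
theorem setLIntegral_enorm_sq_le_of_pairing {u : E3 → ℂ} (hu : MemLp u 2 volume) {z : E3}
    {R : ℝ} (hR : 0 < R) {A : ℝ≥0∞}
    (h : ∀ g : 𝓢(E3, ℂ), (∀ x, x ∉ Metric.ball z (2 * R) → g x = 0) →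
      ‖∫ x, u x * g x‖ₑ ≤ A * eLpNorm g 2 volume) :
    ∫⁻ x in Metric.ball z R, ‖u x‖ₑ ^ 2 ≤ A ^ 2 := by
  rcases eq_or_ne A ∞ with rfl | hA
  · simp
  -- Equal to $1$ on the ball of radius $R$ and supported in that of radius $2R$. Cutting off any
  -- Schwartz function by `χ` gives an admissible test of no larger norm, so density of the Schwartz
  -- space in $L^2$ applies to $\chi\bar u$.
  let χ : ContDiffBump z := ⟨R, 2 * R, hR, by linarith⟩
  have hχ1 : ∀ x, ‖(χ x : ℂ)‖ ≤ 1 := fun x => by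
    rw [Complex.norm_real, Real.norm_of_nonneg χ.nonneg]; exact χ.le_one
  have hχm : AEStronglyMeasurable (fun x => (χ x : ℂ)) volume :=
    (Complex.continuous_ofReal.comp χ.continuous).aestronglyMeasurable
  have hχt : (fun x => (χ x : ℂ)).HasTemperateGrowth := by
    refine HasCompactSupport.hasTemperateGrowth ?_ (Complex.ofRealCLM.contDiff.comp χ.contDiff)
    exact χ.hasCompactSupport.comp_left (g := Complex.ofReal) (by simp)
  have hv : MemLp (fun x => conj (u x) * χ x) 2 volume := by
    refine hu.of_le ((Complex.continuous_conj.comp_aestronglyMeasurable hu.1).mul hχm) ?_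
    refine Eventually.of_forall fun x => ?_
    rw [norm_mul, RCLike.norm_conj]
    exact mul_le_of_le_one_right (norm_nonneg _) (hχ1 x)
  set w := hv.toLp with hw
  have key : ∀ f : Lp ℂ 2 (volume : Measure E3), ‖inner ℂ w f‖ ≤ A.toReal * ‖f‖ := by
    intro f
    refine DenseRange.induction_on (p := fun f => ‖inner ℂ w f‖ ≤ A.toReal * ‖f‖)
      (SchwartzMap.denseRange_toLpCLM (F := ℂ) (E := E3) (p := 2) (μ := volume)
        ENNReal.ofNat_ne_top) f
      (isClosed_le (by fun_prop) (by fun_prop)) fun g => ?_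
    set G : 𝓢(E3, ℂ) := SchwartzMap.smulLeftCLM ℂ (fun x => (χ x : ℂ)) g with hG
    have hGx : ∀ x, G x = χ x * g x := fun x => by
      rw [hG, SchwartzMap.smulLeftCLM_apply_apply hχt, smul_eq_mul]
    have h1 := h G fun x hx => by
      rw [hGx, χ.zero_of_le_dist (by simpa using hx)]; simp
    have h2 : inner ℂ w (g.toLp 2) = ∫ x, u x * G x := by
      rw [L2.inner_def]
      refine integral_congr_ae ?_
      filter_upwards [hv.coeFn_toLp, g.coeFn_toLp 2 volume] with x hx1 hx2
      rw [hw, hx1, hx2, hGx]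
      simp [mul_comm, mul_assoc]
    have h3 : eLpNorm G 2 volume ≤ eLpNorm g 2 volume := by
      refine eLpNorm_mono fun x => ?_
      rw [hGx, norm_mul]
      exact mul_le_of_le_one_left (norm_nonneg _) (hχ1 x)
    have hfin : A * eLpNorm g 2 volume ≠ ∞ :=
      ENNReal.mul_ne_top hA (g.eLpNorm_lt_top 2 volume).ne
    have h5 : ‖∫ x, u x * G x‖ₑ ≤ A * eLpNorm g 2 volume := h1.trans (mul_le_mul_right h3 A)
    have h6 := ENNReal.toReal_mono hfin h5
    rw [toReal_enorm, ENNReal.toReal_mul] at h6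
    rw [SchwartzMap.toLpCLM_apply, h2, SchwartzMap.norm_toLp]
    exact h6
  -- Test the bounded functional on its own representative.
  have hwn : ‖w‖ ≤ A.toReal := by
    have := key w
    rw [inner_self_eq_norm_sq_to_K] at this
    rcases eq_or_ne ‖w‖ 0 with h0 | h0
    · rw [h0]; exact ENNReal.toReal_nonneg
    · have h1 : ‖w‖ * ‖w‖ ≤ A.toReal * ‖w‖ := by simpa [sq] using this
      exact le_of_mul_le_mul_right h1 (lt_of_le_of_ne (norm_nonneg _) (Ne.symm h0))
  have hwe : eLpNorm (fun x => conj (u x) * χ x) 2 volume ≤ A := by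
    rw [← ENNReal.toReal_le_toReal hv.2.ne hA, ← Lp.norm_toLp _ hv]
    exact hwn
  have h4 : ∫⁻ x, ‖conj (u x) * χ x‖ₑ ^ 2 ≤ A ^ 2 := by
    rw [eLpNorm_eq_lintegral_rpow_enorm_toReal (by norm_num) (by norm_num)] at hwe
    simp only [ENNReal.toReal_ofNat, ENNReal.rpow_ofNat] at hwe
    have := pow_le_pow_left' hwe 2
    rw [← ENNReal.rpow_natCast, ← ENNReal.rpow_mul] at this
    simpa using this
  refine le_trans ?_ h4
  rw [← lintegral_indicator Metric.isOpen_ball.measurableSet]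
  refine lintegral_mono fun x => ?_
  by_cases hx : x ∈ Metric.ball z R
  · rw [indicator_of_mem hx, χ.one_of_mem_closedBall (Metric.ball_subset_closedBall hx)]
    simp
  · rw [indicator_of_notMem hx]; exact zero_le

/-- The solution of the Helmholtz equation is bounded in Morrey norm, uniformly in the centre of
the ball, the wave length and the absorption. -/
theorem setLIntegral_ball_helmholtz_le {a ε : ℝ} (ha : 0 < a) (hε : 0 < ε) {S₀ S₁ : E3 → ℂ}
    (h₀ : MemB S₀) (h₁ : MemB S₁) {q : E3} {u : E3 → ℂ}
    (hu : IsHelmholtzSolution a ε (source S₀ S₁ q ε) u) (z : E3) {R : ℝ} (hR : ε ≤ R) :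
    ∫⁻ x in Metric.ball z R, ‖u x‖ₑ ^ 2
      ≤ 128 * (bNorm S₀ + bNorm S₁) ^ 2 * ENNReal.ofReal R := by
  have hRpos : 0 < R := hε.trans_le hR
  -- Tests live in the doubled ball, so the constant is $(8\sqrt{2R})^2=128R$.
  refine (setLIntegral_enorm_sq_le_of_pairing hu.memLp hRpos fun g hg =>
    enorm_integral_mul_le_of_helmholtz ha hε h₀ h₁ hu z (by linarith) hg).trans (le_of_eq ?_)
  rw [mul_pow, ← ENNReal.ofReal_pow (by positivity), mul_pow, Real.sq_sqrt (by positivity),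
    show (8 : ℝ) ^ 2 * (2 * R) = 128 * R by ring, ENNReal.ofReal_mul (by norm_num)]
  simp only [ENNReal.ofReal_ofNat]
  ring

/-! ### Weighted bounds -/

/-- The weight `(1 + |x|) ^ (-(1 + p))`. -/
noncomputable def decayWeight (p : ℝ) (x : E3) : ℝ := (1 + ‖x‖) ^ (-(1 + p))

theorem decayWeight_pos (p : ℝ) (x : E3) : 0 < decayWeight p x :=
  Real.rpow_pos_of_pos (by positivity) _

theorem continuous_decayWeight (p : ℝ) : Continuous (decayWeight p) :=
  Continuous.rpow_const (by fun_prop) fun x => Or.inl (by positivity)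

@[fun_prop] theorem measurable_decayWeight (p : ℝ) : Measurable (decayWeight p) :=
  (continuous_decayWeight p).measurable

theorem decayWeight_le_one {p : ℝ} (hp : 0 < p) (x : E3) : decayWeight p x ≤ 1 :=
  Real.rpow_le_one_of_one_le_of_nonpos (by linarith [norm_nonneg x]) (by linarith)

/-- The weighted mass of a measure whose balls of radius `R ≥ 1` have mass at most `R`. -/
noncomputable def weightedMass (p : ℝ) : ℝ≥0∞ :=
  ∑' k : ℕ, ENNReal.ofReal ((2 ^ k / 2) ^ (-(1 + p))) * ENNReal.ofReal (2 ^ k)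

theorem weightedMass_lt_top {p : ℝ} (hp : 0 < p) : weightedMass p < ∞ := by
  have h : ∀ k : ℕ, ENNReal.ofReal ((2 ^ k / 2) ^ (-(1 + p))) * ENNReal.ofReal (2 ^ k)
      = ENNReal.ofReal (2 ^ (1 + p) * ((2 : ℝ) ^ (-p)) ^ k) := by
    intro k
    rw [← ENNReal.ofReal_mul (by positivity)]
    congr 1
    rw [Real.div_rpow (by positivity) (by norm_num), ← Real.rpow_natCast (2 ^ (-p)),
      ← Real.rpow_mul (by norm_num), ← Real.rpow_natCast, ← Real.rpow_mul (by norm_num),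
      div_eq_mul_inv, ← Real.rpow_neg (by norm_num), ← Real.rpow_add (by norm_num),
      ← Real.rpow_add (by norm_num), ← Real.rpow_add (by norm_num)]
    congr 1
    ring
  have hs : Summable fun k : ℕ => 2 ^ (1 + p) * ((2 : ℝ) ^ (-p)) ^ k :=
    (summable_geometric_of_lt_one (by positivity)
      (Real.rpow_lt_one_of_one_lt_of_neg one_lt_two (by linarith))).mul_left _
  unfold weightedMass
  simp only [h]
  exact lt_top_iff_ne_top.2 hs.tsum_ofReal_ne_top

/-- Ring $k$ contributes about $2^{-k(1+p)}\cdot2^k=2^{-kp}$, which is summable precisely because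
$p>0$. -/
theorem lintegral_decayWeight_le {ν : Measure E3} {K : ℝ≥0∞}
    (hν : ∀ R : ℝ, 1 ≤ R → ν (Metric.ball 0 R) ≤ K * ENNReal.ofReal R) {p : ℝ} (hp : 0 < p) :
    ∫⁻ x, ENNReal.ofReal (decayWeight p x) ∂ν ≤ K * weightedMass p := by
  have hcov : ⋃ k, dyadicRing k = univ := eq_univ_of_forall fun x =>
    mem_iUnion.2 (exists_mem_dyadicRing x)
  -- With rings numbered from $0$, ring $k$ satisfies $1+|x|\ge2^k/2$, including the unit ball at
  -- $k=0$.
  have hlow : ∀ k, ∀ x ∈ dyadicRing k, decayWeight p x ≤ (2 ^ k / 2) ^ (-(1 + p)) := by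
    intro k x hx
    refine Real.rpow_le_rpow_of_nonpos (by positivity) ?_ (by linarith)
    cases k with
    | zero => norm_num; linarith [norm_nonneg x]
    | succ j => rw [pow_succ, mul_div_cancel_right₀ _ two_ne_zero]; linarith [hx.1]
  calc ∫⁻ x, ENNReal.ofReal (decayWeight p x) ∂ν
      = ∫⁻ x in ⋃ k, dyadicRing k, ENNReal.ofReal (decayWeight p x) ∂ν := by
        rw [hcov, Measure.restrict_univ]
    _ ≤ ∑' k, ∫⁻ x in dyadicRing k, ENNReal.ofReal (decayWeight p x) ∂ν := lintegral_iUnion_le _ _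
    _ ≤ ∑' k : ℕ, K * (ENNReal.ofReal ((2 ^ k / 2) ^ (-(1 + p))) * ENNReal.ofReal (2 ^ k)) := by
        refine ENNReal.tsum_le_tsum fun k => ?_
        calc _ ≤ ∫⁻ x in dyadicRing k, ENNReal.ofReal ((2 ^ k / 2) ^ (-(1 + p))) ∂ν :=
              setLIntegral_mono' (measurableSet_dyadicRing k) fun x hx =>
                ENNReal.ofReal_le_ofReal (hlow k x hx)
          _ = ENNReal.ofReal ((2 ^ k / 2) ^ (-(1 + p))) * ν (dyadicRing k) := setLIntegral_const _ _
          _ ≤ ENNReal.ofReal ((2 ^ k / 2) ^ (-(1 + p))) * (K * ENNReal.ofReal (2 ^ k)) := by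
              gcongr
              refine (measure_mono fun x hx => ?_).trans (hν (2 ^ k) (one_le_pow₀ one_le_two))
              rw [Metric.mem_ball, dist_zero_right]
              exact norm_lt_of_mem_dyadicRing hx
          _ = _ := by ring
    _ = _ := ENNReal.tsum_mul_left

/-- A uniform Morrey bound at scales larger than `1`. -/
def MorreyBound (u : E3 → ℂ) (K : ℝ≥0∞) : Prop :=
  ∀ z : E3, ∀ R : ℝ, 1 ≤ R → ∫⁻ x in Metric.ball z R, ‖u x‖ₑ ^ 2 ≤ K * ENNReal.ofReal R

theorem setLIntegral_ball_add (f : E3 → ℝ≥0∞) (s z : E3) (R : ℝ) :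
    ∫⁻ x in Metric.ball z R, f (x + s) = ∫⁻ x in Metric.ball (z + s) R, f x := by
  rw [← lintegral_indicator Metric.isOpen_ball.measurableSet,
    ← lintegral_indicator Metric.isOpen_ball.measurableSet,
    ← lintegral_add_right_eq_self ((Metric.ball (z + s) R).indicator f) s]
  refine lintegral_congr fun x => ?_
  simp only [indicator, Metric.mem_ball, dist_add_right]

/-- Translating $u$ only moves the centres of the balls, and the Morrey bound is uniform in the
centre. Hence the shifts $\pm\varepsilon y/2$ in the two-point function cost nothing, whatever the
size of $y$. -/
theorem MorreyBound.lintegral_decayWeight_le {u : E3 → ℂ} {K : ℝ≥0∞} (h : MorreyBound u K)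
    (hu : AEStronglyMeasurable u volume) {p : ℝ} (hp : 0 < p) (s : E3) :
    ∫⁻ x, ‖u (x + s)‖ₑ ^ 2 * ENNReal.ofReal (decayWeight p x) ≤ K * weightedMass p := by
  have hm : AEMeasurable (fun x => ‖u (x + s)‖ₑ ^ 2) volume :=
    (hu.comp_quasiMeasurePreserving
      (measurePreserving_add_right volume s).quasiMeasurePreserving).enorm.pow_const 2
  have := _root_.lintegral_decayWeight_le (ν := volume.withDensity fun x => ‖u (x + s)‖ₑ ^ 2)
    (K := K) (fun R hR => ?_) hp
  · rwa [lintegral_withDensity_eq_lintegral_mul₀ hm (by fun_prop)] at this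
  · rw [withDensity_apply _ Metric.isOpen_ball.measurableSet,
      setLIntegral_ball_add fun x => ‖u x‖ₑ ^ 2]
    exact h _ _ hR

theorem mul_le_sq_add_sq_ennreal (a b : ℝ≥0∞) : a * b ≤ a ^ 2 + b ^ 2 := by
  rcases le_total a b with h | h
  · calc a * b ≤ b * b := by gcongr
      _ ≤ _ := by rw [← sq]; exact le_add_self
  · calc a * b ≤ a * a := by gcongr
      _ ≤ _ := by rw [← sq]; exact le_self_add

theorem MorreyBound.lintegral_twoPoint_le {u : E3 → ℂ} {K : ℝ≥0∞} (h : MorreyBound u K)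
    (hu : AEStronglyMeasurable u volume) {p : ℝ} (hp : 0 < p) (ε : ℝ) (y : E3) :
    ∫⁻ x, ‖twoPoint ε u x y‖ₑ * ENNReal.ofReal (decayWeight p x) ≤ 2 * K * weightedMass p := by
  have h1 := h.lintegral_decayWeight_le hu hp ((ε / 2) • y)
  have h2 := h.lintegral_decayWeight_le hu hp (-((ε / 2) • y))
  have hm : AEMeasurable
      (fun x => ‖u (x + (ε / 2) • y)‖ₑ ^ 2 * ENNReal.ofReal (decayWeight p x)) volume :=
    ((hu.comp_quasiMeasurePreserving (measurePreserving_add_right volume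
      ((ε / 2) • y)).quasiMeasurePreserving).enorm.pow_const 2).mul (by fun_prop)
  calc _ ≤ ∫⁻ x, (‖u (x + (ε / 2) • y)‖ₑ ^ 2 * ENNReal.ofReal (decayWeight p x)
        + ‖u (x + -((ε / 2) • y))‖ₑ ^ 2 * ENNReal.ofReal (decayWeight p x)) := by
        refine lintegral_mono fun x => ?_
        rw [← add_mul]
        gcongr
        simp only [twoPoint, enorm_mul, RCLike.enorm_conj, sub_eq_add_neg]
        exact mul_le_sq_add_sq_ennreal _ _
    _ ≤ K * weightedMass p + K * weightedMass p := by
        rw [lintegral_add_left' hm]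
        exact add_le_add h1 h2
    _ = _ := by ring

/-! ### The space `X_λ` -/

/-- The weighted supremum in the definition of the norm of `X_λ`. -/
noncomputable def xSup (lam : ℝ) (φ : E3 → E3 → ℂ) (y : E3) : ℝ≥0∞ :=
  ⨆ x, ENNReal.ofReal ((1 + ‖x‖ + ‖y‖) ^ (1 + lam)) * ‖φ x y‖ₑ

theorem enorm_le_xSup {lam : ℝ} (hlam : 0 < lam) (φ : E3 → E3 → ℂ) (x y : E3) :
    ‖φ x y‖ₑ ≤ xSup lam φ y * ENNReal.ofReal (decayWeight lam x) := by
  have h1 : ENNReal.ofReal ((1 + ‖x‖) ^ (1 + lam)) * ‖φ x y‖ₑ ≤ xSup lam φ y := by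
    refine le_trans ?_ (le_iSup _ x)
    refine mul_le_mul_left (ENNReal.ofReal_le_ofReal ?_) _
    exact Real.rpow_le_rpow (by positivity) (by linarith [norm_nonneg y]) (by linarith)
  have h2 : ENNReal.ofReal (decayWeight lam x) * ENNReal.ofReal ((1 + ‖x‖) ^ (1 + lam)) = 1 := by
    rw [← ENNReal.ofReal_mul (decayWeight_pos _ _).le, decayWeight, ← Real.rpow_add (by positivity)]
    simp
  calc ‖φ x y‖ₑ = ENNReal.ofReal (decayWeight lam x)
        * (ENNReal.ofReal ((1 + ‖x‖) ^ (1 + lam)) * ‖φ x y‖ₑ) := by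
        rw [← mul_assoc, h2, one_mul]
    _ ≤ ENNReal.ofReal (decayWeight lam x) * xSup lam φ y := by gcongr
    _ = _ := mul_comm _ _

namespace MemX

variable {lam : ℝ} {φ : E3 → E3 → ℂ}

/-- Continuity in $x$ reduces the supremum to a countable dense set. -/
theorem measurable_xSup (hφ : MemX lam φ) : Measurable (xSup lam φ) := by
  obtain ⟨d, hd⟩ := TopologicalSpace.exists_dense_seq E3
  have : xSup lam φ = fun y => ⨆ n : ℕ,
      ENNReal.ofReal ((1 + ‖d n‖ + ‖y‖) ^ (1 + lam)) * ‖φ (d n) y‖ₑ := by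
    funext y
    refine le_antisymm (iSup_le fun x => ?_) (iSup_le fun n => ?_)
    · have hcont : Continuous fun x : E3 =>
          ENNReal.ofReal ((1 + ‖x‖ + ‖y‖) ^ (1 + lam)) * ‖φ x y‖ₑ := by
        have h1 : Continuous fun x : E3 => (1 + ‖x‖ + ‖y‖) ^ (1 + lam) :=
          Continuous.rpow_const (by fun_prop) fun x => Or.inl (by positivity)
        have h2 : Continuous fun x : E3 =>
            ENNReal.ofReal ((1 + ‖x‖ + ‖y‖) ^ (1 + lam) * ‖φ x y‖) :=
          ENNReal.continuous_ofReal.comp (h1.mul (hφ.continuous y).norm)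
        convert h2 using 2 with x
        rw [ENNReal.ofReal_mul (by positivity), ofReal_norm]
      refine hd.induction_on (p := fun x => ENNReal.ofReal ((1 + ‖x‖ + ‖y‖) ^ (1 + lam)) * ‖φ x y‖ₑ
        ≤ _) x (isClosed_le hcont continuous_const) fun n => ?_
      exact le_iSup (fun n : ℕ => ENNReal.ofReal ((1 + ‖d n‖ + ‖y‖) ^ (1 + lam)) * ‖φ (d n) y‖ₑ) n
    · exact le_iSup (fun x => ENNReal.ofReal ((1 + ‖x‖ + ‖y‖) ^ (1 + lam)) * ‖φ x y‖ₑ) (d n)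
  rw [this]
  refine Measurable.iSup fun n => ?_
  have h1 : Measurable fun y => φ (d n) y :=
    hφ.measurable.comp (measurable_const.prodMk measurable_id : Measurable fun y => (d n, y))
  fun_prop

theorem ae_xSup_lt_top (hφ : MemX lam φ) : ∀ᵐ y, xSup lam φ y < ∞ :=
  ae_lt_top hφ.measurable_xSup hφ.norm_lt_top.ne

theorem integrable_xSup (hφ : MemX lam φ) : Integrable fun y => (xSup lam φ y).toReal :=
  integrable_toReal_of_lintegral_ne_top hφ.measurable_xSup.aemeasurable hφ.norm_lt_top.ne

theorem ae_norm_le (hφ : MemX lam φ) (hlam : 0 < lam) :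
    ∀ᵐ y, ∀ x, ‖φ x y‖ ≤ (xSup lam φ y).toReal * decayWeight lam x := by
  filter_upwards [hφ.ae_xSup_lt_top] with y hy x
  have h := ENNReal.toReal_mono (ENNReal.mul_ne_top hy.ne ENNReal.ofReal_ne_top)
    (enorm_le_xSup hlam φ x y)
  rwa [toReal_enorm, ENNReal.toReal_mul, ENNReal.toReal_ofReal (decayWeight_pos _ _).le] at h

theorem integrable (hφ : MemX lam φ) (hlam : 0 < lam) (x : E3) : Integrable (φ x) := by
  refine (hφ.integrable_xSup.mul_const (decayWeight lam x)).mono'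
    (hφ.measurable.comp (by fun_prop : Measurable fun y => (x, y))).aestronglyMeasurable ?_
  filter_upwards [hφ.ae_norm_le hlam] with y hy using hy x

end MemX

theorem MorreyBound.lintegral_twoPoint_mul_le {u : E3 → ℂ} {K : ℝ≥0∞} (h : MorreyBound u K)
    (hK : K < ∞) (hu : AEStronglyMeasurable u volume) {lam : ℝ} (hlam : 0 < lam) (ε : ℝ)
    {φ : E3 → E3 → ℂ} (hφ : MemX lam φ) :
    ∫⁻ p : E3 × E3, ‖twoPoint ε u p.1 p.2 * φ p.1 p.2‖ₑ
      ≤ 2 * K * weightedMass lam * xNorm lam φ := by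
  have hm : AEStronglyMeasurable (fun p : E3 × E3 => twoPoint ε u p.1 p.2 * φ p.1 p.2)
      (volume.prod volume) :=
    (measurable_twoPoint hu).mul hφ.measurable.aestronglyMeasurable
  have hfin : 2 * K * weightedMass lam ≠ ∞ :=
    ENNReal.mul_ne_top (ENNReal.mul_ne_top (by simp) hK.ne) (weightedMass_lt_top hlam).ne
  rw [Measure.volume_eq_prod, lintegral_prod_symm _ hm.enorm]
  calc _ ≤ ∫⁻ y, 2 * K * weightedMass lam * xSup lam φ y := by
        refine lintegral_mono_ae ?_
        filter_upwards [hφ.ae_xSup_lt_top] with y hy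
        calc ∫⁻ x, ‖twoPoint ε u x y * φ x y‖ₑ
            ≤ ∫⁻ x, ‖twoPoint ε u x y‖ₑ * ENNReal.ofReal (decayWeight lam x) * xSup lam φ y := by
              refine lintegral_mono fun x => ?_
              rw [enorm_mul, mul_assoc, mul_comm (ENNReal.ofReal _)]
              gcongr
              exact enorm_le_xSup hlam φ x y
          _ = (∫⁻ x, ‖twoPoint ε u x y‖ₑ * ENNReal.ofReal (decayWeight lam x)) * xSup lam φ y :=
              lintegral_mul_const' _ _ hy.ne
          _ ≤ _ := by gcongr; exact h.lintegral_twoPoint_le hu hlam ε y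
    _ = _ := lintegral_const_mul' _ _ hfin

/-- Boundedness of the Wigner transform in the dual of `X_λ`. -/
theorem MorreyBound.integrable_and_norm_wignerBracket_le {u : E3 → ℂ} {K : ℝ≥0∞}
    (h : MorreyBound u K) (hK : K < ∞) (hu : AEStronglyMeasurable u volume) {lam : ℝ}
    (hlam : 0 < lam) (ε : ℝ) {φ : E3 → E3 → ℂ} (hφ : MemX lam φ) :
    Integrable (fun p : E3 × E3 => twoPoint ε u p.1 p.2 * φ p.1 p.2) ∧
      ‖wignerBracket ε u φ‖ ≤ (2 * K * weightedMass lam).toReal * (xNorm lam φ).toReal := by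
  have hb := h.lintegral_twoPoint_mul_le hK hu hlam ε hφ
  have hfin : 2 * K * weightedMass lam * xNorm lam φ ≠ ∞ :=
    ENNReal.mul_ne_top (ENNReal.mul_ne_top (ENNReal.mul_ne_top (by simp) hK.ne)
      (weightedMass_lt_top hlam).ne) hφ.norm_lt_top.ne
  refine ⟨⟨(measurable_twoPoint hu).mul hφ.measurable.aestronglyMeasurable, hb.trans_lt
    hfin.lt_top⟩, ?_⟩
  rw [← ENNReal.toReal_mul, ← toReal_enorm]
  exact ENNReal.toReal_mono hfin ((enorm_integral_le_lintegral_enorm _).trans hb)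

theorem morreyBound_of_helmholtz {a ε : ℝ} (ha : 0 < a) (hε : 0 < ε) (hε1 : ε ≤ 1)
    {S₀ S₁ : E3 → ℂ} (h₀ : MemB S₀) (h₁ : MemB S₁) {q : E3} {u : E3 → ℂ}
    (hu : IsHelmholtzSolution a ε (source S₀ S₁ q ε) u) :
    MorreyBound u (128 * (bNorm S₀ + bNorm S₁) ^ 2) := fun z _ hR =>
  setLIntegral_ball_helmholtz_le ha hε h₀ h₁ hu z (hε1.trans hR)

/-! ### Plancherel's theorem for integrable square integrable functions -/

section Plancherel

variable {V : Type*} [NormedAddCommGroup V] [InnerProductSpace ℝ V] [FiniteDimensional ℝ V]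
  [MeasurableSpace V] [BorelSpace V]

/-- The `L²` Fourier transform of an integrable function is its Fourier integral. -/
theorem fourier_toLp_ae_eq {f : V → ℂ} (h1 : Integrable f) (h2 : MemLp f 2 volume) :
    (𝓕 (h2.toLp) : Lp ℂ 2 (volume : Measure V)) =ᵐ[volume] 𝓕 f := by
  set F : Lp ℂ 2 (volume : Measure V) := 𝓕 (h2.toLp) with hF
  have hc : Continuous (𝓕 f) :=
    VectorFourier.fourierIntegral_continuous Real.continuous_fourierChar
      (by exact continuous_inner) h1
  -- Both sides are locally integrable, so testing on smooth compactly supported functions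
  -- identifies them. On each side the transform moves onto the test function: as a tempered
  -- distribution for the $L^2$ transform, by Fubini for the integral.
  refine ae_eq_of_integral_contDiff_smul_eq
    ((Lp.memLp F).locallyIntegrable (by norm_num)) hc.locallyIntegrable fun g hg hgs => ?_
  have hgs' : HasCompactSupport fun x => (g x : ℂ) := hgs.comp_left (g := Complex.ofReal) (by simp)
  set G : 𝓢(V, ℂ) := hgs'.toSchwartzMap (Complex.ofRealCLM.contDiff.comp hg) with hG
  have hGx : ∀ x, G x = g x := fun x => rfl
  have e1 := congrArg (fun T => T G) (Lp.fourier_toTemperedDistribution_eq h2.toLp)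
  simp only [TemperedDistribution.fourier_apply, Lp.toTemperedDistribution_apply] at e1
  have e2 : ∫ x, 𝓕 (G : V → ℂ) x • f x = ∫ x, G x • 𝓕 f x :=
    VectorFourier.integral_fourierIntegral_smul_eq_flip (L := innerₗ V)
      Real.continuous_fourierChar continuous_inner G.integrable h1 |>.trans (by
        simp; rfl)
  calc ∫ x, g x • F x = ∫ x, G x • F x := by simp [hGx]
    _ = ∫ x, 𝓕 (G : V → ℂ) x • f x := by
      rw [← e1]
      refine integral_congr_ae ?_
      filter_upwards [h2.coeFn_toLp] with x hx
      rw [hx, SchwartzMap.fourier_coe]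
    _ = ∫ x, g x • 𝓕 f x := by rw [e2]; simp [hGx]

theorem memLp_fourier {f : V → ℂ} (h1 : Integrable f) (h2 : MemLp f 2 volume) :
    MemLp (𝓕 f) 2 volume :=
  (memLp_congr_ae (fourier_toLp_ae_eq h1 h2)).1 (Lp.memLp _)

theorem integral_fourier_mul_conj {f g : V → ℂ} (hf1 : Integrable f) (hf2 : MemLp f 2 volume)
    (hg1 : Integrable g) (hg2 : MemLp g 2 volume) :
    ∫ ξ, 𝓕 f ξ * conj (𝓕 g ξ) = ∫ x, f x * conj (g x) := by
  have h := Lp.inner_fourier_eq hg2.toLp hf2.toLp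
  rw [L2.inner_def, L2.inner_def] at h
  have e1 : ∫ ξ, 𝓕 f ξ * conj (𝓕 g ξ) = ∫ ξ, inner ℂ
      ((𝓕 hg2.toLp : Lp ℂ 2 (volume : Measure V)) ξ)
      ((𝓕 hf2.toLp : Lp ℂ 2 (volume : Measure V)) ξ) := by
    refine integral_congr_ae ?_
    filter_upwards [fourier_toLp_ae_eq hf1 hf2, fourier_toLp_ae_eq hg1 hg2] with ξ h1 h2
    rw [h1, h2]
    simp
  have e2 : ∫ x, f x * conj (g x) = ∫ x, inner ℂ ((hg2.toLp : Lp ℂ 2 (volume : Measure V)) x)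
      ((hf2.toLp : Lp ℂ 2 (volume : Measure V)) x) := by
    refine integral_congr_ae ?_
    filter_upwards [hf2.coeFn_toLp, hg2.coeFn_toLp] with ξ h1 h2
    rw [h1, h2]
    simp
  rw [e1, e2, h]

theorem lintegral_enorm_sq_fourier_eq {f : V → ℂ} (h1 : Integrable f) (h2 : MemLp f 2 volume) :
    ∫⁻ ξ, ‖𝓕 f ξ‖ₑ ^ 2 = ∫⁻ x, ‖f x‖ₑ ^ 2 := by
  have h := Lp.norm_fourier_eq h2.toLp
  have e : eLpNorm (𝓕 f) 2 volume = eLpNorm f 2 volume := by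
    rw [← eLpNorm_congr_ae (fourier_toLp_ae_eq h1 h2), ← eLpNorm_congr_ae h2.coeFn_toLp]
    rw [← ENNReal.toReal_eq_toReal_iff' (Lp.memLp _).2.ne (Lp.memLp _).2.ne]
    exact h
  rw [eLpNorm_eq_lintegral_rpow_enorm_toReal (by norm_num) (by norm_num),
    eLpNorm_eq_lintegral_rpow_enorm_toReal (by norm_num) (by norm_num)] at e
  simp only [ENNReal.toReal_ofNat, ENNReal.rpow_ofNat] at e
  have := congrArg (fun t => t ^ 2) e
  simp only [← ENNReal.rpow_natCast, ← ENNReal.rpow_mul] at this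
  simpa using this

/-- The Fourier transform of `|𝓕 f|²` is the autocorrelation of `f`. -/
theorem integral_char_mul_norm_sq_fourier {f : V → ℂ} (h1 : Integrable f) (h2 : MemLp f 2 volume)
    (h : V) :
    ∫ ξ, (Real.fourierChar (inner ℝ h ξ) : ℂ) * ((‖𝓕 f ξ‖ ^ 2 : ℝ) : ℂ)
      = ∫ x, f (x + (1 / 2 : ℝ) • h) * conj (f (x - (1 / 2 : ℝ) • h)) := by
  have hsh : ∀ c : V, Integrable (fun x => f (x + c)) ∧ MemLp (fun x => f (x + c)) 2 volume ∧
      ∀ ξ, 𝓕 (fun x => f (x + c)) ξ = Real.fourierChar (inner ℝ c ξ) * 𝓕 f ξ := by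
    intro c
    refine ⟨h1.comp_add_right c,
      h2.comp_measurePreserving (measurePreserving_add_right volume c), fun ξ => ?_⟩
    rw [Real.fourier_eq, Real.fourier_eq,
      ← integral_add_right_eq_self (fun x => Real.fourierChar (-(inner ℝ x ξ)) • f x) c,
      ← integral_const_mul]
    refine integral_congr_ae (Eventually.of_forall fun x => ?_)
    simp only [Circle.smul_def, smul_eq_mul]
    rw [← mul_assoc, ← Circle.coe_mul, ← AddChar.map_add_eq_mul, inner_add_left]
    congr 4
    ring
  -- Splitting the shift symmetrically as $\pm h/2$ produces the two characters whose product, after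
  -- conjugating one, is the character of $h$. Plancherel polarised does the rest.
  obtain ⟨a1, a2, a3⟩ := hsh ((1 / 2 : ℝ) • h)
  obtain ⟨b1, b2, b3⟩ := hsh (-((1 / 2 : ℝ) • h))
  simp only [sub_eq_add_neg]
  rw [← integral_fourier_mul_conj a1 a2 b1 b2]
  refine integral_congr_ae (Eventually.of_forall fun ξ => ?_)
  simp only [a3, b3, map_mul, inner_neg_left, AddChar.map_neg_eq_inv]
  rw [show ((‖𝓕 f ξ‖ ^ 2 : ℝ) : ℂ) = 𝓕 f ξ * conj (𝓕 f ξ) by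
    rw [Complex.mul_conj, Complex.normSq_eq_norm_sq]]
  have : inner ℝ h ξ = inner ℝ ((1 / 2 : ℝ) • h) ξ + inner ℝ ((1 / 2 : ℝ) • h) ξ := by
    rw [← inner_add_left, ← add_smul]; norm_num
  rw [this, AddChar.map_add_eq_mul, Circle.coe_inv_eq_conj, Circle.coe_mul, Complex.conj_conj]
  ring

end Plancherel

/-! ### Localised windows -/

/-- The `L²`-normalised indicator of the ball of radius `δ`. -/
noncomputable def window (δ : ℝ) : E3 → ℝ :=
  (Metric.ball 0 δ).indicator fun _ => (√(volume.real (Metric.ball (0 : E3) δ)))⁻¹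

/-- The product of two translates of the window. -/
noncomputable def overlap (δ : ℝ) (h w : E3) : ℝ := window δ (w + h) * window δ (w - h)

@[fun_prop] theorem measurable_window (δ : ℝ) : Measurable (window δ) :=
  measurable_const.indicator Metric.isOpen_ball.measurableSet

theorem window_nonneg (δ : ℝ) (t : E3) : 0 ≤ window δ t :=
  indicator_nonneg (fun _ _ => by positivity) _

theorem volume_real_ball_pos {δ : ℝ} (hδ : 0 < δ) : 0 < volume.real (Metric.ball (0 : E3) δ) :=
  ENNReal.toReal_pos (Metric.measure_ball_pos _ _ hδ).ne' measure_ball_lt_top.ne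

theorem window_le (δ : ℝ) (t : E3) : window δ t ≤ (√(volume.real (Metric.ball (0 : E3) δ)))⁻¹ :=
  indicator_le_self' (fun _ _ => by positivity) _

theorem sq_window (δ : ℝ) (t : E3) : window δ t ^ 2
    = (Metric.ball 0 δ).indicator (fun _ => (volume.real (Metric.ball (0 : E3) δ))⁻¹) t := by
  by_cases ht : t ∈ Metric.ball (0 : E3) δ
  · rw [window, indicator_of_mem ht, indicator_of_mem ht, inv_pow, Real.sq_sqrt measureReal_nonneg]
  · rw [window, indicator_of_notMem ht, indicator_of_notMem ht]; simp

theorem lintegral_sq_window {δ : ℝ} (hδ : 0 < δ) :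
    ∫⁻ t, ENNReal.ofReal (window δ t) ^ 2 = 1 := by
  have hV := volume_real_ball_pos hδ
  have : ∀ t, ENNReal.ofReal (window δ t) ^ 2 = (Metric.ball (0 : E3) δ).indicator
      (fun _ => ENNReal.ofReal (volume.real (Metric.ball (0 : E3) δ))⁻¹) t := by
    intro t
    rw [← ENNReal.ofReal_pow (window_nonneg _ _), sq_window]
    by_cases ht : t ∈ Metric.ball (0 : E3) δ
    · rw [indicator_of_mem ht, indicator_of_mem ht]
    · rw [indicator_of_notMem ht, indicator_of_notMem ht, ENNReal.ofReal_zero]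
  rw [lintegral_congr this, lintegral_indicator Metric.isOpen_ball.measurableSet, setLIntegral_const,
    ← ofReal_measureReal measure_ball_lt_top.ne, ← ENNReal.ofReal_mul (by positivity),
    inv_mul_cancel₀ hV.ne', ENNReal.ofReal_one]

theorem memLp_window (δ : ℝ) (x : E3) : MemLp (fun t => window δ (t - x)) 2 volume := by
  have h0 : MemLp (window δ) 2 volume :=
    memLp_indicator_const _ Metric.isOpen_ball.measurableSet _ (Or.inr measure_ball_lt_top.ne)
  exact h0.comp_measurePreserving (measurePreserving_sub_right volume x)

theorem overlap_nonneg (δ : ℝ) (h w : E3) : 0 ≤ overlap δ h w :=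
  mul_nonneg (window_nonneg _ _) (window_nonneg _ _)

@[fun_prop] theorem measurable_overlap (δ : ℝ) : Measurable fun p : E3 × E3 => overlap δ p.1 p.2 := by
  unfold overlap
  fun_prop

theorem overlap_eq (δ : ℝ) (h w : E3) : overlap δ h w
    = (Metric.ball (-h) δ ∩ Metric.ball h δ).indicator
      (fun _ => (volume.real (Metric.ball (0 : E3) δ))⁻¹) w := by
  have e1 : w + h ∈ Metric.ball (0 : E3) δ ↔ w ∈ Metric.ball (-h) δ := by
    simp [Metric.mem_ball, dist_eq_norm]
  have e2 : w - h ∈ Metric.ball (0 : E3) δ ↔ w ∈ Metric.ball h δ := by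
    simp [Metric.mem_ball, dist_eq_norm]
  unfold overlap window
  by_cases h1 : w ∈ Metric.ball (-h) δ
  · by_cases h2 : w ∈ Metric.ball h δ
    · rw [indicator_of_mem (e1.2 h1), indicator_of_mem (e2.2 h2),
        indicator_of_mem (show w ∈ Metric.ball (-h) δ ∩ Metric.ball h δ from ⟨h1, h2⟩),
        ← mul_inv, Real.mul_self_sqrt measureReal_nonneg]
    · rw [indicator_of_notMem (mt e2.1 h2), indicator_of_notMem
        (show w ∉ Metric.ball (-h) δ ∩ Metric.ball h δ from fun hh => h2 hh.2), mul_zero]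
  · rw [indicator_of_notMem (mt e1.1 h1), indicator_of_notMem
      (show w ∉ Metric.ball (-h) δ ∩ Metric.ball h δ from fun hh => h1 hh.1), zero_mul]

theorem overlap_eq_zero {δ : ℝ} (h : E3) {w : E3} (hw : δ ≤ ‖w‖) : overlap δ h w = 0 := by
  rw [overlap_eq]
  refine indicator_of_notMem (fun hh => ?_) _
  have h1 : ‖w + h‖ < δ := by simpa [dist_eq_norm] using hh.1
  have h2 : ‖w - h‖ < δ := by simpa [dist_eq_norm] using hh.2
  have h3 : (2 : ℝ) • w = (w + h) + (w - h) := by rw [two_smul]; abel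
  have h4 : 2 * ‖w‖ ≤ ‖w + h‖ + ‖w - h‖ := by
    have := norm_add_le (w + h) (w - h)
    rw [← h3, norm_smul] at this
    simpa using this
  linarith

theorem integrable_overlap (δ : ℝ) (h : E3) : Integrable (overlap δ h) := by
  rw [show overlap δ h = _ from funext (overlap_eq δ h)]
  refine (integrable_indicator_iff
    (Metric.isOpen_ball.inter Metric.isOpen_ball).measurableSet).2 (integrableOn_const ?_)
  exact ((measure_mono inter_subset_left).trans_lt measure_ball_lt_top).ne

theorem integral_overlap (δ : ℝ) (h : E3) : ∫ w, overlap δ h w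
    = (volume.real (Metric.ball (0 : E3) δ))⁻¹
      * volume.real (Metric.ball (-h) δ ∩ Metric.ball h δ) := by
  rw [show overlap δ h = _ from funext (overlap_eq δ h),
    integral_indicator (Metric.isOpen_ball.inter Metric.isOpen_ball).measurableSet, setIntegral_const,
    smul_eq_mul, mul_comm]

theorem integral_overlap_le_one {δ : ℝ} (hδ : 0 < δ) (h : E3) : ∫ w, overlap δ h w ≤ 1 := by
  have hV := volume_real_ball_pos hδ
  rw [integral_overlap, inv_mul_le_one₀ hV]
  have : volume.real (Metric.ball h δ) = volume.real (Metric.ball (0 : E3) δ) := by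
    rw [measureReal_def, measureReal_def, Measure.addHaar_ball_center]
  rw [← this]
  exact measureReal_mono inter_subset_right measure_ball_lt_top.ne

/-- The centred ball of radius $\delta-|h|$ lies in both translates. The cube is the scaling of
volume in dimension three. -/
theorem le_integral_overlap {δ : ℝ} (hδ : 0 < δ) {h : E3} (hh : ‖h‖ ≤ δ) :
    (1 - ‖h‖ / δ) ^ 3 ≤ ∫ w, overlap δ h w := by
  have hV := volume_real_ball_pos hδ
  rw [integral_overlap, le_inv_mul_iff₀ hV]
  have hsub : Metric.ball (0 : E3) (δ - ‖h‖) ⊆ Metric.ball (-h) δ ∩ Metric.ball h δ := by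
    intro w hw
    rw [Metric.mem_ball, dist_zero_right] at hw
    constructor
    · rw [Metric.mem_ball, dist_eq_norm, sub_neg_eq_add]
      linarith [norm_add_le w h]
    · rw [Metric.mem_ball, dist_eq_norm]
      linarith [norm_sub_le w h]
  have hfin : volume (Metric.ball (-h) δ ∩ Metric.ball h δ) ≠ ∞ :=
    ((measure_mono inter_subset_left).trans_lt measure_ball_lt_top).ne
  refine le_trans (le_of_eq ?_) (measureReal_mono hsub hfin)
  have hball : ∀ r : ℝ, 0 ≤ r → volume.real (Metric.ball (0 : E3) r)
      = r ^ 3 * volume.real (Metric.ball (0 : E3) 1) := by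
    intro r hr
    rw [measureReal_def, Measure.addHaar_ball _ _ hr]
    simp [measureReal_def, ENNReal.toReal_mul, hr]
  rw [hball δ hδ.le, hball (δ - ‖h‖) (by linarith)]
  field_simp

/-- This is why the window has width $\sqrt\varepsilon$: the width tends to zero, while the shift
$\varepsilon|y|/2$ is negligible relative to it. -/
theorem tendsto_integral_overlap {e : ℕ → ℝ} (he : ∀ k, 0 < e k) (he0 : Tendsto e atTop (𝓝 0))
    (y : E3) : Tendsto (fun k => ∫ w, overlap (√(e k)) ((e k / 2) • y) w) atTop (𝓝 1) := by
  have hq : ∀ k, ‖(e k / 2) • y‖ / √(e k) = √(e k) * (‖y‖ / 2) := by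
    intro k
    have h1 : 0 < √(e k) := Real.sqrt_pos.2 (he k)
    rw [norm_smul, Real.norm_of_nonneg (by linarith [he k]), div_eq_iff h1.ne']
    have := Real.mul_self_sqrt (he k).le
    linear_combination (-(‖y‖ / 2)) * this
  have hs : Tendsto (fun k => √(e k) * (‖y‖ / 2)) atTop (𝓝 0) := by
    have := (Real.continuous_sqrt.tendsto 0).comp he0
    simpa using this.mul_const (‖y‖ / 2)
  have hl : Tendsto (fun k => (1 - √(e k) * (‖y‖ / 2)) ^ 3) atTop (𝓝 1) := by
    simpa using (hs.const_sub 1).pow 3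
  refine tendsto_of_tendsto_of_tendsto_of_le_of_le' hl tendsto_const_nhds ?_
    (Eventually.of_forall fun k => integral_overlap_le_one (Real.sqrt_pos.2 (he k)) _)
  filter_upwards [hs.eventually_le_const zero_lt_one] with k hk
  have h1 : 0 < √(e k) := Real.sqrt_pos.2 (he k)
  rw [← hq k] at hk ⊢
  refine le_integral_overlap h1 ?_
  rwa [div_le_one h1] at hk

/-! ### Weighted moduli of continuity -/

theorem decayWeight_sub_le {p : ℝ} (hp : 0 < p) (z : E3) {w : E3} (hw : ‖w‖ ≤ 1) :
    decayWeight p (z - w) ≤ 2 ^ (1 + p) * decayWeight p z := by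
  have h1 : 1 + ‖z‖ ≤ 2 * (1 + ‖z - w‖) := by
    have : ‖z‖ ≤ ‖z - w‖ + ‖w‖ := by simpa using norm_add_le (z - w) w
    linarith [norm_nonneg (z - w)]
  have h2 : (2 * (1 + ‖z - w‖)) ^ (-(1 + p)) ≤ (1 + ‖z‖) ^ (-(1 + p)) :=
    Real.rpow_le_rpow_of_nonpos (by positivity) h1 (by linarith)
  rw [Real.mul_rpow (by norm_num) (by positivity), Real.rpow_neg (by norm_num)] at h2
  unfold decayWeight
  have h3 : (0 : ℝ) < 2 ^ (1 + p) := by positivity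
  calc (1 + ‖z - w‖) ^ (-(1 + p))
      = 2 ^ (1 + p) * ((2 ^ (1 + p))⁻¹ * (1 + ‖z - w‖) ^ (-(1 + p))) := by field_simp
    _ ≤ _ := by gcongr

/-- Functions with enough decay are uniformly continuous in a weighted sense. -/
theorem exists_weighted_modulus {f : E3 → ℂ} (hf : Continuous f) {lam A : ℝ} (hlam : 0 < lam)
    (hA : ∀ x, ‖f x‖ ≤ A * decayWeight lam x) {η : ℝ} (hη : 0 < η) :
    ∃ δ, 0 < δ ∧ ∀ w : E3, ‖w‖ < δ → ∀ z,
      ‖f z - f (z - w)‖ ≤ η * decayWeight (lam / 2) z := by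
  have hA0 : 0 ≤ A := by
    have := (norm_nonneg _).trans (hA 0)
    exact nonneg_of_mul_nonneg_left this (decayWeight_pos _ _)
  set q : ℝ := 1 + lam / 2 with hq
  set r : E3 → ℝ := fun x => (1 + ‖x‖) ^ q with hr
  have hrc : Continuous r := Continuous.rpow_const (by fun_prop) fun x => Or.inl (by positivity)
  have hrpos : ∀ x, 0 < r x := fun x => by positivity
  have hrw : ∀ x, r x * decayWeight (lam / 2) x = 1 := fun x => by
    simp only [hr, decayWeight, hq]
    rw [← Real.rpow_add (by positivity)]; simp
  have hrw2 : ∀ x, r x * decayWeight lam x = (1 + ‖x‖) ^ (-(lam / 2)) := fun x => by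
    simp only [hr, decayWeight, hq]
    rw [← Real.rpow_add (by positivity)]; congr 1; ring
  -- Giving up half of the exponent $\lambda$ makes the weighted function vanish at infinity, hence
  -- uniformly continuous.
  set F : E3 → ℂ := fun x => (r x : ℂ) * f x with hF
  have hFn : ∀ x, ‖F x‖ ≤ A * (1 + ‖x‖) ^ (-(lam / 2)) := by
    intro x
    rw [hF, norm_mul, Complex.norm_real, Real.norm_of_nonneg (hrpos x).le, ← hrw2]
    calc _ ≤ r x * (A * decayWeight lam x) := mul_le_mul_of_nonneg_left (hA x) (hrpos x).le
      _ = _ := by ring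
  have hFb : ∀ x, ‖F x‖ ≤ A := fun x => (hFn x).trans (mul_le_of_le_one_right hA0
    (Real.rpow_le_one_of_one_le_of_nonpos (by linarith [norm_nonneg x]) (by linarith)))
  have hF0 : Tendsto F (cocompact E3) (𝓝 0) := by
    refine squeeze_zero_norm hFn ?_
    have h1 : Tendsto (fun t : ℝ => t ^ (-(lam / 2))) atTop (𝓝 0) :=
      tendsto_rpow_neg_atTop (by linarith)
    have h2 : Tendsto (fun x : E3 => 1 + ‖x‖) (cocompact E3) atTop :=
      tendsto_atTop_add_const_left _ _ tendsto_norm_cocompact_atTop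
    simpa using (h1.comp h2).const_mul A
  have hFc : Continuous F := (Complex.continuous_ofReal.comp hrc).mul hf
  have hFu : UniformContinuous F := Continuous.uniformContinuous_of_tendsto_cocompact hFc hF0
  obtain ⟨δ₁, hδ₁, h1⟩ := Metric.uniformContinuous_iff.1 hFu (η / 2) (by linarith)
  have hlim : Tendsto (fun t : ℝ => A * ((1 + t) ^ q - 1)) (𝓝 0) (𝓝 0) := by
    have : ContinuousAt (fun t : ℝ => A * ((1 + t) ^ q - 1)) 0 := by
      refine continuousAt_const.mul (ContinuousAt.sub ?_ continuousAt_const)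
      exact ContinuousAt.rpow_const (by fun_prop) (Or.inl (by norm_num))
    simpa [ContinuousAt] using this
  obtain ⟨δ₂, hδ₂, h2⟩ := Metric.tendsto_nhds_nhds.1 hlim (η / 2) (by linarith)
  refine ⟨min δ₁ δ₂, lt_min hδ₁ hδ₂, fun w hw z => ?_⟩
  have hw1 : ‖w‖ < δ₁ := hw.trans_le (min_le_left _ _)
  have hw2 : ‖w‖ < δ₂ := hw.trans_le (min_le_right _ _)
  set x := z - w with hx
  have e1 : ‖F z - F x‖ < η / 2 := by
    have := h1 (a := z) (b := x) (by simpa [hx, dist_eq_norm] using hw1)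
    rwa [dist_eq_norm] at this
  have e2 : A * ((1 + ‖w‖) ^ q - 1) < η / 2 := by
    have := h2 (x := ‖w‖) (by simpa using hw2)
    rw [Real.dist_eq, sub_zero] at this
    exact (le_abs_self _).trans_lt this
  have hq0 : 0 ≤ q := by rw [hq]; linarith
  have hone : (1 : ℝ) ≤ (1 + ‖w‖) ^ q := Real.one_le_rpow (by linarith [norm_nonneg w]) hq0
  have hzx : ∀ a b : E3, ‖a - b‖ = ‖w‖ → r a ≤ (1 + ‖w‖) ^ q * r b := by
    intro a b hab
    rw [hr, ← Real.mul_rpow (by positivity) (by positivity)]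
    refine Real.rpow_le_rpow (by positivity) ?_ hq0
    have : ‖a‖ ≤ ‖a - b‖ + ‖b‖ := by simpa using norm_add_le (a - b) b
    nlinarith [norm_nonneg w, norm_nonneg b]
  have g1 := hzx z x (by simp [hx])
  have g2 := hzx x z (by simp [hx])
  -- Replacing the weight at $z$ by that at $x$ costs little: by $1+|a|\le(1+|a-b|)(1+|b|)$ their
  -- ratio lies between $s^{-1}$ and $s$ with $s=(1+|w|)^q$, and $1-s^{-1}\le s-1$.
  have e3 : |1 - r z / r x| ≤ (1 + ‖w‖) ^ q - 1 := by
    set s := (1 + ‖w‖) ^ q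
    have k1 : r z / r x ≤ s := by rw [div_le_iff₀ (hrpos x)]; exact g1
    have k2 : 1 ≤ s * (r z / r x) := by
      rw [← mul_div_assoc, one_le_div (hrpos x)]; exact g2
    have k3 : 0 < r z / r x := div_pos (hrpos z) (hrpos x)
    rw [abs_le]
    constructor
    · linarith
    · nlinarith
  have e4 : r z * ‖f z - f x‖ ≤ η := by
    have h3 : (r z : ℂ) * (f z - f x) = (F z - F x) + ((1 - r z / r x : ℝ) : ℂ) * F x := by
      have : (r x : ℂ) ≠ 0 := by exact_mod_cast (hrpos x).ne'
      simp only [hF]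
      push_cast
      field_simp
      ring
    calc r z * ‖f z - f x‖ = ‖(r z : ℂ) * (f z - f x)‖ := by
          rw [norm_mul, Complex.norm_real, Real.norm_of_nonneg (hrpos z).le]
      _ ≤ ‖F z - F x‖ + |1 - r z / r x| * ‖F x‖ := by
          rw [h3]
          refine (norm_add_le _ _).trans ?_
          rw [norm_mul, Complex.norm_real, Real.norm_eq_abs]
      _ ≤ η / 2 + ((1 + ‖w‖) ^ q - 1) * A := by
          exact add_le_add e1.le (mul_le_mul e3 (hFb x) (norm_nonneg _) (by linarith))
      _ ≤ η := by linarith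
  calc ‖f z - f x‖ = (r z * ‖f z - f x‖) * decayWeight (lam / 2) z := by
        rw [mul_right_comm, hrw, one_mul]
    _ ≤ _ := by gcongr; exact (decayWeight_pos _ _).le

/-! ### The Husimi measure -/

/-- The Fourier transform of `u`, localised near `x`. -/
noncomputable def coherent (δ : ℝ) (u : E3 → ℂ) (x ζ : E3) : ℂ :=
  𝓕 (fun t => u t * (window δ (t - x) : ℂ)) ζ

/-- The Husimi measure: a positive approximation of the Wigner transform. -/
noncomputable def husimi (δ ε : ℝ) (u : E3 → ℂ) : Measure (E3 × E3) :=
  ((volume.prod volume).withDensity fun p => ‖coherent δ u p.1 p.2‖ₑ ^ 2).map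
    fun p => (p.1, (2 * Real.pi * ε) • p.2)

theorem integrable_mul_window {u : E3 → ℂ} (hu : MemLp u 2 volume) (δ : ℝ) (x : E3) :
    Integrable (fun t => u t * (window δ (t - x) : ℂ)) ∧
      MemLp (fun t => u t * (window δ (t - x) : ℂ)) 2 volume := by
  have hm : MemLp (fun t => (window δ (t - x) : ℂ)) 2 volume := (memLp_window δ x).ofReal
  refine ⟨hu.integrable_mul hm, ?_⟩
  refine hu.of_le_mul (c := (√(volume.real (Metric.ball (0 : E3) δ)))⁻¹) (hu.1.mul hm.1)
    (Eventually.of_forall fun t => ?_)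
  rw [norm_mul, mul_comm, Complex.norm_real, Real.norm_of_nonneg (window_nonneg _ _)]
  gcongr
  exact window_le _ _

theorem aestronglyMeasurable_coherent {u : E3 → ℂ} (hu : AEStronglyMeasurable u volume) (δ : ℝ) :
    AEStronglyMeasurable (fun p : E3 × E3 => coherent δ u p.1 p.2) (volume.prod volume) := by
  have h1 : AEStronglyMeasurable (fun q : (E3 × E3) × E3 => u q.2)
      ((volume.prod volume).prod volume) :=
    hu.comp_quasiMeasurePreserving Measure.quasiMeasurePreserving_snd
  have h2 : Measurable fun q : (E3 × E3) × E3 => (window δ (q.2 - q.1.1) : ℂ) :=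
    Complex.measurable_ofReal.comp (by fun_prop)
  have h3 : Continuous fun q : (E3 × E3) × E3 => (Real.fourierChar (-(inner ℝ q.2 q.1.2)) : ℂ) := by
    have := Real.continuous_fourierChar
    fun_prop
  have h4 := (h3.aestronglyMeasurable.mul (h1.mul h2.aestronglyMeasurable)).integral_prod_right'
  refine h4.congr (Eventually.of_forall fun p => ?_)
  simp only [coherent, Real.fourier_eq, Circle.smul_def, smul_eq_mul]
  rfl

theorem lintegral_enorm_sq_coherent {u : E3 → ℂ} (hu : MemLp u 2 volume) (δ : ℝ) (x : E3) :
    ∫⁻ ζ, ‖coherent δ u x ζ‖ₑ ^ 2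
      = ∫⁻ s, ‖u (x + s)‖ₑ ^ 2 * ENNReal.ofReal (window δ s) ^ 2 := by
  obtain ⟨h1, h2⟩ := integrable_mul_window hu δ x
  unfold coherent
  rw [lintegral_enorm_sq_fourier_eq h1 h2,
    ← lintegral_add_left_eq_self (fun t => ‖u t * (window δ (t - x) : ℂ)‖ₑ ^ 2) x]
  refine lintegral_congr fun s => ?_
  rw [enorm_mul, mul_pow, add_sub_cancel_left]
  congr 2
  rw [← ofReal_norm, Complex.norm_real, Real.norm_of_nonneg (window_nonneg _ _)]

theorem aemeasurable_density_husimi {u : E3 → ℂ} (hu : AEStronglyMeasurable u volume) (δ : ℝ) :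
    AEMeasurable (fun p : E3 × E3 => ‖coherent δ u p.1 p.2‖ₑ ^ 2) (volume.prod volume) :=
  (aestronglyMeasurable_coherent hu δ).enorm.pow_const 2

/-- Plancherel in frequency and Fubini turn the mass of the cylinder into an average, over $s$ with
density `window δ s ^ 2`, of the mass of $|u|^2$ on `Metric.ball (z + s) R`. That density has
integral one, so neither the constant nor the radius grows. -/
theorem husimi_ball_prod_univ_le {u : E3 → ℂ} (hu : MemLp u 2 volume) {δ : ℝ} (hδ : 0 < δ) (ε : ℝ)
    {z : E3} {R : ℝ} {B : ℝ≥0∞} (hB : ∀ s, ∫⁻ x in Metric.ball (z + s) R, ‖u x‖ₑ ^ 2 ≤ B) :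
    husimi δ ε u (Metric.ball z R ×ˢ univ) ≤ B := by
  have hms : MeasurableSet (Metric.ball z R ×ˢ (univ : Set E3)) :=
    Metric.isOpen_ball.measurableSet.prod MeasurableSet.univ
  have hpre : (fun p : E3 × E3 => (p.1, (2 * Real.pi * ε) • p.2)) ⁻¹' (Metric.ball z R ×ˢ univ)
      = Metric.ball z R ×ˢ univ := by ext; simp
  have hadd : Measure.QuasiMeasurePreserving (fun p : E3 × E3 => p.1 + p.2)
      (volume.prod volume) volume :=
    Measure.quasiMeasurePreserving_snd.comp
      (measurePreserving_prod_add (volume : Measure E3) (volume : Measure E3)).quasiMeasurePreserving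
  have hm : AEMeasurable (fun p : E3 × E3 => ‖u (p.1 + p.2)‖ₑ ^ 2
      * ENNReal.ofReal (window δ p.2) ^ 2) (volume.prod volume) :=
    ((hu.1.comp_quasiMeasurePreserving hadd).enorm.pow_const 2).mul (by fun_prop)
  have hle : ((volume : Measure E3).restrict (Metric.ball z R)).prod (volume : Measure E3)
      ≤ volume.prod volume := Measure.prod_mono Measure.restrict_le_self le_rfl
  rw [husimi, Measure.map_apply (by fun_prop) hms, hpre, withDensity_apply _ hms,
    ← Measure.prod_restrict, Measure.restrict_univ,
    lintegral_prod _ ((aemeasurable_density_husimi hu.1 δ).mono_measure hle)]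
  simp only [lintegral_enorm_sq_coherent hu]
  rw [lintegral_lintegral_swap (hm.mono_measure hle)]
  calc ∫⁻ s, ∫⁻ x in Metric.ball z R, ‖u (x + s)‖ₑ ^ 2 * ENNReal.ofReal (window δ s) ^ 2
      = ∫⁻ s, (∫⁻ x in Metric.ball z R, ‖u (x + s)‖ₑ ^ 2) * ENNReal.ofReal (window δ s) ^ 2 :=
        lintegral_congr fun s => lintegral_mul_const' _ _ (by finiteness)
    _ ≤ ∫⁻ s, B * ENNReal.ofReal (window δ s) ^ 2 := by
        refine lintegral_mono fun s => ?_
        gcongr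
        rw [setLIntegral_ball_add fun x => ‖u x‖ₑ ^ 2]
        exact hB s
    _ = B := by rw [lintegral_const_mul _ (by fun_prop), lintegral_sq_window hδ, mul_one]

theorem lintegral_husimi {u : E3 → ℂ} (hu : AEStronglyMeasurable u volume) (δ ε : ℝ)
    {g : E3 × E3 → ℝ≥0∞} (hg : Measurable g) : ∫⁻ p, g p ∂husimi δ ε u
      = ∫⁻ p : E3 × E3, ‖coherent δ u p.1 p.2‖ₑ ^ 2 * g (p.1, (2 * Real.pi * ε) • p.2)
        ∂(volume.prod volume) := by
  rw [husimi, lintegral_map hg (by fun_prop), lintegral_withDensity_eq_lintegral_mul₀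
    (aemeasurable_density_husimi hu δ) (by fun_prop)]
  rfl

theorem integral_husimi {u : E3 → ℂ} (hu : AEStronglyMeasurable u volume) (δ ε : ℝ)
    {g : E3 × E3 → ℂ} (hg : Measurable g) : ∫ p, g p ∂husimi δ ε u
      = ∫ p : E3 × E3, ((‖coherent δ u p.1 p.2‖ ^ 2 : ℝ) : ℂ) * g (p.1, (2 * Real.pi * ε) • p.2)
        ∂(volume.prod volume) := by
  rw [husimi, integral_map (by fun_prop) hg.aestronglyMeasurable,
    integral_withDensity_eq_integral_toReal_smul₀ (aemeasurable_density_husimi hu δ)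
      (Eventually.of_forall fun p => by finiteness)]
  refine integral_congr_ae (Eventually.of_forall fun p => ?_)
  simp

/-- Averaging of `φ` with the overlap of two windows. -/
noncomputable def smoothed (δ ε : ℝ) (φ : E3 → E3 → ℂ) (z y : E3) : ℂ :=
  ∫ x, φ x y * (overlap δ ((ε / 2) • y) (z - x) : ℂ)

/-- The autocorrelation formula with shift $\varepsilon y$. The dilation by $2\pi\varepsilon$
converts the character $e^{2\pi i\,\cdot}$ into the semiclassical phase, so that the two-point
function appears at exactly $z\pm\varepsilon y/2$. -/
theorem integral_fourierChar_mul_norm_sq_coherent {u : E3 → ℂ} (hu : MemLp u 2 volume) (δ ε : ℝ)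
    (x y : E3) :
    ∫ ζ, Complex.exp (Complex.I * (inner ℝ y ((2 * Real.pi * ε) • ζ) : ℝ))
        * ((‖coherent δ u x ζ‖ ^ 2 : ℝ) : ℂ)
      = ∫ z, twoPoint ε u z y * (overlap δ ((ε / 2) • y) (z - x) : ℂ) := by
  obtain ⟨h1, h2⟩ := integrable_mul_window hu δ x
  have h := integral_char_mul_norm_sq_fourier h1 h2 (ε • y)
  have hs : (1 / 2 : ℝ) • ε • y = (ε / 2) • y := by rw [smul_smul]; congr 1; ring
  rw [hs] at h
  calc _ = _ := by
        refine integral_congr_ae (Eventually.of_forall fun ζ => ?_)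
        simp only [coherent, Real.fourierChar_apply, inner_smul_right, inner_smul_left]
        congr 2
        push_cast
        simp
        ring
    _ = _ := h
    _ = _ := by
        refine integral_congr_ae (Eventually.of_forall fun z => ?_)
        simp only [twoPoint, overlap, map_mul, Complex.conj_ofReal]
        rw [show z + (ε / 2) • y - x = z - x + (ε / 2) • y by abel,
          show z - (ε / 2) • y - x = z - x - (ε / 2) • y by abel]
        push_cast
        ring

namespace MemX

variable {lam : ℝ} {φ : E3 → E3 → ℂ}

theorem continuous_fourierInv3 (hφ : MemX lam φ) (hlam : 0 < lam) :
    Continuous fun p : E3 × E3 => fourierInv3 (φ p.1) p.2 := by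
  refine continuous_of_dominated (bound := fun y => (xSup lam φ y).toReal) (fun p => ?_)
    (fun p => ?_) hφ.integrable_xSup ?_
  · have : Continuous fun y : E3 => Complex.exp (Complex.I * (inner ℝ y p.2 : ℝ)) := by fun_prop
    exact this.aestronglyMeasurable.mul (hφ.integrable hlam p.1).1
  · filter_upwards [hφ.ae_norm_le hlam] with y hy
    rw [norm_mul, mul_comm Complex.I, Complex.norm_exp_ofReal_mul_I, one_mul]
    exact (hy p.1).trans (mul_le_of_le_one_right ENNReal.toReal_nonneg (decayWeight_le_one hlam _))
  · refine Eventually.of_forall fun y => ?_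
    have := hφ.continuous y
    fun_prop

theorem norm_fourierInv3_le (hφ : MemX lam φ) (hlam : 0 < lam) (x ξ : E3) :
    ‖fourierInv3 (φ x) ξ‖ ≤ (xNorm lam φ).toReal * decayWeight lam x := by
  have h := norm_integral_le_of_norm_le (hφ.integrable_xSup.mul_const (decayWeight lam x))
    (f := fun y => Complex.exp (Complex.I * (inner ℝ y ξ : ℝ)) * φ x y) (by
      filter_upwards [hφ.ae_norm_le hlam] with y hy
      rw [norm_mul, mul_comm Complex.I, Complex.norm_exp_ofReal_mul_I, one_mul]
      exact hy x)
  rwa [integral_mul_const, integral_toReal hφ.measurable_xSup.aemeasurable hφ.ae_xSup_lt_top] at h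

/-- The overlap has mass at most one and lives where $|z-x|<\delta\le1$, a region in which the
weights at $x$ and $z$ are comparable. -/
theorem lintegral_mul_overlap_le (hlam : 0 < lam) {δ : ℝ} (hδ : 0 < δ) (hδ1 : δ ≤ 1)
    (h z y : E3) :
    ∫⁻ x, ‖φ x y * (overlap δ h (z - x) : ℂ)‖ₑ
      ≤ ENNReal.ofReal (2 ^ (1 + lam)) * (xSup lam φ y * ENNReal.ofReal (decayWeight lam z)) := by
  set A := ENNReal.ofReal (2 ^ (1 + lam)) * (xSup lam φ y * ENNReal.ofReal (decayWeight lam z))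
  have hov : ∫⁻ w, ENNReal.ofReal (overlap δ h w) ≤ 1 := by
    rw [← ofReal_integral_eq_lintegral_ofReal (integrable_overlap δ h)
      (Eventually.of_forall fun w => overlap_nonneg δ h w)]
    exact ENNReal.ofReal_le_one.2 (integral_overlap_le_one hδ h)
  have hm : Measurable fun w => ENNReal.ofReal (overlap δ h w) := by
    have := (measurable_overlap δ).comp (measurable_const.prodMk measurable_id :
      Measurable fun w : E3 => (h, w))
    exact this.ennreal_ofReal
  calc _ ≤ ∫⁻ x, A * ENNReal.ofReal (overlap δ h (z - x)) := by
        refine lintegral_mono fun x => ?_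
        rw [enorm_mul, show ‖(overlap δ h (z - x) : ℂ)‖ₑ = ENNReal.ofReal (overlap δ h (z - x)) by
          rw [← ofReal_norm, Complex.norm_real, Real.norm_of_nonneg (overlap_nonneg _ _ _)]]
        rcases lt_or_ge ‖z - x‖ δ with hw | hw
        · gcongr
          have h1 := decayWeight_sub_le hlam z (hw.le.trans hδ1)
          rw [sub_sub_cancel] at h1
          calc ‖φ x y‖ₑ ≤ xSup lam φ y * ENNReal.ofReal (decayWeight lam x) :=
                enorm_le_xSup hlam φ x y
            _ ≤ xSup lam φ y * (ENNReal.ofReal (2 ^ (1 + lam))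
                * ENNReal.ofReal (decayWeight lam z)) := by
                gcongr
                rw [← ENNReal.ofReal_mul (by positivity)]
                exact ENNReal.ofReal_le_ofReal h1
            _ = A := by simp only [A]; ring
        · rw [overlap_eq_zero h hw]; simp
    _ = A * ∫⁻ w, ENNReal.ofReal (overlap δ h w) := by
        rw [lintegral_const_mul _ (by exact hm.comp (measurable_const.sub measurable_id)),
          lintegral_sub_left_eq_self (fun w => ENNReal.ofReal (overlap δ h w)) z]
    _ ≤ A := mul_le_of_le_one_right' hov

theorem enorm_smoothed_le (hlam : 0 < lam) {δ : ℝ} (hδ : 0 < δ) (hδ1 : δ ≤ 1) (ε : ℝ) (z y : E3) :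
    ‖smoothed δ ε φ z y‖ₑ
      ≤ ENNReal.ofReal (2 ^ (1 + lam)) * (xSup lam φ y * ENNReal.ofReal (decayWeight lam z)) :=
  (enorm_integral_le_lintegral_enorm _).trans (lintegral_mul_overlap_le hlam hδ hδ1 _ _ _)

theorem measurable_smoothed (hφ : MemX lam φ) (δ ε : ℝ) :
    StronglyMeasurable fun p : E3 × E3 => smoothed δ ε φ p.1 p.2 := by
  have h1 : Measurable fun q : (E3 × E3) × E3 => φ q.2 q.1.2 :=
    hφ.measurable.comp (measurable_snd.prodMk (measurable_snd.comp measurable_fst))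
  have h2 : Measurable fun q : (E3 × E3) × E3 =>
      (overlap δ ((ε / 2) • q.1.2) (q.1.1 - q.2) : ℂ) := by
    unfold overlap
    fun_prop
  have h3 : StronglyMeasurable fun q : (E3 × E3) × E3 =>
      φ q.2 q.1.2 * (overlap δ ((ε / 2) • q.1.2) (q.1.1 - q.2) : ℂ) := (h1.mul h2).stronglyMeasurable
  exact h3.integral_prod_right'

end MemX

theorem MorreyBound.lintegral_twoPoint_mul_mul_le {u : E3 → ℂ} {K : ℝ≥0∞} (h : MorreyBound u K)
    (hK : K < ∞) (hu : AEStronglyMeasurable u volume) {lam : ℝ} (hlam : 0 < lam) (ε : ℝ)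
    {g : E3 → ℝ≥0∞} (hg : Measurable g) (hgf : ∀ᵐ y, g y < ∞) :
    ∫⁻ p : E3 × E3, ‖twoPoint ε u p.1 p.2‖ₑ * (g p.2 * ENNReal.ofReal (decayWeight lam p.1))
        ∂(volume.prod volume)
      ≤ 2 * K * weightedMass lam * ∫⁻ y, g y := by
  have hfin : 2 * K * weightedMass lam ≠ ∞ :=
    ENNReal.mul_ne_top (ENNReal.mul_ne_top (by simp) hK.ne) (weightedMass_lt_top hlam).ne
  have hm : AEMeasurable (fun p : E3 × E3 => ‖twoPoint ε u p.1 p.2‖ₑ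
      * (g p.2 * ENNReal.ofReal (decayWeight lam p.1))) (volume.prod volume) :=
    (measurable_twoPoint hu).enorm.mul (by fun_prop)
  rw [lintegral_prod_symm _ hm, ← lintegral_const_mul' _ _ hfin]
  refine lintegral_mono_ae ?_
  filter_upwards [hgf] with y hy
  calc _ = (∫⁻ x, ‖twoPoint ε u x y‖ₑ * ENNReal.ofReal (decayWeight lam x)) * g y := by
        rw [← lintegral_mul_const' _ _ hy.ne]
        exact lintegral_congr fun x => by ring
    _ ≤ _ := by gcongr; exact h.lintegral_twoPoint_le hu hlam ε y

theorem MorreyBound.husimi_ball_prod_univ_le {u : E3 → ℂ} {K : ℝ≥0∞} (h : MorreyBound u K)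
    (hu : MemLp u 2 volume) {δ : ℝ} (hδ : 0 < δ) (ε : ℝ) (z : E3) {R : ℝ} (hR : 1 ≤ R) :
    husimi δ ε u (Metric.ball z R ×ˢ univ) ≤ K * ENNReal.ofReal R :=
  _root_.husimi_ball_prod_univ_le hu hδ ε fun _ => h _ _ hR

theorem MorreyBound.lintegral_decayWeight_husimi_le {u : E3 → ℂ} {K : ℝ≥0∞} (h : MorreyBound u K)
    (hu : MemLp u 2 volume) {δ : ℝ} (hδ : 0 < δ) (ε : ℝ) {p : ℝ} (hp : 0 < p) :
    ∫⁻ x, ENNReal.ofReal (decayWeight p x.1) ∂husimi δ ε u ≤ K * weightedMass p := by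
  have := _root_.lintegral_decayWeight_le (ν := (husimi δ ε u).map Prod.fst) (K := K)
    (fun R hR => ?_) hp
  · rwa [lintegral_map (by fun_prop) measurable_fst] at this
  · rw [Measure.map_apply measurable_fst Metric.isOpen_ball.measurableSet, ← prod_univ]
    exact h.husimi_ball_prod_univ_le hu hδ ε 0 hR

/-- The Husimi measure acts on symbols as the Wigner transform acts on averaged symbols. -/
theorem MorreyBound.integral_husimi_fourierInv3 {u : E3 → ℂ} {K : ℝ≥0∞} (h : MorreyBound u K)
    (hK : K < ∞) (hu : MemLp u 2 volume) {δ : ℝ} (hδ : 0 < δ) (hδ1 : δ ≤ 1) (ε : ℝ) {lam : ℝ}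
    (hlam : 0 < lam) {φ : E3 → E3 → ℂ} (hφ : MemX lam φ) :
    Integrable (fun p : E3 × E3 => fourierInv3 (φ p.1) p.2) (husimi δ ε u) ∧
    ∫ p, fourierInv3 (φ p.1) p.2 ∂husimi δ ε u = wignerBracket ε u (smoothed δ ε φ) := by
  have hcont := hφ.continuous_fourierInv3 hlam
  set N := (xNorm lam φ).toReal with hN
  have hint : Integrable (fun p : E3 × E3 => fourierInv3 (φ p.1) p.2) (husimi δ ε u) := by
    refine ⟨hcont.aestronglyMeasurable, ?_⟩
    rw [hasFiniteIntegral_iff_enorm]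
    calc _ ≤ ∫⁻ p, ENNReal.ofReal N * ENNReal.ofReal (decayWeight lam p.1) ∂husimi δ ε u := by
          refine lintegral_mono fun p => ?_
          rw [← ENNReal.ofReal_mul ENNReal.toReal_nonneg, ← ofReal_norm]
          exact ENNReal.ofReal_le_ofReal (hφ.norm_fourierInv3_le hlam _ _)
      _ ≤ ENNReal.ofReal N * (K * weightedMass lam) := by
          rw [lintegral_const_mul _ (by fun_prop)]
          gcongr
          exact h.lintegral_decayWeight_husimi_le hu hδ ε hlam
      _ < ∞ := ENNReal.mul_lt_top (by simp) (ENNReal.mul_lt_top hK (weightedMass_lt_top hlam))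
  refine ⟨hint, ?_⟩
  rw [integral_husimi hu.1 δ ε hcont.measurable]
  set G : E3 × E3 → ℂ := fun p => ((‖coherent δ u p.1 p.2‖ ^ 2 : ℝ) : ℂ)
    * fourierInv3 (φ p.1) ((2 * Real.pi * ε) • p.2) with hG
  have hcoh := aestronglyMeasurable_coherent hu.1 δ
  have hGint : Integrable G (volume.prod volume) := by
    have g1 : AEStronglyMeasurable (fun p : E3 × E3 => ((‖coherent δ u p.1 p.2‖ ^ 2 : ℝ) : ℂ))
        (volume.prod volume) := Complex.continuous_ofReal.comp_aestronglyMeasurable (hcoh.norm.pow 2)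
    have g2 : Continuous fun p : E3 × E3 => (p.1, (2 * Real.pi * ε) • p.2) := by fun_prop
    have g3 : Continuous fun p : E3 × E3 => fourierInv3 (φ p.1) ((2 * Real.pi * ε) • p.2) := by
      have := hcont.comp g2
      simpa only [Function.comp_def] using this
    refine ⟨g1.mul g3.aestronglyMeasurable, ?_⟩
    have := hint.2
    rw [hasFiniteIntegral_iff_enorm, lintegral_husimi hu.1 δ ε hcont.measurable.enorm] at this
    rw [hasFiniteIntegral_iff_enorm]
    refine (lintegral_congr fun p => ?_).trans_lt this
    rw [hG, enorm_mul]
    congr 1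
    simp [← ofReal_norm, ENNReal.ofReal_pow]
  set T : E3 × (E3 × E3) → ℂ := fun t => twoPoint ε u t.2.1 t.2.2
    * (φ t.1 t.2.2 * (overlap δ ((ε / 2) • t.2.2) (t.2.1 - t.1) : ℂ)) with hT
  have hTm : AEStronglyMeasurable T (volume.prod (volume.prod volume)) := by
    have h1 : Measurable fun t : E3 × (E3 × E3) => φ t.1 t.2.2 :=
      hφ.measurable.comp (measurable_fst.prodMk (measurable_snd.comp measurable_snd))
    have h2 : Measurable fun t : E3 × (E3 × E3) =>
        (overlap δ ((ε / 2) • t.2.2) (t.2.1 - t.1) : ℂ) := by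
      unfold overlap
      fun_prop
    have h3 : AEStronglyMeasurable (fun t : E3 × (E3 × E3) => twoPoint ε u t.2.1 t.2.2)
        (volume.prod (volume.prod volume)) :=
      (measurable_twoPoint hu.1).comp_quasiMeasurePreserving Measure.quasiMeasurePreserving_snd
    exact h3.mul (h1.mul h2).aestronglyMeasurable
  have hTint : Integrable T (volume.prod (volume.prod volume)) := by
    refine ⟨hTm, ?_⟩
    rw [hasFiniteIntegral_iff_enorm, lintegral_prod_symm _ hTm.enorm]
    calc _ ≤ ∫⁻ q : E3 × E3, ENNReal.ofReal (2 ^ (1 + lam)) * (‖twoPoint ε u q.1 q.2‖ₑ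
            * (xSup lam φ q.2 * ENNReal.ofReal (decayWeight lam q.1))) ∂(volume.prod volume) := by
          refine lintegral_mono fun q => ?_
          simp only [hT, enorm_mul (twoPoint _ _ _ _)]
          rw [lintegral_const_mul' _ _ (by finiteness), mul_left_comm]
          gcongr
          exact MemX.lintegral_mul_overlap_le hlam hδ hδ1 _ _ _
      _ ≤ ENNReal.ofReal (2 ^ (1 + lam)) * (2 * K * weightedMass lam * xNorm lam φ) := by
          rw [lintegral_const_mul' _ _ (by finiteness)]
          gcongr
          exact h.lintegral_twoPoint_mul_mul_le hK hu.1 hlam ε hφ.measurable_xSup hφ.ae_xSup_lt_top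
      _ < ∞ := ENNReal.mul_lt_top (by finiteness) (ENNReal.mul_lt_top (ENNReal.mul_lt_top
          (ENNReal.mul_lt_top (by simp) hK) (weightedMass_lt_top hlam)) hφ.norm_lt_top)
  -- The frequency integral is evaluated at fixed $x$, where $|\text{coherent}|^2$ is integrable in
  -- $\zeta$ and $\varphi(x,\cdot)$ in $y$. What remains is the function `T`, absolutely integrable
  -- in $(x,z,y)$, and the order of integration is then free.
  have hslice : ∀ x, ∫ ζ, G (x, ζ) = ∫ y, ∫ z, T (x, (z, y)) := by
    intro x
    obtain ⟨h1, h2⟩ := integrable_mul_window hu δ x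
    have hsq : Integrable fun ζ => ((‖coherent δ u x ζ‖ ^ 2 : ℝ) : ℂ) := by
      have := memLp_fourier h1 h2
      exact ((memLp_two_iff_integrable_sq_norm this.1).1 this).ofReal
    have hprod : Integrable (fun q : E3 × E3 =>
        Complex.exp (Complex.I * (inner ℝ q.2 ((2 * Real.pi * ε) • q.1) : ℝ))
          * (((‖coherent δ u x q.1‖ ^ 2 : ℝ) : ℂ) * φ x q.2)) (volume.prod volume) := by
      refine (hsq.mul_prod (hφ.integrable hlam x)).bdd_mul (c := 1)
        (Continuous.aestronglyMeasurable (by fun_prop)) (Eventually.of_forall fun q => ?_)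
      rw [mul_comm Complex.I, Complex.norm_exp_ofReal_mul_I]
    calc ∫ ζ, G (x, ζ) = ∫ ζ, ∫ y, Complex.exp (Complex.I
          * (inner ℝ y ((2 * Real.pi * ε) • ζ) : ℝ))
          * (((‖coherent δ u x ζ‖ ^ 2 : ℝ) : ℂ) * φ x y) := by
          refine integral_congr_ae (Eventually.of_forall fun ζ => ?_)
          simp only [hG, fourierInv3]
          rw [← integral_const_mul]
          exact integral_congr_ae (Eventually.of_forall fun y => by ring)
      _ = _ := integral_integral_swap hprod
      _ = ∫ y, ∫ z, T (x, (z, y)) := by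
          refine integral_congr_ae (Eventually.of_forall fun y => ?_)
          simp only [hT, ← mul_assoc]
          rw [integral_mul_const, integral_fourierChar_mul_norm_sq_coherent hu, ← integral_mul_const]
          exact integral_congr_ae (Eventually.of_forall fun z => by ring)
  calc ∫ p, G p ∂(volume.prod volume) = ∫ x, ∫ ζ, G (x, ζ) := integral_prod _ hGint
    _ = ∫ x, ∫ q, T (x, q) ∂(volume.prod volume) := by
        refine integral_congr_ae ?_
        filter_upwards [hTint.prod_right_ae] with x hx
        rw [hslice x, integral_prod_symm _ hx]
    _ = ∫ q : E3 × E3, (∫ x, T (x, q)) ∂(volume.prod volume) := integral_integral_swap hTint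
    _ = wignerBracket ε u (smoothed δ ε φ) := by
        refine integral_congr_ae (Eventually.of_forall fun q => ?_)
        simp only [hT, smoothed]
        rw [integral_const_mul]

/-! ### Convergence of smoothed symbols -/

theorem decayWeight_anti {p q : ℝ} (hpq : p ≤ q) (x : E3) : decayWeight q x ≤ decayWeight p x :=
  Real.rpow_le_rpow_of_exponent_le (by linarith [norm_nonneg x]) (by linarith)

/-- Two separate errors: the mass missing from the overlap, multiplied by the size of $f$, and the
oscillation of $f$ at scale $\delta$. -/
theorem norm_sub_integral_mul_overlap_le {f : E3 → ℂ} (hf : Continuous f) {lam A η r δ : ℝ}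
    (hlam : 0 < lam) (hA : ∀ x, ‖f x‖ ≤ A * decayWeight lam x)
    (hr : ∀ w : E3, ‖w‖ < r → ∀ z, ‖f z - f (z - w)‖ ≤ η * decayWeight (lam / 2) z)
    (hδ : 0 < δ) (hδr : δ ≤ r) (hη : 0 ≤ η) (h z : E3) :
    ‖f z - ∫ x, f x * (overlap δ h (z - x) : ℂ)‖
      ≤ (A * (1 - ∫ w, overlap δ h w) + η) * decayWeight (lam / 2) z := by
  have hA0 : 0 ≤ A :=
    nonneg_of_mul_nonneg_left ((norm_nonneg _).trans (hA 0)) (decayWeight_pos _ _)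
  have hI1 := integral_overlap_le_one hδ h
  set I := ∫ w, overlap δ h w with hI
  have hov := integrable_overlap δ h
  have hdw := decayWeight_pos (lam / 2) z
  have hsub : ∫ x, f x * (overlap δ h (z - x) : ℂ) = ∫ w, f (z - w) * (overlap δ h w : ℂ) := by
    rw [← integral_sub_left_eq_self (fun x => f x * (overlap δ h (z - x) : ℂ)) volume z]
    simp
  have hi : Integrable fun w => f (z - w) * (overlap δ h w : ℂ) := by
    refine hov.ofReal.bdd_mul (c := A) (Continuous.aestronglyMeasurable (by fun_prop))
      (Eventually.of_forall fun w => (hA _).trans ?_)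
    exact mul_le_of_le_one_right hA0 (decayWeight_le_one hlam _)
  have hc : Integrable fun w => f z * (overlap δ h w : ℂ) := hov.ofReal.const_mul _
  have hcI : ∫ w, f z * (overlap δ h w : ℂ) = f z * I := by
    rw [integral_const_mul, integral_complex_ofReal]
  have hdec : f z - ∫ w, f (z - w) * (overlap δ h w : ℂ)
      = f z * ((1 - I : ℝ) : ℂ) + ∫ w, (f z - f (z - w)) * (overlap δ h w : ℂ) := by
    simp only [sub_mul]
    rw [integral_sub hc hi, hcI]
    push_cast
    ring
  have hrest : ‖∫ w, (f z - f (z - w)) * (overlap δ h w : ℂ)‖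
      ≤ ∫ w, η * decayWeight (lam / 2) z * overlap δ h w := by
    refine norm_integral_le_of_norm_le (hov.const_mul _) (Eventually.of_forall fun w => ?_)
    rw [norm_mul, Complex.norm_real, Real.norm_of_nonneg (overlap_nonneg _ _ _)]
    rcases lt_or_ge ‖w‖ δ with hw | hw
    · exact mul_le_mul_of_nonneg_right (hr w (hw.trans_le hδr) z) (overlap_nonneg _ _ _)
    · rw [overlap_eq_zero h hw]; simp
  rw [integral_const_mul] at hrest
  rw [hsub, hdec]
  refine (norm_add_le _ _).trans ?_
  rw [norm_mul, Complex.norm_real, Real.norm_of_nonneg (by linarith), add_mul]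
  refine add_le_add ?_ (hrest.trans (mul_le_of_le_one_right (by positivity) hI1))
  calc ‖f z‖ * (1 - I) ≤ (A * decayWeight (lam / 2) z) * (1 - I) := by
        refine mul_le_mul_of_nonneg_right ((hA z).trans ?_) (by linarith)
        exact mul_le_mul_of_nonneg_left (decayWeight_anti (by linarith) z) hA0
    _ = _ := by ring

theorem MorreyBound.integrable_twoPoint_mul_smoothed {u : E3 → ℂ} {K : ℝ≥0∞} (h : MorreyBound u K)
    (hK : K < ∞) (hu : AEStronglyMeasurable u volume) {δ : ℝ} (hδ : 0 < δ) (hδ1 : δ ≤ 1) (ε : ℝ)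
    {lam : ℝ} (hlam : 0 < lam) {φ : E3 → E3 → ℂ} (hφ : MemX lam φ) :
    Integrable (fun p : E3 × E3 => twoPoint ε u p.1 p.2 * smoothed δ ε φ p.1 p.2)
      (volume.prod volume) := by
  refine ⟨(measurable_twoPoint hu).mul (hφ.measurable_smoothed δ ε).aestronglyMeasurable, ?_⟩
  rw [hasFiniteIntegral_iff_enorm]
  calc _ ≤ ∫⁻ q : E3 × E3, ENNReal.ofReal (2 ^ (1 + lam)) * (‖twoPoint ε u q.1 q.2‖ₑ
          * (xSup lam φ q.2 * ENNReal.ofReal (decayWeight lam q.1))) ∂(volume.prod volume) := by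
        refine lintegral_mono fun q => ?_
        rw [enorm_mul, mul_left_comm]
        gcongr
        exact MemX.enorm_smoothed_le hlam hδ hδ1 _ _ _
    _ ≤ ENNReal.ofReal (2 ^ (1 + lam)) * (2 * K * weightedMass lam * xNorm lam φ) := by
        rw [lintegral_const_mul' _ _ (by finiteness)]
        gcongr
        exact h.lintegral_twoPoint_mul_mul_le hK hu hlam ε hφ.measurable_xSup hφ.ae_xSup_lt_top
    _ < ∞ := ENNReal.mul_lt_top (by finiteness) (ENNReal.mul_lt_top (ENNReal.mul_lt_top
        (ENNReal.mul_lt_top (by simp) hK) (weightedMass_lt_top hlam)) hφ.norm_lt_top)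

/-- For fixed $y$ both errors are eventually below $\eta$ times the weight of exponent $\lambda/2$,
against which the two-point functions are bounded uniformly in $k$. -/
theorem tendsto_lintegral_twoPoint_mul_sub_smoothed {e : ℕ → ℝ} (he : ∀ k, 0 < e k)
    (he0 : Tendsto e atTop (𝓝 0)) {v : ℕ → E3 → ℂ} {K : ℝ≥0∞} (hK : K < ∞)
    (hv : ∀ k, MorreyBound (v k) K) (hm : ∀ k, MemLp (v k) 2 volume) {lam : ℝ} (hlam : 0 < lam)
    {φ : E3 → E3 → ℂ} (hφ : MemX lam φ) {y : E3}
    (hb : ∀ x, ‖φ x y‖ ≤ (xSup lam φ y).toReal * decayWeight lam x) :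
    Tendsto (fun k => ∫⁻ z, ‖twoPoint (e k) (v k) z y
      * (φ z y - smoothed (√(e k)) (e k) φ z y)‖ₑ) atTop (𝓝 0) := by
  set A := (xSup lam φ y).toReal with hA
  set W := 2 * K * weightedMass (lam / 2) with hW
  have hWf : W ≠ ∞ := ENNReal.mul_ne_top (ENNReal.mul_ne_top (by simp) hK.ne)
    (weightedMass_lt_top (by linarith)).ne
  set I : ℕ → ℝ := fun k => ∫ w, overlap (√(e k)) ((e k / 2) • y) w with hI
  have hI1 : Tendsto I atTop (𝓝 1) := tendsto_integral_overlap he he0 y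
  have hsq : Tendsto (fun k => √(e k)) atTop (𝓝 0) := by
    simpa [Function.comp_def] using (Real.continuous_sqrt.tendsto 0).comp he0
  have hkey : ∀ η : ℝ, 0 < η → ∀ᶠ k in atTop, ∫⁻ z, ‖twoPoint (e k) (v k) z y
      * (φ z y - smoothed (√(e k)) (e k) φ z y)‖ₑ ≤ ENNReal.ofReal (2 * η) * W := by
    intro η hη
    obtain ⟨r, hr0, hr⟩ := exists_weighted_modulus (hφ.continuous y) hlam hb hη
    have h1 : Tendsto (fun k => A * (1 - I k)) atTop (𝓝 0) := by
      simpa using (hI1.const_sub 1).const_mul A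
    filter_upwards [hsq.eventually_le_const hr0, h1.eventually_le_const hη] with k hk1 hk2
    calc _ ≤ ∫⁻ z, ENNReal.ofReal (2 * η) * (‖twoPoint (e k) (v k) z y‖ₑ
            * ENNReal.ofReal (decayWeight (lam / 2) z)) := by
          refine lintegral_mono fun z => ?_
          rw [enorm_mul, mul_left_comm]
          gcongr
          rw [← ofReal_norm, ← ENNReal.ofReal_mul (by positivity)]
          refine ENNReal.ofReal_le_ofReal ((norm_sub_integral_mul_overlap_le (hφ.continuous y) hlam
            hb hr (Real.sqrt_pos.2 (he k)) hk1 hη.le _ z).trans ?_)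
          refine mul_le_mul_of_nonneg_right ?_ (decayWeight_pos _ _).le
          linarith
      _ ≤ _ := by
          rw [lintegral_const_mul' _ _ ENNReal.ofReal_ne_top]
          gcongr
          exact (hv k).lintegral_twoPoint_le (hm k).1 (by linarith) _ _
  rw [ENNReal.tendsto_nhds_zero]
  intro τ hτ
  have hlim : Tendsto (fun η : ℝ => ENNReal.ofReal (2 * η) * W) (𝓝[>] 0) (𝓝 0) := by
    have h1 : Tendsto (fun η : ℝ => ENNReal.ofReal (2 * η)) (𝓝[>] 0) (𝓝 0) := by
      have : Continuous fun η : ℝ => ENNReal.ofReal (2 * η) :=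
        ENNReal.continuous_ofReal.comp (by fun_prop)
      simpa using (this.tendsto 0).mono_left nhdsWithin_le_nhds
    simpa using ENNReal.Tendsto.mul_const h1 (Or.inr hWf)
  obtain ⟨η, h1, h2⟩ := ((hlim.eventually_le_const hτ).and self_mem_nhdsWithin).exists
  filter_upwards [hkey η h2] with k hk using hk.trans h1

/-- Dominated convergence in $y$: the inner integrals tend to zero for almost every $y$ and are
bounded by a multiple of the integrable function `xSup lam φ`. -/
theorem tendsto_wignerBracket_sub_smoothed {e : ℕ → ℝ} (he : ∀ k, 0 < e k) (he1 : ∀ k, e k ≤ 1)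
    (he0 : Tendsto e atTop (𝓝 0)) {v : ℕ → E3 → ℂ} {K : ℝ≥0∞} (hK : K < ∞)
    (hv : ∀ k, MorreyBound (v k) K) (hm : ∀ k, MemLp (v k) 2 volume) {lam : ℝ} (hlam : 0 < lam)
    {φ : E3 → E3 → ℂ} (hφ : MemX lam φ) :
    Tendsto (fun k => wignerBracket (e k) (v k) φ
      - wignerBracket (e k) (v k) (smoothed (√(e k)) (e k) φ)) atTop (𝓝 0) := by
  have hδ : ∀ k, 0 < √(e k) := fun k => Real.sqrt_pos.2 (he k)
  have hδ1 : ∀ k, √(e k) ≤ 1 := fun k => Real.sqrt_le_one.2 (he1 k)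
  set D : ℕ → E3 × E3 → ℂ := fun k p => twoPoint (e k) (v k) p.1 p.2
    * (φ p.1 p.2 - smoothed (√(e k)) (e k) φ p.1 p.2) with hD
  have hDm : ∀ k, AEStronglyMeasurable (D k) (volume.prod volume) := fun k =>
    (measurable_twoPoint (hm k).1).mul
      (hφ.measurable.stronglyMeasurable.sub (hφ.measurable_smoothed _ _)).aestronglyMeasurable
  have hdiff : ∀ k, wignerBracket (e k) (v k) φ
      - wignerBracket (e k) (v k) (smoothed (√(e k)) (e k) φ) = ∫ p, D k p ∂(volume.prod volume) := by
    intro k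
    rw [wignerBracket, wignerBracket, ← Measure.volume_eq_prod, ← integral_sub
      ((hv k).integrable_and_norm_wignerBracket_le hK (hm k).1 hlam (e k) hφ).1
      ((hv k).integrable_twoPoint_mul_smoothed hK (hm k).1 (hδ k) (hδ1 k) (e k) hlam hφ)]
    exact integral_congr_ae (Eventually.of_forall fun p => by simp only [hD]; ring)
  set c := ENNReal.ofReal (2 ^ (1 + lam)) with hc
  set W := (1 + c) * (2 * K * weightedMass lam) with hW
  have hWf : W ≠ ∞ := ENNReal.mul_ne_top (by finiteness) (ENNReal.mul_ne_top
    (ENNReal.mul_ne_top (by simp) hK.ne) (weightedMass_lt_top hlam).ne)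
  have hbound : ∀ k, ∀ᵐ y, ∫⁻ z, ‖D k (z, y)‖ₑ ≤ W * xSup lam φ y := by
    intro k
    filter_upwards [hφ.ae_xSup_lt_top] with y hy
    calc ∫⁻ z, ‖D k (z, y)‖ₑ ≤ ∫⁻ z, (1 + c) * xSup lam φ y * (‖twoPoint (e k) (v k) z y‖ₑ
            * ENNReal.ofReal (decayWeight lam z)) := by
          refine lintegral_mono fun z => ?_
          rw [hD, enorm_mul, mul_left_comm]
          gcongr
          calc _ ≤ ‖φ z y‖ₑ + ‖smoothed (√(e k)) (e k) φ z y‖ₑ := enorm_sub_le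
            _ ≤ xSup lam φ y * ENNReal.ofReal (decayWeight lam z)
                + c * (xSup lam φ y * ENNReal.ofReal (decayWeight lam z)) :=
                add_le_add (enorm_le_xSup hlam φ z y)
                  (MemX.enorm_smoothed_le hlam (hδ k) (hδ1 k) _ _ _)
            _ = _ := by ring
      _ ≤ (1 + c) * xSup lam φ y * (2 * K * weightedMass lam) := by
          rw [lintegral_const_mul' _ _ (ENNReal.mul_ne_top (by finiteness) hy.ne)]
          gcongr
          exact (hv k).lintegral_twoPoint_le (hm k).1 hlam _ _
      _ = _ := by rw [hW]; ring
  have hlim : Tendsto (fun k => ∫⁻ p, ‖D k p‖ₑ ∂(volume.prod volume)) atTop (𝓝 0) := by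
    have h1 := tendsto_lintegral_of_dominated_convergence' (μ := (volume : Measure E3))
      (F := fun k y => ∫⁻ z, ‖D k (z, y)‖ₑ) (f := fun _ => 0) (fun y => W * xSup lam φ y)
      (fun k => (hDm k).enorm.lintegral_prod_left') hbound
      (by
        rw [lintegral_const_mul' _ _ hWf]
        exact ENNReal.mul_ne_top hWf hφ.norm_lt_top.ne)
      (by
        filter_upwards [hφ.ae_norm_le hlam] with y hb
        exact tendsto_lintegral_twoPoint_mul_sub_smoothed he he0 hK hv hm hlam hφ hb)
    simp only [lintegral_zero] at h1
    exact h1.congr fun k => (lintegral_prod_symm _ (hDm k).enorm).symm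
  have hlim' := (ENNReal.tendsto_toReal ENNReal.zero_ne_top).comp hlim
  refine squeeze_zero_norm' ?_ hlim'
  filter_upwards [hlim.eventually_lt_const (u := ∞) ENNReal.zero_lt_top] with k hk
  rw [hdiff, ← toReal_enorm]
  exact ENNReal.toReal_mono hk.ne (enorm_integral_le_lintegral_enorm _)

/-! ### Vague compactness -/

/-- Bounded sequences of measures are sequentially compact for the topology of pairings with the
continuous functions vanishing at infinity. -/
theorem exists_subseq_tendsto_integral {V : Type*} [NormedAddCommGroup V] [NormedSpace ℝ V]
    [FiniteDimensional ℝ V] [MeasurableSpace V] [BorelSpace V] (m : ℕ → Measure V) {N : ℝ≥0}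
    (hm : ∀ k, m k univ ≤ N) :
    ∃ θ : ℕ → ℕ, StrictMono θ ∧ ∃ n : Measure V, IsFiniteMeasure n ∧
      ∀ f : V → ℂ, Continuous f → Tendsto f (cocompact V) (𝓝 0) →
        Tendsto (fun k => ∫ x, f x ∂m (θ k)) atTop (𝓝 (∫ x, f x ∂n)) := by
  -- Needed only to divide by `N`.
  wlog hN : N ≠ 0 generalizing N
  · exact this (N := N + 1) (fun k => (hm k).trans (by simp)) (by positivity)
  let _ : MeasurableSpace (OnePoint V) := borel _
  have : BorelSpace (OnePoint V) := ⟨rfl⟩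
  -- The one-point compactification is a sphere, hence metrizable and second countable, so
  -- compactness of its probability measures is sequential.
  let h := onePointEquivSphereOfFinrankEq (V := V) (ι := Fin (Module.finrank ℝ V + 1)) (by simp)
  have : TopologicalSpace.MetrizableSpace (OnePoint V) := h.isEmbedding.metrizableSpace
  have : SecondCountableTopology (OnePoint V) := h.isEmbedding.secondCountableTopology
  have hemb : MeasurableEmbedding ((↑) : V → OnePoint V) :=
    OnePoint.isOpenEmbedding_coe.measurableEmbedding
  have hN' : (N : ℝ≥0∞) ≠ 0 := by exact_mod_cast hN
  -- The deficit in mass is placed at infinity to obtain probability measures.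
  let ν : ℕ → ProbabilityMeasure (OnePoint V) := fun k =>
    ⟨(N : ℝ≥0∞)⁻¹ • ((m k).map (↑) + (N - m k univ) • Measure.dirac OnePoint.infty), ⟨by
      rw [Measure.smul_apply, Measure.add_apply, hemb.map_apply, Measure.smul_apply,
        Measure.dirac_apply_of_mem (mem_univ _), preimage_univ, smul_eq_mul, smul_eq_mul, mul_one,
        add_tsub_cancel_of_le (hm k), ENNReal.inv_mul_cancel hN' ENNReal.coe_ne_top]⟩⟩
  obtain ⟨ρ, -, θ, hθ, hlim⟩ := isCompact_univ.tendsto_subseq (x := ν) fun _ => mem_univ _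
  have hfin : IsFiniteMeasure ((ρ : Measure (OnePoint V)).comap ((↑) : V → OnePoint V)) := ⟨by
    rw [hemb.comap_apply]; exact measure_lt_top _ _⟩
  refine ⟨θ, hθ, (N : ℝ≥0∞) • (ρ : Measure (OnePoint V)).comap (↑),
    Measure.smul_finite _ ENNReal.coe_ne_top, fun f hf hf0 => ?_⟩
  have hf0' : Tendsto f (coclosedCompact V) (𝓝 0) := by rwa [coclosedCompact_eq_cocompact]
  let F : C(OnePoint V, ℂ) := OnePoint.continuousMapMk ⟨f, hf⟩ 0 hf0'
  have hFc : ∀ x : V, F x = f x := fun x => rfl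
  have hFi : F OnePoint.infty = 0 := rfl
  have h1 := (ProbabilityMeasure.tendsto_iff_forall_integral_rclike_tendsto ℂ).1 hlim
    (BoundedContinuousFunction.mkOfCompact F)
  simp only [BoundedContinuousFunction.mkOfCompact_apply] at h1
  have hν : ∀ k, ∫ x, F x ∂(ν k : Measure (OnePoint V)) = (N : ℝ)⁻¹ * ∫ x, f x ∂m k := by
    intro k
    have i1 : IsFiniteMeasure (m k) := ⟨(hm k).trans_lt ENNReal.coe_lt_top⟩
    have i2 : Integrable F ((m k).map ((↑) : V → OnePoint V)) :=
      (BoundedContinuousFunction.mkOfCompact F).integrable _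
    have i3 : Integrable F ((N - m k univ) • Measure.dirac (OnePoint.infty : OnePoint V)) :=
      ((BoundedContinuousFunction.mkOfCompact F).integrable _).smul_measure (by finiteness)
    simp only [ν, ProbabilityMeasure.coe_mk]
    rw [integral_smul_measure, integral_add_measure i2 i3, hemb.integral_map, integral_smul_measure,
      integral_dirac, hFi]
    simp [hFc]
  have hρ : ∫ x, f x ∂((N : ℝ≥0∞) • (ρ : Measure (OnePoint V)).comap ((↑) : V → OnePoint V))
      = N * ∫ x, F x ∂(ρ : Measure (OnePoint V)) := by
    have e1 : ∫ x, F x ∂((ρ : Measure (OnePoint V)).comap ((↑) : V → OnePoint V)).map (↑)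
        = ∫ x, F x ∂(ρ : Measure (OnePoint V)) := by
      rw [hemb.map_comap]
      -- The limit may charge the point at infinity, but functions vanishing there do not see it.
      refine setIntegral_eq_integral_of_forall_compl_eq_zero fun x hx => ?_
      induction x with
      | infty => exact hFi
      | coe x => exact absurd (mem_range_self x) hx
    rw [hemb.integral_map] at e1
    rw [integral_smul_measure, ← e1]
    simp [hFc]
  rw [hρ]
  refine (h1.const_mul (N : ℂ)).congr fun k => ?_
  rw [Function.comp_apply, hν, ← mul_assoc]
  have : (N : ℂ) ≠ 0 := by exact_mod_cast hN
  simp [this]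

/-- Vague compactness for measures on phase space with uniformly bounded weighted mass. -/
theorem exists_subseq_tendsto_integral_of_lintegral_decayWeight_le {p : ℝ}
    (m : ℕ → Measure (E3 × E3)) {N : ℝ≥0}
    (hm : ∀ k, ∫⁻ x, ENNReal.ofReal (decayWeight p x.1) ∂m k ≤ N) :
    ∃ θ : ℕ → ℕ, StrictMono θ ∧ ∃ μ : Measure (E3 × E3), IsLocallyFiniteMeasure μ ∧
      ∀ f : E3 × E3 → ℂ, Continuous f →
        Tendsto (fun x => (((1 + ‖x.1‖) ^ (1 + p) : ℝ) : ℂ) * f x) (cocompact (E3 × E3)) (𝓝 0) →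
        Integrable f μ ∧
          Tendsto (fun k => ∫ x, f x ∂m (θ k)) atTop (𝓝 (∫ x, f x ∂μ)) := by
  set W : E3 × E3 → ℝ := fun x => (1 + ‖x.1‖) ^ (1 + p) with hW
  have hWc : Continuous W := Continuous.rpow_const (by fun_prop) fun x => Or.inl (by positivity)
  have hW0 : ∀ x, 0 ≤ W x := fun x => by positivity
  have hWd : ∀ x, decayWeight p x.1 * W x = 1 := fun x => by
    simp only [hW, decayWeight]
    rw [← Real.rpow_add (by positivity)]
    simp
  have hdm : Measurable fun x : E3 × E3 => ENNReal.ofReal (decayWeight p x.1) := by fun_prop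
  -- Compactness is applied to the weighted measures, which are finite. The limit is then divided by
  -- the weight, and test functions are multiplied by its inverse.
  obtain ⟨θ, hθ, n, hn, hlim⟩ := exists_subseq_tendsto_integral
    (fun k => (m k).withDensity fun x => ENNReal.ofReal (decayWeight p x.1)) (N := N) fun k => by
      rw [withDensity_apply _ MeasurableSet.univ, Measure.restrict_univ]; exact hm k
  refine ⟨θ, hθ, n.withDensity fun x => ENNReal.ofReal (W x),
    IsLocallyFiniteMeasure.withDensity_ofReal hWc, fun f hf hf0 => ?_⟩
  have hgc : Continuous fun x => (W x : ℂ) * f x := (Complex.continuous_ofReal.comp hWc).mul hf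
  have hWm : Measurable fun x => ENNReal.ofReal (W x) := hWc.measurable.ennreal_ofReal
  have hsm : ∀ x, (ENNReal.ofReal (W x)).toReal • f x = (W x : ℂ) * f x := fun x => by
    rw [ENNReal.toReal_ofReal (hW0 x), Complex.real_smul]
  constructor
  · rw [integrable_withDensity_iff_integrable_smul' hWm (Eventually.of_forall fun x => by finiteness)]
    simp only [hsm]
    let g : ZeroAtInftyContinuousMap (E3 × E3) ℂ := ⟨⟨_, hgc⟩, hf0⟩
    exact g.toBCF.integrable n
  · rw [integral_withDensity_eq_integral_toReal_smul hWm (Eventually.of_forall fun x => by finiteness)]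
    simp only [hsm]
    refine (hlim _ hgc hf0).congr fun k => ?_
    rw [integral_withDensity_eq_integral_toReal_smul hdm (Eventually.of_forall fun x => by finiteness)]
    refine integral_congr_ae (Eventually.of_forall fun x => ?_)
    simp only []
    rw [ENNReal.toReal_ofReal (decayWeight_pos _ _).le, Complex.real_smul, ← mul_assoc,
      ← Complex.ofReal_mul, hWd, Complex.ofReal_one, one_mul]

/-- Upper bounds for the mass of an open set pass to vague limits. -/
theorem measure_le_of_tendsto_integral {V : Type*} [TopologicalSpace V] [MeasurableSpace V]
    [BorelSpace V] [R1Space V] [LocallyCompactSpace V] {m : ℕ → Measure V} {μ : Measure V}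
    [μ.Regular] {U : Set V} (hU : IsOpen U) {B : ℝ≥0∞} (hB : ∀ᶠ k in atTop, m k U ≤ B)
    (hlim : ∀ f : V → ℂ, Continuous f → HasCompactSupport f → Integrable f μ ∧
      Tendsto (fun k => ∫ x, f x ∂m k) atTop (𝓝 (∫ x, f x ∂μ))) :
    μ U ≤ B := by
  rcases eq_or_ne B ∞ with rfl | hBf
  · exact le_top
  rw [hU.measure_eq_iSup_isCompact]
  refine iSup_le fun T => iSup_le fun hTU => iSup_le fun hT => ?_
  -- A Urysohn function between a compact subset and the open set. Inner regularity then exhausts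
  -- `U`.
  obtain ⟨f, hf1, hfc, hfU, hf01⟩ := exists_continuousMap_one_of_isCompact_subset_isOpen hT hU hTU
  have hfc' : HasCompactSupport fun x => (f x : ℂ) :=
    HasCompactSupport.comp_left (f := f) (g := Complex.ofReal) hfc (by simp)
  obtain ⟨hi, hl⟩ := hlim (fun x => (f x : ℂ)) (by fun_prop) hfc'
  have hir : Integrable f μ := by simpa using hi.re
  have hle : ∀ᶠ k in atTop, ‖∫ x, (f x : ℂ) ∂m k‖ ≤ B.toReal := by
    filter_upwards [hB] with k hk
    rw [← toReal_enorm]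
    refine ENNReal.toReal_mono hBf ((enorm_integral_le_lintegral_enorm _).trans (le_trans ?_ hk))
    rw [← lintegral_indicator_one hU.measurableSet]
    refine lintegral_mono fun x => ?_
    by_cases hx : x ∈ U
    · rw [indicator_of_mem hx, ← ofReal_norm, Complex.norm_real, Real.norm_of_nonneg (hf01 x).1]
      exact ENNReal.ofReal_le_one.2 (hf01 x).2
    · have : f x = 0 := by
        by_contra h
        exact hx (hfU (subset_tsupport _ h))
      simp [this]
  have hlimle := le_of_tendsto hl.norm hle
  rw [integral_complex_ofReal, Complex.norm_real,
    Real.norm_of_nonneg (integral_nonneg fun x => (hf01 x).1)] at hlimle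
  calc μ T = ∫⁻ x in T, 1 ∂μ := by simp
    _ ≤ ∫⁻ x in T, ENNReal.ofReal (f x) ∂μ := by
        refine setLIntegral_mono f.continuous.measurable.ennreal_ofReal fun x hx => ?_
        rw [hf1 hx]; simp
    _ ≤ ∫⁻ x, ENNReal.ofReal (f x) ∂μ := setLIntegral_le_lintegral _ _
    _ = ENNReal.ofReal (∫ x, f x ∂μ) :=
        (ofReal_integral_eq_lintegral_ofReal hir (Eventually.of_forall fun x => (hf01 x).1)).symm
    _ ≤ B := by rw [← ENNReal.ofReal_toReal hBf]; exact ENNReal.ofReal_le_ofReal hlimle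

/-! ### Behaviour of symbols at infinity -/

/-- The Riemann–Lebesgue lemma, after rescaling the frequency by $-1/(2\pi)$. -/
theorem tendsto_fourierInv3_cocompact (g : E3 → ℂ) :
    Tendsto (fourierInv3 g) (cocompact E3) (𝓝 0) := by
  have hc : (-(2 * Real.pi)⁻¹ : ℝ) ≠ 0 := neg_ne_zero.2 (by positivity)
  have h := (tendsto_integral_exp_inner_smul_cocompact g).comp
    (Homeomorph.smulOfNeZero (α := E3) _ hc).isClosedEmbedding.tendsto_cocompact
  refine h.congr fun ξ => integral_congr_ae (Eventually.of_forall fun y => ?_)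
  simp only [Homeomorph.smulOfNeZero_apply, inner_smul_right, Circle.smul_def, smul_eq_mul,
    Real.fourierChar_apply]
  congr 2
  push_cast
  have : (Real.pi : ℂ) ≠ 0 := by exact_mod_cast Real.pi_ne_zero
  field_simp

/-- The map $x\mapsto\varphi(x,\cdot)$ is continuous into $L^1$, which makes the Riemann–Lebesgue
lemma locally uniform in $x$. -/
theorem MemX.eventually_norm_fourierInv3_lt {lam : ℝ} {φ : E3 → E3 → ℂ} (hφ : MemX lam φ)
    (hlam : 0 < lam) (x₀ : E3) {η : ℝ} (hη : 0 < η) :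
    ∀ᶠ p : E3 × E3 in 𝓝 x₀ ×ˢ cocompact E3, ‖fourierInv3 (φ p.1) p.2‖ < η := by
  have hcont : Continuous fun x => ∫ y, ‖φ x y - φ x₀ y‖ := by
    refine continuous_of_dominated (bound := fun y => (xSup lam φ y).toReal + (xSup lam φ y).toReal)
      (fun x => ((hφ.integrable hlam x).sub (hφ.integrable hlam x₀)).norm.1) (fun x => ?_)
      (hφ.integrable_xSup.add hφ.integrable_xSup) (Eventually.of_forall fun y => ?_)
    · filter_upwards [hφ.ae_norm_le hlam] with y hy
      have : ∀ x, ‖φ x y‖ ≤ (xSup lam φ y).toReal := fun x =>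
        (hy x).trans (mul_le_of_le_one_right ENNReal.toReal_nonneg (decayWeight_le_one hlam _))
      rw [norm_norm]
      exact (norm_sub_le _ _).trans (add_le_add (this x) (this x₀))
    · have := hφ.continuous y
      fun_prop
  have h1 : ∀ᶠ x in 𝓝 x₀, ∫ y, ‖φ x y - φ x₀ y‖ < η / 2 := by
    refine (hcont.tendsto x₀).eventually_lt_const ?_
    simpa using hη
  have h2 : ∀ᶠ ξ in cocompact E3, ‖fourierInv3 (φ x₀) ξ‖ < η / 2 :=
    (tendsto_fourierInv3_cocompact (φ x₀)).norm.eventually_lt_const (by simpa using hη)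
  filter_upwards [h1.prod_mk h2] with p hp
  have hi : ∀ x, Integrable fun y => Complex.exp (Complex.I * (inner ℝ y p.2 : ℝ)) * φ x y := by
    intro x
    refine (hφ.integrable hlam x).bdd_mul (c := 1) (Continuous.aestronglyMeasurable (by fun_prop))
      (Eventually.of_forall fun y => ?_)
    rw [mul_comm Complex.I, Complex.norm_exp_ofReal_mul_I]
  have h3 : ‖fourierInv3 (φ p.1) p.2 - fourierInv3 (φ x₀) p.2‖ ≤ ∫ y, ‖φ p.1 y - φ x₀ y‖ := by
    rw [fourierInv3, fourierInv3, ← integral_sub (hi _) (hi _)]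
    refine (norm_integral_le_integral_norm _).trans (le_of_eq ?_)
    refine integral_congr_ae (Eventually.of_forall fun y => ?_)
    simp only [← mul_sub]
    rw [norm_mul, mul_comm Complex.I, Complex.norm_exp_ofReal_mul_I, one_mul]
  calc ‖fourierInv3 (φ p.1) p.2‖
      ≤ ‖fourierInv3 (φ p.1) p.2 - fourierInv3 (φ x₀) p.2‖ + ‖fourierInv3 (φ x₀) p.2‖ := by
        simpa using norm_add_le (fourierInv3 (φ p.1) p.2 - fourierInv3 (φ x₀) p.2)
          (fourierInv3 (φ x₀) p.2)
    _ < η := by linarith [hp.1, hp.2]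

/-- Elements of `X_λ` vanish at infinity in phase space, with some spatial decay. -/
theorem MemX.tendsto_weight_mul_fourierInv3 {lam : ℝ} {φ : E3 → E3 → ℂ} (hφ : MemX lam φ)
    (hlam : 0 < lam) :
    Tendsto (fun p : E3 × E3 => (((1 + ‖p.1‖) ^ (1 + lam / 2) : ℝ) : ℂ) * fourierInv3 (φ p.1) p.2)
      (cocompact (E3 × E3)) (𝓝 0) := by
  set N := (xNorm lam φ).toReal with hN
  have hb : ∀ p : E3 × E3, ‖(((1 + ‖p.1‖) ^ (1 + lam / 2) : ℝ) : ℂ) * fourierInv3 (φ p.1) p.2‖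
      = (1 + ‖p.1‖) ^ (1 + lam / 2) * ‖fourierInv3 (φ p.1) p.2‖ := fun p => by
    rw [norm_mul, Complex.norm_real, Real.norm_of_nonneg (by positivity)]
  rw [NormedAddGroup.tendsto_nhds_zero]
  intro η hη
  have h1 : Tendsto (fun t : ℝ => N * (1 + t) ^ (-(lam / 2))) atTop (𝓝 0) := by
    have := (tendsto_rpow_neg_atTop (y := lam / 2) (by linarith)).comp
      (tendsto_atTop_add_const_left atTop (1 : ℝ) tendsto_id)
    simpa using this.const_mul N
  obtain ⟨R, hR0, hR⟩ : ∃ R : ℝ, 0 ≤ R ∧ ∀ t, R ≤ t → N * (1 + t) ^ (-(lam / 2)) < η := by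
    obtain ⟨R, hR⟩ := eventually_atTop.1 (h1.eventually_lt_const hη)
    exact ⟨max R 0, le_max_right _ _, fun t ht => hR t ((le_max_left _ _).trans ht)⟩
  set c := (1 + R) ^ (1 + lam / 2) with hc
  have hc0 : 0 < c := by positivity
  -- For $|x|>R$ the spare decay of order $\lambda/2$ already suffices. For $|x|\le R$ the local
  -- statements are glued by compactness.
  have h2 := (isCompact_closedBall (0 : E3) R).mem_nhdsSet_prod_of_forall fun x _ =>
    hφ.eventually_norm_fourierInv3_lt hlam x (div_pos hη hc0)
  obtain ⟨s, hs, t, ht, hst⟩ := mem_prod_iff.1 h2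
  obtain ⟨T, hT, hTt⟩ := mem_cocompact.1 ht
  refine mem_cocompact.2 ⟨_, (isCompact_closedBall (0 : E3) R).prod hT, fun p hp => ?_⟩
  simp only [mem_ofPred_eq, hb]
  rcases le_or_gt ‖p.1‖ R with hpR | hpR
  · have hp1 : p.1 ∈ Metric.closedBall (0 : E3) R := by simpa using hpR
    have hp2 : p.2 ∉ T := fun h => hp ⟨hp1, h⟩
    have h3 : ‖fourierInv3 (φ p.1) p.2‖ < η / c := hst ⟨subset_of_mem_nhdsSet hs hp1, hTt hp2⟩
    calc _ ≤ c * ‖fourierInv3 (φ p.1) p.2‖ := by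
          gcongr
          exact Real.rpow_le_rpow (by positivity) (by linarith) (by linarith)
      _ < c * (η / c) := by gcongr
      _ = η := by field_simp
  · calc _ ≤ (1 + ‖p.1‖) ^ (1 + lam / 2) * (N * decayWeight lam p.1) := by
          gcongr
          exact hφ.norm_fourierInv3_le hlam _ _
      _ = N * (1 + ‖p.1‖) ^ (-(lam / 2)) := by
          rw [mul_left_comm, decayWeight, ← Real.rpow_add (by positivity)]
          congr 2
          ring
      _ < η := hR _ hpR.le

/-! ### Convergence to a positive measure and conclusion -/

/-- Under uniform Morrey bounds, Wigner transforms converge along a subsequence to a positive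
measure, which satisfies the Morrey bound at every scale at which it holds eventually. -/
theorem exists_subseq_tendsto_wignerBracket {e : ℕ → ℝ} (he : ∀ k, 0 < e k) (he1 : ∀ k, e k ≤ 1)
    (he0 : Tendsto e atTop (𝓝 0)) {v : ℕ → E3 → ℂ} {K : ℝ≥0∞} (hK : K < ∞)
    (hv : ∀ k, MorreyBound (v k) K) (hm : ∀ k, MemLp (v k) 2 volume)
    (hK0 : ∀ R : ℝ, 0 < R → ∀ᶠ k in atTop, ∀ z,
      ∫⁻ x in Metric.ball z R, ‖v k x‖ₑ ^ 2 ≤ K * ENNReal.ofReal R)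
    {lam : ℝ} (hlam : 0 < lam) :
    ∃ θ : ℕ → ℕ, StrictMono θ ∧ ∃ μ : Measure (E3 × E3), IsLocallyFiniteMeasure μ ∧
      (∀ φ, MemX lam φ → Integrable (fun p : E3 × E3 => fourierInv3 (φ p.1) p.2) μ ∧
        Tendsto (fun k => wignerBracket (e (θ k)) (v (θ k)) φ) atTop
          (𝓝 (∫ p : E3 × E3, fourierInv3 (φ p.1) p.2 ∂μ))) ∧
      ∀ R : ℝ, 0 < R → μ (Metric.ball 0 R ×ˢ univ) ≤ K * ENNReal.ofReal R := by
  have hδ : ∀ k, 0 < √(e k) := fun k => Real.sqrt_pos.2 (he k)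
  have hδ1 : ∀ k, √(e k) ≤ 1 := fun k => Real.sqrt_le_one.2 (he1 k)
  have hl2 : 0 < lam / 2 := by linarith
  have hfin : K * weightedMass (lam / 2) ≠ ∞ := ENNReal.mul_ne_top hK.ne (weightedMass_lt_top hl2).ne
  set m : ℕ → Measure (E3 × E3) := fun k => husimi (√(e k)) (e k) (v k) with hmdef
  obtain ⟨θ, hθ, μ, hμ, hlim⟩ := exists_subseq_tendsto_integral_of_lintegral_decayWeight_le
    (p := lam / 2) m (N := (K * weightedMass (lam / 2)).toNNReal) fun k => by
      rw [ENNReal.coe_toNNReal hfin]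
      exact (hv k).lintegral_decayWeight_husimi_le (hm k) (hδ k) (e k) hl2
  refine ⟨θ, hθ, μ, hμ, fun φ hφ => ?_, fun R hR => ?_⟩
  · obtain ⟨h1, h2⟩ := hlim _ (hφ.continuous_fourierInv3 hlam)
      (hφ.tendsto_weight_mul_fourierInv3 hlam)
    refine ⟨h1, ?_⟩
    -- The Wigner bracket is the Husimi integral plus the error from smoothing, which tends to zero.
    have h3 := ((tendsto_wignerBracket_sub_smoothed he he1 he0 hK hv hm hlam hφ).comp
      hθ.tendsto_atTop).add h2
    rw [zero_add] at h3
    refine h3.congr fun k => ?_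
    simp only [Function.comp_apply, hmdef]
    rw [((hv (θ k)).integral_husimi_fourierInv3 hK (hm (θ k)) (hδ (θ k)) (hδ1 (θ k)) (e (θ k))
      hlam hφ).2, sub_add_cancel]
  · refine measure_le_of_tendsto_integral (m := fun k => m (θ k))
      (Metric.isOpen_ball.prod isOpen_univ) ?_ fun f hf hfc =>
        hlim f hf (HasCompactSupport.is_zero_at_infty hfc.mul_left)
    filter_upwards [hθ.tendsto_atTop.eventually (hK0 R hR)] with k hk
    exact husimi_ball_prod_univ_le (hm (θ k)) (hδ (θ k)) _ fun s => hk _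

theorem theorem4p1 :
    ∃ C : ℝ≥0, ∀ (q : E3), q ≠ 0 →
      ∀ (α : ℝ → ℝ), (∀ ε, 0 < ε → 0 < α ε) → Tendsto α (𝓝[>] 0) (𝓝 0) →
      ∀ (S₀ S₁ : E3 → ℂ), MemB S₀ → MemB S₁ →
      ∀ (u : ℝ → E3 → ℂ),
        (∀ ε, 0 < ε → IsHelmholtzSolution (α ε) ε (source S₀ S₁ q ε) (u ε)) →
      ∀ lam : ℝ, 0 < lam →
        -- the Wigner transforms are bounded in the dual of `X_λ`
        (∃ M : ℝ, ∀ ε, 0 < ε → ε ≤ 1 → ∀ φ, MemX lam φ →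
          Integrable (fun p : E3 × E3 => twoPoint ε (u ε) p.1 p.2 * φ p.1 p.2) ∧
          ‖wignerBracket ε (u ε) φ‖ ≤ M * (xNorm lam φ).toReal) ∧
        -- and converge weak-star along a subsequence, to a measure with the stated bound
        (∀ e : ℕ → ℝ, (∀ k, 0 < e k) → Tendsto e atTop (𝓝 0) →
          ∃ θ : ℕ → ℕ, StrictMono θ ∧ ∃ μ : Measure (E3 × E3),
            IsLocallyFiniteMeasure μ ∧
            (∀ φ, MemX lam φ →
              Integrable (fun p : E3 × E3 => fourierInv3 (φ p.1) p.2) μ ∧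
              Tendsto (fun k => wignerBracket (e (θ k)) (u (e (θ k))) φ) atTop
                (𝓝 (∫ p : E3 × E3, fourierInv3 (φ p.1) p.2 ∂μ))) ∧
            (⨆ (R : ℝ) (_ : 0 < R), μ ({x | ‖x‖ < R} ×ˢ univ) / ENNReal.ofReal R)
              ≤ C * (bNorm S₀ + bNorm S₁) ^ 2) := by
  refine ⟨128, fun q _ α hα _ S₀ S₁ h₀ h₁ u hu lam hlam => ?_⟩
  set K : ℝ≥0∞ := 128 * (bNorm S₀ + bNorm S₁) ^ 2 with hKdef
  have hK : K < ∞ := ENNReal.mul_lt_top (by simp)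
    (ENNReal.pow_lt_top (ENNReal.add_lt_top.2 ⟨h₀.2, h₁.2⟩))
  have hM : ∀ ε, 0 < ε → ε ≤ 1 → MorreyBound (u ε) K := fun ε hε hε1 =>
    morreyBound_of_helmholtz (hα ε hε) hε hε1 h₀ h₁ (hu ε hε)
  refine ⟨⟨(2 * K * weightedMass lam).toReal, fun ε hε hε1 φ hφ =>
    (hM ε hε hε1).integrable_and_norm_wignerBracket_le hK (hu ε hε).memLp.1 hlam ε hφ⟩,
    fun e he he0 => ?_⟩
  -- The uniform Morrey bound at radii $R\ge1$ requires $\varepsilon\le1$, so the first `n` terms of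
  -- the sequence are dropped.
  obtain ⟨n, hn⟩ := eventually_atTop.1 (he0.eventually_le_const zero_lt_one)
  have he0' : Tendsto (fun k => e (k + n)) atTop (𝓝 0) := (tendsto_add_atTop_iff_nat n).2 he0
  obtain ⟨θ, hθ, μ, hμ, hlim, hball⟩ := exists_subseq_tendsto_wignerBracket
    (e := fun k => e (k + n)) (v := fun k => u (e (k + n))) (fun k => he _)
    (fun k => hn _ (by omega)) he0' hK (fun k => hM _ (he _) (hn _ (by omega)))
    (fun k => (hu _ (he _)).memLp)
    -- A fixed radius, however small, eventually exceeds $\varepsilon_k$. This is what allows the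
    -- supremum over all $R>0$ in the limit.
    (fun R hR => by
      filter_upwards [he0'.eventually_le_const hR] with k hk z
      exact setLIntegral_ball_helmholtz_le (hα _ (he _)) (he _) h₀ h₁ (hu _ (he _)) z hk) hlam
  refine ⟨fun k => θ k + n, fun a b hab => Nat.add_lt_add_right (hθ hab) n, μ, hμ, hlim,
    iSup_le fun R => iSup_le fun hR => ENNReal.div_le_of_le_mul ?_⟩
  have hset : {x : E3 | ‖x‖ < R} = Metric.ball 0 R := by ext; simp
  rw [hset]
  exact_mod_cast hball R hR
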